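/- **Setting.** Let $\mathcal{G}_\ell$ consist of all single-qubit rotations $e^{itZ}$, $t\in\mathbb{R}$, and all controlled-phase gates $C^{(j)}(\theta)$, $2\le j\le \ell$, $\theta\in\mathbb{R}$, where $C^{(j)}(\theta)$ acts on $j$ qubits, multiplies $|1\cdots 1\rangle$ by $e^{i\theta}$ and fixes the other computational basis states. A noisy IQP circuit $\mathcal{C}$ of depth $d\ge 1$ on $n\ge 1$ qubits is given by $d$ layers of gates from $\mathcal{G}_\ell$, the gates of one layer acting on pairwise disjoint sets of qubits (with no geometric restriction), and by a strength $p\in(0,1]$. It starts in $|+\rangle\langle+|^{\otimes n}$. Each layer of gates is followed by the amplitude-damping channel $\mathcal{E}_p^{\otimes n}$, where $\mathcal{E}_p(\rho)=K_0\rho K_0^\dagger+K_1\rho K_1^\dagger$, $K_0=|0\rangle\langle0|+\sqrt{1-p}\,|1\rangle\langle1|$, $K_1=\sqrt p\,|0\rangle\langle1|$. Let $P_{\mathcal{C}}$ be the distribution on $\{+,-\}^n$ obtained by measuring every qubit of the final state in the Hadamard basis. A classical algorithm is a fixed program for a random-access machine with fair coin tosses and integer arrays. Every operation is charged the bit lengths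 of the numbers involved, and multiplication and division the product of the bit lengths. The input consists of $n$, $d$, $\lceil 1/\epsilon\rceil$ and, layer by layer, the qubits on which each gate acts, all with random access, and of the real numbers $p$ and the gate angles modulo $2\pi$, of which the machine can read $\lfloor 2^b r\rfloor$ at a cost of at least $b$. **Theorem.** There is an absolute constant $K>0$ such that the following holds with $d_T = K\,\log(n)/\log\big((1-p)^{-1}\big)$ (read as $d_T=0$ for $p=1$). For every $\ell$ and every constant $p_0>0$ there are a classical algorithm and a polynomial $q$ such that, for all $n\ge 1$, all $p\in[p_0,1]$, all $\epsilon>0$ and all noisy IQP circuits $\mathcal{C}$ over $\mathcal{G}_\ell$ on $n$ qubits with noise strength $p$ and depth $d\ge\max(1,d_T)$, the algorithm outputs a sample from a distribution $Q_{\mathcal{C}}$ on $\{+,-\}^n$ with $$\|Q_{\mathcal{C}}-P_{\mathcal{C}}\|_{TVD}=\tfrac12\sum_x|Q_{\mathcal{C}}(x)-P_{\mathcal{C}}(x)|\le\epsilon ,$$ and its worst-case running time (over all outcomes of the coin tosses) is at most $n^3\,d\;q(1/\epsilon)$. -/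

import Mathlib

/-! ## Noisy IQP circuits

Basis states of `n` qubits are labelled by `Fin n → Bool`, with `false` for `|0⟩` and `true`
for `|1⟩`. -/

namespace IQP

/-- Operators on `n` qubits, as matrices in the computational basis. -/
abbrev Op (n : ℕ) := Matrix (Fin n → Bool) (Fin n → Bool) ℂ

/-- The tensor product of `n` single-qubit operators. -/
noncomputable def tensor {n : ℕ} (A : Fin n → Matrix Bool Bool ℂ) : Op n :=
  Matrix.of fun x y => ∏ i, A i (x i) (y i)

/-- The gates: `zRot t i` is `e^{itZ}` on qubit `i`; `cPhase θ s` is the controlled-phase gate on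
the set `s` of qubits, which multiplies by `e^{iθ}` the basis states that are `1` on all of `s`. -/
inductive Gate (n : ℕ) where
  | zRot (t : ℝ) (i : Fin n)
  | cPhase (θ : ℝ) (s : Finset (Fin n))

namespace Gate

variable {n : ℕ}

/-- The set of qubits on which a gate acts. -/
def support : Gate n → Finset (Fin n)
  | zRot _ i => {i}
  | cPhase _ s => s

/-- The angle of a gate. -/
def angle : Gate n → ℝ
  | zRot t _ => t
  | cPhase θ _ => θ

/-- The unitary of a gate. -/
noncomputable def unitary : Gate n → Op n
  | zRot t i => Matrix.diagonal fun x =>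
      Complex.exp (Complex.I * (t : ℂ) * (if x i then -1 else 1))
  | cPhase θ s => Matrix.diagonal fun x =>
      if ∀ i ∈ s, x i = true then Complex.exp (Complex.I * (θ : ℂ)) else 1

/-- Membership in the gate set `𝒢_ℓ`: all single-qubit `Z`-rotations, and the controlled-phase
gates on `j` qubits for `2 ≤ j ≤ ℓ`. -/
def InGateSet (l : ℕ) : Gate n → Prop
  | zRot _ _ => True
  | cPhase _ s => 2 ≤ s.card ∧ s.card ≤ l

end Gate

/-- An IQP circuit on `n` qubits over `𝒢_ℓ`: a list of layers, the gates of one layer acting on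
pairwise disjoint sets of qubits. -/
structure Circuit (n l : ℕ) where
  layers : List (List (Gate n))
  inGateSet : ∀ L ∈ layers, ∀ g ∈ L, g.InGateSet l
  disjoint : ∀ L ∈ layers, L.Pairwise fun g h => Disjoint g.support h.support

/-- The depth: the number of layers. -/
def Circuit.depth {n l : ℕ} (C : Circuit n l) : ℕ := C.layers.length

/-- The unitary of a layer (the gates are diagonal, so their order is irrelevant). -/
noncomputable def layerUnitary {n : ℕ} (L : List (Gate n)) : Op n := (L.map Gate.unitary).prod

/-- The Kraus operators `K₀ = |0⟩⟨0| + √(1-p) |1⟩⟨1|` (index `false`) and `K₁ = √p |0⟩⟨1|`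
(index `true`) of the single-qubit amplitude-damping channel of strength `p`. -/
noncomputable def kraus (p : ℝ) : Bool → Matrix Bool Bool ℂ
  | false => Matrix.diagonal fun b => if b then (Real.sqrt (1 - p) : ℂ) else 1
  | true => Matrix.single false true (Real.sqrt p : ℂ)

/-- The channel `ℰ_p^{⊗ n}`. -/
noncomputable def noise {n : ℕ} (p : ℝ) (ρ : Op n) : Op n :=
  ∑ s : Fin n → Bool,
    tensor (fun i => kraus p (s i)) * ρ * (tensor fun i => kraus p (s i)).conjTranspose

/-- The state `|+⟩⟨+|^{⊗ n}`. -/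
noncomputable def plusState (n : ℕ) : Op n := tensor fun _ => Matrix.of fun _ _ => 1 / 2

/-- One noisy layer: the unitary of the layer, then amplitude damping on every qubit. -/
noncomputable def noisyLayer {n : ℕ} (p : ℝ) (ρ : Op n) (L : List (Gate n)) : Op n :=
  noise p (layerUnitary L * ρ * (layerUnitary L).conjTranspose)

/-- The output state of the noisy circuit started in `|+⟩⟨+|^{⊗ n}`. -/
noncomputable def outputState {n l : ℕ} (C : Circuit n l) (p : ℝ) : Op n :=
  C.layers.foldl (noisyLayer p) (plusState n)

/-- The Hadamard-basis vector `H^{⊗ n} |x⟩`. -/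
noncomputable def hadamardVec {n : ℕ} (x : Fin n → Bool) : (Fin n → Bool) → ℂ :=
  fun y => ∏ i, (if x i && y i then -1 else 1) / (Real.sqrt 2 : ℂ)

/-- The Born-rule distribution `P_𝒞` of a Hadamard-basis measurement of the output state; the
outcome bit `false` stands for `+` and `true` for `-`. -/
noncomputable def bornProb {n l : ℕ} (C : Circuit n l) (p : ℝ) (x : Fin n → Bool) : ℝ :=
  (star (hadamardVec x) ⬝ᵥ (outputState C p).mulVec (hadamardVec x)).re

/-- Total variation distance. -/
noncomputable def tvd {α : Type} [Fintype α] (Q : PMF α) (P : α → ℝ) : ℝ :=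
  (1 / 2) * ∑ x, |(Q x).toReal - P x|

end IQP

/-! ## Randomized random-access machines with bit costs

Programs are while-programs over finitely many integer arrays, with fair coins. Every operation is
charged the bit lengths of the numbers it touches; multiplication and division are charged the
product of the bit lengths. Integer data are read from a random-access list. Real data are read
through binary expansions: obtaining `b` binary places of a real number costs at least `b`. -/

namespace RAM

/-- The data of a problem instance. -/
structure Data where
  ints : List ℤ
  reals : List ℝ

/-- Expressions. `get a i` is entry `i` of array `a`, `int i` is the `i`-th integer of the data,
and `real j b` is the `j`-th real number of the data, to `b` binary places. -/
inductive Expr where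
  | lit (c : ℤ)
  | get (a : ℕ) (i : Expr)
  | int (i : Expr)
  | real (j b : Expr)
  | add (e f : Expr)
  | sub (e f : Expr)
  | mul (e f : Expr)
  | div (e f : Expr)

/-- Programs. Tests are of the form `0 < e`. -/
inductive Prog where
  | skip
  | set (a : ℕ) (i e : Expr)
  | flip (a : ℕ) (i : Expr)
  | emit (e : Expr)
  | seq (P Q : Prog)
  | branch (e : Expr) (P Q : Prog)
  | loop (e : Expr) (P : Prog)

/-- The arrays, indexed by name and position. -/
abbrev Mem := ℕ → ℤ → ℤ

/-- The length of the binary representation of an integer. -/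
def bitLen (z : ℤ) : ℕ := z.natAbs.size + 1

namespace Expr

/-- The value of an expression. -/
noncomputable def eval (D : Data) (M : Mem) : Expr → ℤ
  | lit c => c
  | get a i => M a (i.eval D M)
  | int i => D.ints.getD (i.eval D M).toNat 0
  | real j b => ⌊(2 : ℝ) ^ (b.eval D M).toNat * D.reals.getD (j.eval D M).toNat 0⌋
  | add e f => e.eval D M + f.eval D M
  | sub e f => e.eval D M - f.eval D M
  | mul e f => e.eval D M * f.eval D M
  | div e f => e.eval D M / f.eval D M

/-- The cost of evaluating an expression. -/
noncomputable def cost (D : Data) (M : Mem) : Expr → ℕ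
  | lit c => bitLen c
  | get a i => i.cost D M + bitLen (i.eval D M) + bitLen ((get a i).eval D M)
  | int i => i.cost D M + bitLen (i.eval D M) + bitLen ((int i).eval D M)
  | real j b => j.cost D M + b.cost D M + bitLen (j.eval D M) + (b.eval D M).toNat
      + bitLen ((real j b).eval D M)
  | add e f => e.cost D M + f.cost D M + bitLen (e.eval D M) + bitLen (f.eval D M)
  | sub e f => e.cost D M + f.cost D M + bitLen (e.eval D M) + bitLen (f.eval D M)
  | mul e f => e.cost D M + f.cost D M + bitLen (e.eval D M) * bitLen (f.eval D M)
  | div e f => e.cost D M + f.cost D M + bitLen (e.eval D M) * bitLen (f.eval D M)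

end Expr

/-- A state of the machine: the arrays, the coins not yet tossed, and the bits emitted so far. -/
structure State where
  mem : Mem
  coins : List Bool
  out : List Bool

/-- The memory after a write. -/
def write (M : Mem) (a : ℕ) (i v : ℤ) : Mem :=
  Function.update M a (Function.update (M a) i v)

/-- `Exec D P s t s'`: program `P`, started in state `s`, halts in state `s'` after time `t`. -/
inductive Exec (D : Data) : Prog → State → ℕ → State → Prop
  | skip (s : State) : Exec D .skip s 1 s
  | set (a : ℕ) (i e : Expr) (s : State) :
      Exec D (.set a i e) s
        (i.cost D s.mem + e.cost D s.mem
          + bitLen (i.eval D s.mem) + bitLen (e.eval D s.mem))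
        { s with mem := write s.mem a (i.eval D s.mem) (e.eval D s.mem) }
  | flip (a : ℕ) (i : Expr) (M : Mem) (b : Bool) (r o : List Bool) :
      Exec D (.flip a i) ⟨M, b :: r, o⟩
        (i.cost D M + bitLen (i.eval D M) + 1)
        ⟨write M a (i.eval D M) (if b then 1 else 0), r, o⟩
  | emit (e : Expr) (s : State) :
      Exec D (.emit e) s
        (e.cost D s.mem + bitLen (e.eval D s.mem))
        { s with out := s.out ++ [decide (0 < e.eval D s.mem)] }
  | seq (P Q : Prog) (s s' s'' : State) (t t' : ℕ) :
      Exec D P s t s' → Exec D Q s' t' s'' → Exec D (.seq P Q) s (t + t') s''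
  | branch_pos (e : Expr) (P Q : Prog) (s s' : State) (t : ℕ) :
      0 < e.eval D s.mem → Exec D P s t s' →
      Exec D (.branch e P Q) s
        (e.cost D s.mem + bitLen (e.eval D s.mem) + t) s'
  | branch_neg (e : Expr) (P Q : Prog) (s s' : State) (t : ℕ) :
      ¬ 0 < e.eval D s.mem → Exec D Q s t s' →
      Exec D (.branch e P Q) s
        (e.cost D s.mem + bitLen (e.eval D s.mem) + t) s'
  | loop_stop (e : Expr) (P : Prog) (s : State) :
      ¬ 0 < e.eval D s.mem →
      Exec D (.loop e P) s (e.cost D s.mem + bitLen (e.eval D s.mem)) s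
  | loop_step (e : Expr) (P : Prog) (s s' s'' : State) (t t' : ℕ) :
      0 < e.eval D s.mem → Exec D P s t s' → Exec D (.loop e P) s' t' s'' →
      Exec D (.loop e P) s
        (e.cost D s.mem + bitLen (e.eval D s.mem) + t + t') s''

/-- The program `A`, on the data `D`, halts within time `T` on every sequence of `T` coin tosses
(in time `T` it cannot toss more coins than that), always emits exactly `n` bits, and its output
for fair coins has the distribution `Q`. -/
def Samples (A : Prog) (D : Data) (T : ℕ) {n : ℕ} (Q : PMF (Fin n → Bool)) : Prop :=
  ∃ f : (Fin T → Bool) → (Fin n → Bool),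
    (∀ r : Fin T → Bool, ∃ t ≤ T, ∃ s : State,
      Exec D A ⟨fun _ _ => 0, List.ofFn r, []⟩ t s ∧ s.out = List.ofFn (f r)) ∧
    Q = (PMF.uniformOfFintype (Fin T → Bool)).map f

end RAM

/-! ## Circuits as data for the machine -/

namespace IQP

/-- A gate as integers: the number of its qubits, then its qubits in increasing order. (A list of
length one describes a `Z`-rotation, a longer one a controlled-phase gate.) -/
def Gate.code {n : ℕ} (g : Gate n) : List ℤ :=
  (g.support.card : ℤ) :: (g.support.sort (· ≤ ·)).map fun i => ((i : ℕ) : ℤ)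

/-- The problem instance. The integers are `n`, the depth and `⌈1/ε⌉`, followed, layer by layer, by
the number of gates of the layer and the gates. The real numbers are `p` and the angles of the
gates, reduced modulo `2π` to `[0, 2π)`, in the order of the gates. -/
noncomputable def instanceData {n l : ℕ} (C : Circuit n l) (p ε : ℝ) : RAM.Data where
  ints := [(n : ℤ), (C.depth : ℤ), ⌈1 / ε⌉] ++
    C.layers.flatMap fun L => (L.length : ℤ) :: L.flatMap Gate.code
  reals := p :: C.layers.flatten.map fun g => toIcoMod Real.two_pi_pos 0 g.angle

end IQP

/-! Diagonal gates multiply a matrix entry ρ(y,y') by a phase, and amplitude damping never changes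
the set S of qubits on which y and y' differ. In each layer every qubit of S contributes a factor
√(1-p), while a qubit outside S decays classically from 1 to 0 with probability p. Hence
(`bornProb_eq`) P(x) = 2^(-n) ∑_S (-1)^(S·x) s^|S| F(S), where s = (1-p)^(d/2) and F(S) is the mean
of cos(phase difference) over a uniform start b and a random decay path e. In particular |F| ≤ 1 and
F(∅) = 1.

The depth condition gives s ≤ n^(-4) (`sqrt_one_sub_pow_mul_le`). Then for S ≠ ∅ the coefficients
s^|S| are dominated by the weights μ(S) of a product Bernoulli law of parameter about 1/(2n)
(`bernWeight_bounds`). With c_S = s^|S|/μ(S) ≤ 1 this writes P as the mixture, with weights μ(S), of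
the distributions 2^(-n) (1 + (-1)^(S·x) c_S F(S)), the second term being dropped for S = ∅. The
mixture can be sampled without knowing F. Draw S, b, e and a uniform x, keep x with probability (1 +
(-1)^(S·x) c_S cos)/2, and otherwise negate one bit of x inside S, which reverses the parity
(`sum_expect_keep`). One random cosine replaces the average of all cosines.

The algorithm uses integers only. Random numbers are uniform below G = 2^B, the amplitude c_S is
tested by comparing squares (`ampTest_iff`), and cos(D/G) is replaced by Re (1 + iD/(NG))^N
(`abs_cosNum_sub_le`). The errors add up to at most 1/E with E = ⌈1/ε⌉
(`sum_abs_expect_sampler_sub_le`).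

This sampler takes polynomial time in n, d and E, with a large exponent. The bound n³ d q(1/ε) comes
from using it only if n < E and d ≤ c E², when every parameter is polynomial in E. In all other
cases fair coins suffice: the distance of P to the uniform distribution is controlled by (1+s)^n - 1
(`sum_abs_uniform_sub_le`), and n s ≤ 1/E follows from s ≤ n^(-4) if E ≤ n, and from s ≤ 2/(pd) if n
< E and d > c E². The constant c is where p₀ enters.

The program is verified in a logic `WP` in which one number Z bounds both the bit lengths of all
numbers and the iterations of each loop. A polynomial time bound can then be read off the syntax
(`Prog.exists_time_le`). -/

open scoped BigOperators

namespace IQP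

variable {n : ℕ}

/-! ### The output distribution as a signed mixture -/

/-- Negate the bits of `b` in the set `S`. -/
def flipOn (S b : Fin n → Bool) : Fin n → Bool := fun i => xor (b i) (S i)

/-- Decay of the qubits outside `S` that are marked by `e`. -/
def damp (S b e : Fin n → Bool) : Fin n → Bool := fun i => b i && (S i || !e i)

theorem flipOn_flipOn (S b : Fin n → Bool) : flipOn S (flipOn S b) = b := by
  funext i; simp [flipOn]

/-- The number of elements of `S`. -/
def wt (S : Fin n → Bool) : ℕ := (Finset.univ.filter fun i => S i = true).card

theorem prod_ite_eq_pow_wt {R : Type*} [CommMonoid R] (S : Fin n → Bool) (s : R) :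
    (∏ i, if S i then s else 1) = s ^ wt S := by
  simp [Finset.prod_ite, wt]

/-- The parity sign of `x` on `S`. -/
def sgn (S x : Fin n → Bool) : ℤ := ∏ i, if S i && x i then -1 else 1

/-- Integer factor of the angle of a gate in its phase, up to a global phase. -/
def Gate.coef : Gate n → ℤ
  | zRot _ _ => -2
  | cPhase _ _ => 1

/-- Whether all qubits of a gate are in the state `1`. -/
def Gate.active (g : Gate n) (b : Fin n → Bool) : ℤ := if ∀ i ∈ g.support, b i = true then 1 else 0

/-- The phase of a layer on a basis state, for given angles of the gates. -/
def layerPhase {R : Type*} [CommRing R] (ang : Gate n → R) (L : List (Gate n))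
    (b : Fin n → Bool) : R :=
  (L.map fun g => ((g.coef * g.active b : ℤ) : R) * ang g).sum

/-- Difference of the phases collected along the decay path `e` from `b` and from `flipOn S b`. -/
def phaseDiff {R : Type*} [CommRing R] (ang : Gate n → R) (S : Fin n → Bool) :
    List (List (Gate n)) → (ℕ → Fin n → Bool) → (Fin n → Bool) → R
  | [], _, _ => 0
  | L :: Ls, e, b => (layerPhase ang L b - layerPhase ang L (flipOn S b)) +
      phaseDiff ang S Ls (fun t => e (t + 1)) (damp S b (e 0))

/-- Extension of a finite family of bit strings. -/
def extend {d : ℕ} (e : Fin d → Fin n → Bool) : ℕ → Fin n → Bool :=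
  fun t => if h : t < d then e ⟨t, h⟩ else fun _ => false

/-- Product weights of independent bits that are `true` with probability `τ`. -/
def bernWeight {ι : Type*} [Fintype ι] (τ : ℝ) (S : ι → Bool) : ℝ := ∏ i, if S i then τ else 1 - τ

theorem bernWeight_eq (τ : ℝ) (S : Fin n → Bool) :
    bernWeight τ S = τ ^ wt S * (1 - τ) ^ (n - wt S) := by
  have h : (Finset.univ.filter fun i => ¬ S i = true).card = n - wt S := by
    rw [wt, ← Finset.compl_filter, Finset.card_compl, Fintype.card_fin]
  simp only [bernWeight, Finset.prod_ite, Finset.prod_const, h]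
  rfl

theorem sum_bernWeight {ι : Type*} [Fintype ι] [DecidableEq ι] (τ : ℝ) :
    ∑ S : ι → Bool, bernWeight τ S = 1 := by
  simp only [bernWeight]
  rw [← Fintype.prod_sum (fun (_ : ι) (b : Bool) => if b then τ else 1 - τ)]
  simp

theorem bernWeight_nonneg {ι : Type*} [Fintype ι] {τ : ℝ} (h0 : 0 ≤ τ) (h1 : τ ≤ 1) (S : ι → Bool) :
    0 ≤ bernWeight τ S :=
  Finset.prod_nonneg fun i _ => by split_ifs <;> linarith

/-! ### Noise and gates on pairs of basis states -/

/-- For y ≠ y' only K₀ contributes, with factor √(1-p), and both bits stay. For y = y' the sum over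
Kraus operators is a classical decay with probability p. The decay bit e is kept as a dummy in the
first case, so that all qubits share one product law. -/
theorem kraus_sum (p : ℝ) (hp0 : 0 ≤ p) (hp1 : p ≤ 1) (a a' y y' : Bool) :
    ∑ s : Bool, kraus p s a y * (starRingEnd ℂ) (kraus p s a' y') =
      ∑ e : Bool, (((if e then p else 1 - p) * (if xor y y' then Real.sqrt (1 - p) else 1) : ℝ) : ℂ) *
        ((if a = (y && (xor y y' || !e)) then 1 else 0) *
          (if a' = (y' && (xor y y' || !e)) then 1 else 0)) := by
  have h1 : (Real.sqrt p : ℂ) * Real.sqrt p = p := by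
    rw [← Complex.ofReal_mul, Real.mul_self_sqrt hp0]
  have h2 : (Real.sqrt (1 - p) : ℂ) * Real.sqrt (1 - p) = 1 - p := by
    rw [← Complex.ofReal_mul, Real.mul_self_sqrt (by linarith)]; simp
  cases a <;> cases a' <;> cases y <;> cases y' <;>
    simp [kraus, Matrix.single, h1, h2] <;> ring

theorem noise_apply (p : ℝ) (hp0 : 0 ≤ p) (hp1 : p ≤ 1) (ρ : Op n) (a a' : Fin n → Bool) :
    noise p ρ a a' = ∑ y, ∑ y', ρ y y' * ∑ e : Fin n → Bool,
      ((bernWeight p e * Real.sqrt (1 - p) ^ wt (flipOn y y') : ℝ) : ℂ) *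
        ((if a = damp (flipOn y y') y e then 1 else 0) *
          (if a' = damp (flipOn y y') y' e then 1 else 0)) := by
  have key : ∀ y y' : Fin n → Bool,
      ∑ s : Fin n → Bool, (∏ i, kraus p (s i) (a i) (y i)) *
        (starRingEnd ℂ) (∏ i, kraus p (s i) (a' i) (y' i)) =
      ∑ e : Fin n → Bool, ((bernWeight p e * Real.sqrt (1 - p) ^ wt (flipOn y y') : ℝ) : ℂ) *
        ((if a = damp (flipOn y y') y e then 1 else 0) *
          (if a' = damp (flipOn y y') y' e then 1 else 0)) := by
    intro y y'
    simp only [map_prod, ← Finset.prod_mul_distrib]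
    rw [← Fintype.prod_sum (fun (i : Fin n) (s : Bool) =>
      kraus p s (a i) (y i) * (starRingEnd ℂ) (kraus p s (a' i) (y' i)))]
    simp only [kraus_sum p hp0 hp1]
    rw [Fintype.prod_sum]
    refine Finset.sum_congr rfl fun e _ => ?_
    rw [Finset.prod_mul_distrib, Finset.prod_mul_distrib]
    congr 1
    · rw [← Complex.ofReal_prod, Finset.prod_mul_distrib, bernWeight, ← prod_ite_eq_pow_wt]
      simp only [flipOn, Bool.xor_comm]
    · congr 1
      · rw [Finset.prod_ite_zero]
        simp [funext_iff, damp, flipOn, Bool.xor_comm]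
      · rw [Finset.prod_ite_zero]
        simp [funext_iff, damp, flipOn, Bool.xor_comm]
  have lhs : noise p ρ a a' = ∑ s : Fin n → Bool, ∑ y', ∑ y, (∏ i, kraus p (s i) (a i) (y i)) *
      ρ y y' * (starRingEnd ℂ) (∏ i, kraus p (s i) (a' i) (y' i)) := by
    simp only [noise, Matrix.sum_apply, Matrix.mul_apply, Matrix.conjTranspose_apply, tensor,
      Matrix.of_apply, Finset.sum_mul, RCLike.star_def]
  rw [lhs]
  simp only [← key, Finset.mul_sum]
  rw [Finset.sum_comm]
  rw [Finset.sum_comm (s := Finset.univ) (t := Finset.univ)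
    (f := fun y y' => ∑ s : Fin n → Bool, ρ y y' * ((∏ i, kraus p (s i) (a i) (y i)) *
        (starRingEnd ℂ) (∏ i, kraus p (s i) (a' i) (y' i))))]
  refine Finset.sum_congr rfl fun y' _ => ?_
  rw [Finset.sum_comm]
  refine Finset.sum_congr rfl fun y _ => Finset.sum_congr rfl fun s _ => ?_
  ring

/-- The Heisenberg form of `noise_apply`: the channel is moved from the state to the test function,
as the induction over layers requires. -/
theorem sum_noise_mul (p : ℝ) (hp0 : 0 ≤ p) (hp1 : p ≤ 1) (ρ : Op n)
    (g : (Fin n → Bool) → (Fin n → Bool) → ℂ) :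
    ∑ a, ∑ a', noise p ρ a a' * g a a' = ∑ y, ∑ y', ρ y y' * ∑ e : Fin n → Bool,
      ((bernWeight p e * Real.sqrt (1 - p) ^ wt (flipOn y y') : ℝ) : ℂ) *
        g (damp (flipOn y y') y e) (damp (flipOn y y') y' e) := by
  simp only [noise_apply p hp0 hp1, Finset.sum_mul]
  have h1 : ∀ F : (Fin n → Bool) → (Fin n → Bool) → (Fin n → Bool) → (Fin n → Bool) → ℂ,
      ∑ a, ∑ a', ∑ y, ∑ y', F a a' y y' = ∑ y, ∑ y', ∑ a, ∑ a', F a a' y y' := by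
    intro F
    calc _ = ∑ z : (Fin n → Bool) × (Fin n → Bool), ∑ w : (Fin n → Bool) × (Fin n → Bool),
          F z.1 z.2 w.1 w.2 := by simp only [Fintype.sum_prod_type]
      _ = ∑ w : (Fin n → Bool) × (Fin n → Bool), ∑ z : (Fin n → Bool) × (Fin n → Bool),
          F z.1 z.2 w.1 w.2 := Finset.sum_comm
      _ = _ := by simp only [Fintype.sum_prod_type]
  rw [h1]
  refine Finset.sum_congr rfl fun y _ => Finset.sum_congr rfl fun y' _ => ?_
  simp only [mul_assoc, ← Finset.mul_sum]
  congr 1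
  simp only [Finset.sum_mul]
  have h2 : ∀ F : (Fin n → Bool) → (Fin n → Bool) → (Fin n → Bool) → ℂ,
      ∑ a, ∑ a', ∑ e, F a a' e = ∑ e, ∑ a, ∑ a', F a a' e := by
    intro F
    calc _ = ∑ z : (Fin n → Bool) × (Fin n → Bool), ∑ e : Fin n → Bool,
          F z.1 z.2 e := by simp only [Fintype.sum_prod_type]
      _ = ∑ e : Fin n → Bool, ∑ z : (Fin n → Bool) × (Fin n → Bool), F z.1 z.2 e :=
          Finset.sum_comm
      _ = _ := by simp only [Fintype.sum_prod_type]
  rw [h2]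
  refine Finset.sum_congr rfl fun e _ => ?_
  rw [Finset.sum_eq_single (damp (flipOn y y') y e), Finset.sum_eq_single (damp (flipOn y y') y' e)]
  · simp
  · intro b _ hb; simp [hb]
  · simp
  · intro b _ hb; simp [hb]
  · simp

/-- The global phase of a gate, up to which `e^{itZ}` is determined by `Gate.coef`. -/
def Gate.offset : Gate n → ℝ
  | zRot t _ => t
  | cPhase _ _ => 0

theorem Gate.unitary_eq (g : Gate n) : g.unitary = Matrix.diagonal fun x =>
    Complex.exp (Complex.I * ((g.offset + ((g.coef * g.active x : ℤ) : ℝ) * g.angle : ℝ) : ℂ)) := by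
  cases g with
  | zRot t i =>
    simp only [unitary, offset, coef, active, support, angle]
    congr 1; funext x
    congr 1
    by_cases h : x i = true
    · simp [h]; ring
    · simp [h]
  | cPhase θ s =>
    simp only [unitary, offset, coef, angle]
    congr 1; funext x
    by_cases h : ∀ i ∈ s, x i = true
    · rw [if_pos h, show (cPhase θ s).active x = 1 from if_pos h]; simp
    · rw [if_neg h, show (cPhase θ s).active x = 0 from if_neg h]; simp

theorem layerUnitary_eq (L : List (Gate n)) : layerUnitary L = Matrix.diagonal fun x =>
    Complex.exp (Complex.I * (((L.map Gate.offset).sum + layerPhase Gate.angle L x : ℝ) : ℂ)) := by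
  induction L with
  | nil => simp [layerUnitary, layerPhase]
  | cons g L ih =>
    have : layerUnitary (g :: L) = g.unitary * layerUnitary L := by simp [layerUnitary]
    rw [this, ih, Gate.unitary_eq, Matrix.diagonal_mul_diagonal]
    congr 1; funext x
    rw [← Complex.exp_add]
    congr 1
    simp only [layerPhase, List.map_cons, List.sum_cons]
    push_cast
    ring

/-- The global phases `Gate.offset` cancel between the unitary and its adjoint, so only differences
of `layerPhase` survive. -/
theorem conj_layerUnitary_apply (L : List (Gate n)) (ρ : Op n) (y y' : Fin n → Bool) :
    (layerUnitary L * ρ * (layerUnitary L).conjTranspose) y y' =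
      ρ y y' * Complex.exp (Complex.I *
        ((layerPhase Gate.angle L y - layerPhase Gate.angle L y' : ℝ) : ℂ)) := by
  rw [layerUnitary_eq, Matrix.diagonal_conjTranspose, Matrix.mul_diagonal, Matrix.diagonal_mul,
    mul_comm _ (ρ y y'), mul_assoc]
  congr 1
  rw [Pi.star_apply, RCLike.star_def, ← Complex.exp_conj, ← Complex.exp_add]
  congr 1
  simp only [map_mul, Complex.conj_I, Complex.conj_ofReal]
  push_cast
  ring

/-! ### Summation over decay paths -/

/-- Mean phase factor of the decay paths from `b` and `flipOn S b`. -/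
noncomputable def meanPhase (p : ℝ) (S : Fin n → Bool) :
    List (List (Gate n)) → (Fin n → Bool) → ℂ
  | [], _ => 1
  | L :: Ls, b => Complex.exp (Complex.I *
        ((layerPhase Gate.angle L b - layerPhase Gate.angle L (flipOn S b) : ℝ) : ℂ)) *
      ∑ e : Fin n → Bool, (bernWeight p e : ℂ) * meanPhase p S Ls (damp S b e)

/-- Because the test function depends on y ⊕ y' alone and no layer changes y ⊕ y', it passes through
the whole circuit. Each layer leaves behind the factor √(1-p)^|S| and one averaging step of
`meanPhase`. -/
theorem sum_foldl_noisyLayer (p : ℝ) (hp0 : 0 ≤ p) (hp1 : p ≤ 1) (c : (Fin n → Bool) → ℂ)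
    (Ls : List (List (Gate n))) (ρ : Op n) :
    ∑ y, ∑ y', Ls.foldl (noisyLayer p) ρ y y' * c (flipOn y y') =
      ∑ y, ∑ y', ρ y y' * (c (flipOn y y') *
        ((Real.sqrt (1 - p) ^ Ls.length) ^ wt (flipOn y y') : ℝ) *
        meanPhase p (flipOn y y') Ls y) := by
  induction Ls generalizing ρ with
  | nil => simp [meanPhase]
  | cons L Ls ih =>
    rw [List.foldl_cons, ih]
    simp only [noisyLayer]
    rw [sum_noise_mul p hp0 hp1]
    refine Finset.sum_congr rfl fun y _ => Finset.sum_congr rfl fun y' _ => ?_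
    -- Decay fixes the bits inside S and acts identically on y and y' outside S.
    have h1 : ∀ e, flipOn (damp (flipOn y y') y e) (damp (flipOn y y') y' e) = flipOn y y' := by
      intro e; funext i
      simp only [flipOn, damp]
      cases y i <;> cases y' i <;> cases e i <;> rfl
    have h2 : flipOn (flipOn y y') y = y' := by
      funext i
      simp only [flipOn]
      cases y i <;> cases y' i <;> rfl
    simp only [h1]
    rw [conj_layerUnitary_apply, meanPhase, h2, mul_assoc]
    congr 1
    simp only [Finset.mul_sum]
    refine Finset.sum_congr rfl fun e _ => ?_
    simp only [List.length_cons]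
    push_cast
    ring

theorem extend_cons_zero {d : ℕ} (a : Fin n → Bool) (e : Fin d → Fin n → Bool) :
    extend (Fin.cons a e : Fin (d + 1) → Fin n → Bool) 0 = a := by
  simp only [extend, Nat.zero_lt_succ, dif_pos]
  rfl

theorem extend_cons_succ {d : ℕ} (a : Fin n → Bool) (e : Fin d → Fin n → Bool) :
    (fun t => extend (Fin.cons a e : Fin (d + 1) → Fin n → Bool) (t + 1)) = extend e := by
  funext t
  by_cases h : t < d
  · simp only [extend, dif_pos h, dif_pos (Nat.succ_lt_succ h)]
    exact Fin.cons_succ (α := fun _ => Fin n → Bool) a e ⟨t, h⟩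
  · simp only [extend, dif_neg h, dif_neg (fun h' => h (Nat.lt_of_succ_lt_succ h'))]

theorem sum_fin_succ_pi {α M : Type*} [Fintype α] [AddCommMonoid M] {d : ℕ}
    (F : (Fin (d + 1) → α) → M) :
    ∑ e, F e = ∑ a, ∑ e : Fin d → α, F (Fin.cons a e) := by
  rw [← Fintype.sum_prod_type']
  exact (Fintype.sum_equiv (Fin.consEquiv fun _ => α) _ _ fun _ => rfl).symm

/-- Unrolling the recursion gives a single average over complete decay histories, the form from
which one can sample. -/
theorem meanPhase_eq (p : ℝ) (S : Fin n → Bool) (Ls : List (List (Gate n))) (b : Fin n → Bool) :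
    meanPhase p S Ls b = ∑ e : Fin Ls.length → Fin n → Bool,
      ((∏ t, bernWeight p (e t) : ℝ) : ℂ) *
        Complex.exp (Complex.I * ((phaseDiff Gate.angle S Ls (extend e) b : ℝ) : ℂ)) := by
  induction Ls generalizing b with
  | nil => simp [meanPhase, phaseDiff]
  | cons L Ls ih =>
    rw [meanPhase]
    simp only [List.length_cons]
    rw [sum_fin_succ_pi, Finset.mul_sum]
    refine Finset.sum_congr rfl fun a _ => ?_
    rw [ih, Finset.mul_sum, Finset.mul_sum]
    refine Finset.sum_congr rfl fun e _ => ?_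
    rw [Fin.prod_univ_succ, phaseDiff, extend_cons_zero, extend_cons_succ]
    simp only [Fin.cons_zero, Fin.cons_succ]
    rw [Complex.ofReal_add, mul_add, Complex.exp_add]
    push_cast
    ring

/-- The measurement sees y and y' only through y ⊕ y', which makes `sum_foldl_noisyLayer`
applicable. -/
theorem hadamardVec_mul (x y y' : Fin n → Bool) :
    hadamardVec x y * hadamardVec x y' = (((1 / 2) ^ n * sgn (flipOn y y') x : ℝ) : ℂ) := by
  have h2 : (Real.sqrt 2 : ℂ) * Real.sqrt 2 = 2 := by
    rw [← Complex.ofReal_mul, Real.mul_self_sqrt (by norm_num)]; simp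
  have hne : (Real.sqrt 2 : ℂ) ≠ 0 := by
    intro h; rw [h] at h2; norm_num at h2
  have : ∀ i, (if (x i && y i) = true then (-1 : ℂ) else 1) / (Real.sqrt 2 : ℂ) *
      ((if (x i && y' i) = true then (-1 : ℂ) else 1) / (Real.sqrt 2 : ℂ)) =
      (1 / 2 : ℂ) * ((if (flipOn y y' i && x i) = true then -1 else 1 : ℤ) : ℂ) := by
    intro i
    rw [div_mul_div_comm, h2]
    have hb : ∀ a b c : Bool, (if (a && b) = true then (-1 : ℂ) else 1) *
        (if (a && c) = true then (-1 : ℂ) else 1) / 2 =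
        (1 / 2 : ℂ) * ((if (xor c b && a) = true then -1 else 1 : ℤ) : ℂ) := by
      intro a b c
      cases a <;> cases b <;> cases c <;> simp <;> norm_num
    exact hb (x i) (y i) (y' i)
  rw [hadamardVec, hadamardVec, ← Finset.prod_mul_distrib]
  simp only [this]
  rw [Finset.prod_mul_distrib, sgn]
  simp only [Complex.ofReal_mul, Complex.ofReal_pow, Complex.ofReal_intCast]
  rw [Int.cast_prod]
  simp

theorem bornProb_eq {l : ℕ} (C : Circuit n l) (p : ℝ) (hp0 : 0 ≤ p) (hp1 : p ≤ 1)
    (x : Fin n → Bool) :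
    bornProb C p x = (1 / 2) ^ n * ∑ S : Fin n → Bool,
      (sgn S x : ℝ) * (Real.sqrt (1 - p) ^ C.depth) ^ wt S *
        ((1 / 2) ^ n * ∑ b : Fin n → Bool, ∑ e : Fin C.depth → Fin n → Bool,
          (∏ t, bernWeight p (e t)) *
            Real.cos (phaseDiff Gate.angle S C.layers (extend e) b)) := by
  have h1 : star (hadamardVec x) ⬝ᵥ (outputState C p).mulVec (hadamardVec x) =
      ∑ y, ∑ y', outputState C p y y' * (((1 / 2) ^ n * sgn (flipOn y y') x : ℝ) : ℂ) := by
    simp only [dotProduct, Matrix.mulVec, Finset.mul_sum]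
    refine Finset.sum_congr rfl fun y _ => Finset.sum_congr rfl fun y' _ => ?_
    rw [← hadamardVec_mul]
    have : star (hadamardVec x) y = hadamardVec x y := by
      rw [Pi.star_apply, hadamardVec, RCLike.star_def, map_prod]
      refine Finset.prod_congr rfl fun i _ => ?_
      rw [map_div₀, Complex.conj_ofReal]
      split_ifs <;> simp
    rw [this]; ring
  rw [bornProb, h1, outputState, sum_foldl_noisyLayer p hp0 hp1
    (fun S => (((1 / 2) ^ n * sgn S x : ℝ) : ℂ))]
  have h3 : ∀ y y' : Fin n → Bool, plusState n y y' = (1 / 2) ^ n := by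
    intro y y'; simp [plusState, tensor]
  -- The sum over pairs (y, y') is reindexed by y and S = y ⊕ y'.
  have h4 : ∀ F : (Fin n → Bool) → (Fin n → Bool) → ℂ,
      ∑ y, ∑ y', F y (flipOn y y') = ∑ S, ∑ y, F y S := by
    intro F
    rw [Finset.sum_comm' (s' := fun _ => Finset.univ) (t' := Finset.univ) (by simp)]
    rw [Finset.sum_comm]
    rw [Finset.sum_comm (s := Finset.univ) (t := Finset.univ) (f := fun S y => F y S)]
    refine Finset.sum_congr rfl fun y _ => ?_
    exact Fintype.sum_equiv ⟨flipOn y, flipOn y, flipOn_flipOn y, flipOn_flipOn y⟩ _ _ fun _ => rfl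
  simp only [h3]
  rw [h4 fun y S => (1 / 2) ^ n * ((((1 / 2) ^ n * sgn S x : ℝ) : ℂ) *
        ((Real.sqrt (1 - p) ^ C.layers.length) ^ wt S : ℝ) * meanPhase p S C.layers y)]
  rw [Complex.re_sum, Finset.mul_sum]
  refine Finset.sum_congr rfl fun S _ => ?_
  simp only [Complex.re_sum, Finset.mul_sum, meanPhase_eq]
  refine Finset.sum_congr rfl fun b _ => Finset.sum_congr rfl fun e _ => ?_
  -- Born probabilities are defined as real parts, so each phase factor turns into a cosine.
  have h5 : ∀ (r θ : ℝ), ((r : ℂ) * Complex.exp (Complex.I * θ)).re = r * Real.cos θ := by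
    intro r θ
    rw [Complex.re_ofReal_mul, mul_comm Complex.I, Complex.exp_ofReal_mul_I_re]
  have h6 : ((1 : ℂ) / 2) ^ n = (((1 / 2) ^ n : ℝ) : ℂ) := by push_cast; rfl
  rw [h6, ← mul_assoc, ← mul_assoc, ← Complex.ofReal_mul, ← Complex.ofReal_mul,
    ← Complex.ofReal_mul, h5]
  have h7 : ∀ h a r w c : ℝ, h * (h * a * r) * w * c = h * (a * r * (h * (w * c))) := by
    intros; ring
  exact h7 _ _ _ _ _

/-! ### Flipping one bit -/

/-- Negate the bit of `x` at the last element of `S`. -/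
def flipLast (S x : Fin n → Bool) : Fin n → Bool := fun i =>
  if S i = true ∧ ∀ k, i < k → S k = false then !x i else x i

theorem flipLast_of_forall_eq_false {S : Fin n → Bool} (hS : ∀ i, S i = false)
    (x : Fin n → Bool) : flipLast S x = x := by
  funext i; simp [flipLast, hS i]

theorem flipLast_flipLast (S x : Fin n → Bool) : flipLast S (flipLast S x) = x := by
  funext i
  simp only [flipLast]
  split_ifs <;> simp

theorem wt_pos_iff {S : Fin n → Bool} : 0 < wt S ↔ ¬ ∀ i, S i = false := by
  simp [wt, Finset.card_pos, Finset.filter_nonempty_iff]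

theorem wt_le (S : Fin n → Bool) : wt S ≤ n := by
  simpa [wt] using Finset.card_filter_le Finset.univ fun i => S i = true

/-- Exactly one factor of the product changes sign, the one at the maximum of S. The maximum is a
choice that a program can find in a single scan. -/
theorem sgn_flipLast {S : Fin n → Bool} (hS : ¬ ∀ i, S i = false) (x : Fin n → Bool) :
    sgn S (flipLast S x) = -sgn S x := by
  have hne : (Finset.univ.filter fun i => S i = true).Nonempty := by
    rwa [← Finset.card_pos, ← wt, wt_pos_iff]
  obtain ⟨j, hj, hmax⟩ := Finset.exists_max_image _ id hne
  simp only [Finset.mem_filter, Finset.mem_univ, true_and, id] at hj hmax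
  have hj' : ∀ k, j < k → S k = false := by
    intro k hk
    by_contra h
    exact absurd (hmax k (by simpa using h)) (not_le.mpr hk)
  rw [sgn, sgn, ← Finset.mul_prod_erase _ _ (Finset.mem_univ j),
    ← Finset.mul_prod_erase _ (fun i => if S i && x i then (-1 : ℤ) else 1) (Finset.mem_univ j),
    ← neg_mul]
  congr 1
  · rw [show flipLast S x j = !x j from if_pos ⟨hj, hj'⟩, hj]
    cases x j <;> simp
  · refine Finset.prod_congr rfl fun i hi => ?_
    have hne := Finset.ne_of_mem_erase hi
    by_cases hSi : S i = true
    · have : ¬ ∀ k, i < k → S k = false := by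
        intro h
        have := h j (lt_of_le_of_ne (hmax i hSi) hne)
        simp [hj] at this
      simp [flipLast, this]
    · simp [hSi]

theorem sgn_eq_one_or (S x : Fin n → Bool) : sgn S x = 1 ∨ sgn S x = -1 := by
  rw [sgn]
  refine Finset.prod_induction _ (fun z : ℤ => z = 1 ∨ z = -1) ?_ (Or.inl rfl) ?_
  · rintro a b (rfl | rfl) (rfl | rfl) <;> simp
  · intro i _; split_ifs <;> simp

theorem sgn_of_forall_eq_false {S : Fin n → Bool} (hS : ∀ i, S i = false) (x : Fin n → Bool) :
    sgn S x = 1 := by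
  simp [sgn, hS]

/-! ### Distances of mixtures -/

/-- A hybrid argument: factors are replaced one at a time, and each replacement costs the one-step
ℓ¹ distance because the other factors sum to one. -/
theorem sum_prod_weights_sub_le {α : Type*} [Fintype α] (w w' : α → ℝ) (hw : ∀ a, 0 ≤ w a)
    (hw' : ∀ a, 0 ≤ w' a) (h1 : ∑ a, w a = 1) (h1' : ∑ a, w' a = 1) (d : ℕ) :
    ∑ e : Fin d → α, |∏ t, w (e t) - ∏ t, w' (e t)| ≤ d * ∑ a, |w a - w' a| := by
  have hsum : ∀ d : ℕ, ∑ e : Fin d → α, ∏ t, w' (e t) = 1 := by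
    intro d
    rw [← Fintype.prod_sum (fun (_ : Fin d) a => w' a), h1']; simp
  induction d with
  | zero => simp
  | succ d ih =>
    rw [sum_fin_succ_pi]
    have : ∀ (a : α) (e : Fin d → α), |∏ t, w ((Fin.cons a e : Fin (d + 1) → α) t) -
        ∏ t, w' ((Fin.cons a e : Fin (d + 1) → α) t)| ≤
        w a * |∏ t, w (e t) - ∏ t, w' (e t)| + |w a - w' a| * ∏ t, w' (e t) := by
      intro a e
      rw [Fin.prod_univ_succ, Fin.prod_univ_succ]
      simp only [Fin.cons_zero, Fin.cons_succ]
      have hp : 0 ≤ ∏ t, w' (e t) := Finset.prod_nonneg fun t _ => hw' _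
      calc _ = |w a * (∏ t, w (e t) - ∏ t, w' (e t)) + (w a - w' a) * ∏ t, w' (e t)| := by ring_nf
        _ ≤ _ := abs_add_le _ _
        _ = _ := by rw [abs_mul, abs_mul, abs_of_nonneg (hw a), abs_of_nonneg hp]
    calc _ ≤ ∑ a, ∑ e : Fin d → α, (w a * |∏ t, w (e t) - ∏ t, w' (e t)| +
          |w a - w' a| * ∏ t, w' (e t)) :=
          Finset.sum_le_sum fun a _ => Finset.sum_le_sum fun e _ => this a e
      _ = (∑ a, w a) * (∑ e : Fin d → α, |∏ t, w (e t) - ∏ t, w' (e t)|) +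
          ∑ a, |w a - w' a| := by
          simp only [Finset.sum_add_distrib, ← Finset.mul_sum, hsum, mul_one, Finset.sum_mul]
      _ ≤ _ := by
          rw [h1]; push_cast; linarith

/-- The hybrid bound is used twice, over the n bits of a row and over the d rows. The 2 counts both
values of a bit. -/
theorem sum_bernWeight_sub_le {p p' : ℝ} (h0 : 0 ≤ p) (h1 : p ≤ 1) (h0' : 0 ≤ p') (h1' : p' ≤ 1)
    (d : ℕ) :
    ∑ e : Fin d → Fin n → Bool, |∏ t, bernWeight p (e t) - ∏ t, bernWeight p' (e t)| ≤
      2 * n * d * |p - p'| := by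
  have h2 := sum_prod_weights_sub_le (fun b : Bool => if b then p else 1 - p)
    (fun b : Bool => if b then p' else 1 - p') (by intro a; split_ifs <;> linarith)
    (by intro a; split_ifs <;> linarith) (by simp) (by simp) n
  refine (sum_prod_weights_sub_le (fun b : Fin n → Bool => bernWeight p b) (bernWeight p')
    (bernWeight_nonneg h0 h1) (bernWeight_nonneg h0' h1') (sum_bernWeight p) (sum_bernWeight p')
    d).trans ?_
  have h3 : ∑ b : Bool, |(if b then p else 1 - p) - (if b then p' else 1 - p')| =
      2 * |p - p'| := by
    have : |1 - p - (1 - p')| = |p - p'| := by rw [← abs_neg]; ring_nf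
    simp only [Fintype.sum_bool, if_true, Bool.false_eq_true, if_false, this]; ring
  rw [h3] at h2
  calc _ ≤ (d : ℝ) * (n * (2 * |p - p'|)) := mul_le_mul_of_nonneg_left h2 (Nat.cast_nonneg d)
    _ = _ := by ring

/-- A signed mixture of parities is close to a mixture of tilted uniform distributions whose biases
approximate the signed weights. -/
theorem sum_abs_mixture_sub_le (τ s δ : ℝ) (hτ0 : 0 ≤ τ) (hτ1 : τ ≤ 1) (hδ : 0 ≤ δ)
    (F H : (Fin n → Bool) → ℝ) (hF : ∀ S, (∀ i, S i = false) → F S = 1)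
    (hH : ∀ S, (¬ ∀ i, S i = false) →
      |bernWeight τ S * H S - s ^ wt S * F S| ≤ bernWeight τ S * δ) :
    ∑ x : Fin n → Bool, |(1 / 2) ^ n * ∑ S : Fin n → Bool, bernWeight τ S *
        (1 + if ∀ i, S i = false then 0 else (sgn S x : ℝ) * H S) -
      (1 / 2) ^ n * ∑ S : Fin n → Bool, (sgn S x : ℝ) * s ^ wt S * F S| ≤ δ := by
  have hx : ∀ x : Fin n → Bool, |(1 / 2) ^ n * ∑ S : Fin n → Bool, bernWeight τ S *
        (1 + if ∀ i, S i = false then 0 else (sgn S x : ℝ) * H S) -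
      (1 / 2) ^ n * ∑ S : Fin n → Bool, (sgn S x : ℝ) * s ^ wt S * F S| ≤ (1 / 2) ^ n * δ := by
    intro x
    rw [← mul_sub, abs_mul, abs_of_nonneg (by positivity)]
    refine mul_le_mul_of_nonneg_left ?_ (by positivity)
    have e1 : ∑ S : Fin n → Bool, bernWeight τ S *
        (1 + if ∀ i, S i = false then 0 else (sgn S x : ℝ) * H S) =
        1 + ∑ S : Fin n → Bool, if ∀ i, S i = false then 0 else
          bernWeight τ S * ((sgn S x : ℝ) * H S) := by
      simp only [mul_add, mul_one, Finset.sum_add_distrib, sum_bernWeight, mul_ite, mul_zero]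
    have e2 : ∑ S : Fin n → Bool, (sgn S x : ℝ) * s ^ wt S * F S =
        1 + ∑ S : Fin n → Bool, if ∀ i, S i = false then 0 else
          (sgn S x : ℝ) * s ^ wt S * F S := by
      rw [← Finset.add_sum_erase _ _ (Finset.mem_univ fun _ => false),
        ← Finset.add_sum_erase _ (fun S : Fin n → Bool => if ∀ i, S i = false then 0 else
          (sgn S x : ℝ) * s ^ wt S * F S) (Finset.mem_univ fun _ => false)]
      have : wt (fun _ : Fin n => false) = 0 := by simp [wt]
      rw [sgn_of_forall_eq_false (fun _ => rfl), hF _ (fun _ => rfl), this]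
      simp only [implies_true, if_true]
      rw [zero_add]
      congr 1
      · simp
      · refine Finset.sum_congr rfl fun S hS => ?_
        rw [if_neg]
        intro h
        exact Finset.ne_of_mem_erase hS (funext h)
    -- The constants 1 from the empty set cancel. Each other term is at most μ(S) δ, and the weights
    -- sum to one.
    rw [e1, e2, add_sub_add_left_eq_sub, ← Finset.sum_sub_distrib]
    calc _ ≤ ∑ S : Fin n → Bool, bernWeight τ S * δ := by
          refine (Finset.abs_sum_le_sum_abs _ _).trans (Finset.sum_le_sum fun S _ => ?_)
          split_ifs with h
          · simpa using mul_nonneg (bernWeight_nonneg hτ0 hτ1 S) hδ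
          · refine le_trans (le_of_eq ?_) (hH S h)
            rw [show bernWeight τ S * ((sgn S x : ℝ) * H S) - (sgn S x : ℝ) * s ^ wt S * F S =
              (sgn S x : ℝ) * (bernWeight τ S * H S - s ^ wt S * F S) by ring, abs_mul]
            rcases sgn_eq_one_or S x with h | h <;> simp [h]
      _ = δ := by rw [← Finset.sum_mul, sum_bernWeight, one_mul]
  calc _ ≤ ∑ x : Fin n → Bool, (1 / 2) ^ n * δ := Finset.sum_le_sum fun x _ => hx x
    _ = δ := by
      simp

/-! ### Threshold tests on uniform integers -/

/-- The number of integers below cG, counted among 0, …, G-1, is ⌈cG⌉ clamped to [0, G]. Clamping is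
harmless since the target y lies in [0,1], even if c does not, and rounding up costs at most 1/G. -/
theorem abs_card_lt_div_sub_le {G : ℕ} (hG : 0 < G) {c y η : ℝ} (hy0 : 0 ≤ y) (hy1 : y ≤ 1)
    (h : |c - y| ≤ η) :
    |((Finset.univ.filter fun w : Fin G => ((w : ℕ) : ℝ) < c * G).card : ℝ) / G - y| ≤
      η + 1 / G := by
  have hG' : (0 : ℝ) < G := by exact_mod_cast hG
  have hcard : (Finset.univ.filter fun w : Fin G => ((w : ℕ) : ℝ) < c * G).card =
      min ⌈c * G⌉₊ G := by
    have : (Finset.univ.filter fun w : Fin G => ((w : ℕ) : ℝ) < c * G).map Fin.valEmbedding =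
        Finset.range (min ⌈c * G⌉₊ G) := by
      ext k
      simp only [Finset.mem_map, Finset.mem_filter, Finset.mem_univ, true_and,
        Fin.valEmbedding_apply, Finset.mem_range, lt_min_iff, Nat.lt_ceil]
      constructor
      · rintro ⟨w, hw, rfl⟩; exact ⟨hw, w.2⟩
      · rintro ⟨h1, h2⟩; exact ⟨⟨k, h2⟩, h1, rfl⟩
    rw [← Finset.card_map, this, Finset.card_range]
  rw [hcard]
  obtain ⟨h1, h2⟩ := abs_le.mp h
  have hη : 0 ≤ η := (abs_nonneg _).trans h
  have hinv : (0 : ℝ) ≤ 1 / G := by positivity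
  rw [abs_le]
  constructor
  · rw [neg_le_sub_iff_le_add]
    have : y - η ≤ (min ⌈c * G⌉₊ G : ℕ) / (G : ℝ) := by
      rw [le_div_iff₀ hG']
      push_cast
      rw [le_min_iff]
      constructor
      · exact le_trans (by nlinarith) (Nat.le_ceil _)
      · nlinarith
    linarith
  · rw [sub_le_iff_le_add]
    rw [div_le_iff₀ hG', add_mul, add_mul, div_mul_cancel₀ _ hG'.ne']
    rcases le_or_gt c 0 with hc | hc
    · have : ⌈c * G⌉₊ = 0 := Nat.ceil_eq_zero.mpr (by nlinarith)
      rw [this]; simp only [zero_le, inf_of_le_left, Nat.cast_zero]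
      positivity
    · have := Nat.ceil_lt_add_one (a := c * G) (by positivity)
      push_cast
      refine (min_le_left _ _).trans ?_
      nlinarith

/-! ### Averages over independent uniform draws -/

theorem expect_sum_arrow {α β X : Type*} [Fintype α] [Fintype β] [DecidableEq α] [DecidableEq β]
    [Fintype X] (F : (α ⊕ β → X) → ℝ) :
    𝔼 U, F U = 𝔼 a : α → X, 𝔼 b : β → X, F (Sum.elim a b) := by
  rw [← Finset.expect_product', Finset.univ_product_univ]
  exact Fintype.expect_equiv (Equiv.sumArrowEquivProdArrow α β X) _ _ fun U => by
    congr 1; ext i; cases i <;> rfl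

/-- A uniform integer below G is less than V with probability exactly V/G, so thresholding
independent draws produces product Bernoulli laws without error. This serves S (V/G), the fair bits
(1/2) and the decay (P/G). -/
theorem expect_threshold {κ : Type*} [Fintype κ] [DecidableEq κ] {G V : ℕ} (hG : 0 < G)
    (hV : V ≤ G) (F : (κ → Bool) → ℝ) :
    𝔼 U : κ → Fin G, F (fun i => decide ((U i : ℕ) < V)) =
      ∑ B, bernWeight ((V : ℝ) / G) B * F B := by
  have hG' : (G : ℝ) ≠ 0 := by exact_mod_cast hG.ne'
  have h1 : ∀ U : κ → Fin G, F (fun i => decide ((U i : ℕ) < V)) =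
      ∑ B : κ → Bool, (∏ i, if B i = decide ((U i : ℕ) < V) then (1 : ℝ) else 0) * F B := by
    intro U
    rw [Finset.sum_eq_single fun i => decide ((U i : ℕ) < V)]
    · simp
    · intro B _ hB
      rw [Finset.prod_ite_zero, if_neg, zero_mul]
      simpa [funext_iff] using hB
    · simp
  have hc : (Finset.univ.filter fun u : Fin G => (u : ℕ) < V).card = V := by
    rw [Fin.card_filter_val_lt, min_eq_right hV]
  have h2 : ∀ b : Bool, 𝔼 u : Fin G, (if b = decide ((u : ℕ) < V) then (1 : ℝ) else 0) =
      if b then (V : ℝ) / G else 1 - (V : ℝ) / G := by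
    intro b
    rw [Fintype.expect_eq_sum_div_card, Fintype.card_fin]
    cases b
    · have : ∀ u : Fin G, (if false = decide ((u : ℕ) < V) then (1 : ℝ) else 0) =
          1 - if (u : ℕ) < V then (1 : ℝ) else 0 := by
        intro u; by_cases h : (u : ℕ) < V <;> simp [h]
      simp only [this, Finset.sum_sub_distrib, Finset.sum_boole, hc]
      simp
      field_simp
    · have : ∀ u : Fin G, (if true = decide ((u : ℕ) < V) then (1 : ℝ) else 0) =
          if (u : ℕ) < V then (1 : ℝ) else 0 := by
        intro u; by_cases h : (u : ℕ) < V <;> simp [h]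
      simp only [this, Finset.sum_boole, hc]
      simp
  simp only [h1]
  rw [Finset.expect_sum_comm]
  refine Finset.sum_congr rfl fun B _ => ?_
  rw [← Finset.expect_mul]
  congr 1
  rw [bernWeight, Fintype.expect_eq_sum_div_card,
    ← Fintype.prod_sum (fun (i : κ) (u : Fin G) => if B i = decide ((u : ℕ) < V) then (1 : ℝ) else 0)]
  simp only [← h2, Fintype.expect_eq_sum_div_card]
  rw [Finset.prod_div_distrib]
  simp

theorem bernWeight_half (b : Fin n → Bool) : bernWeight (1 / 2) b = (1 / 2) ^ n := by
  rw [bernWeight]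
  have : (1 - 1 / 2 : ℝ) = 1 / 2 := by norm_num
  rw [this]
  simp only [ite_self, Finset.prod_const, Finset.card_univ, Fintype.card_fin]

/-- The entries of a finite sequence of draws, continued by zero. -/
def drawAt {m G : ℕ} (U : Fin m → Fin G) (k : ℕ) : ℕ := if h : k < m then U ⟨k, h⟩ else 0

/-- Draws grouped by their use: three rows of `n`, then `d` rows of `n`, then two. -/
theorem expect_draws {d G : ℕ}
    (Ψ : (Fin n → ℕ) → (Fin n → ℕ) → (Fin n → ℕ) → (Fin d → Fin n → ℕ) → ℕ → ℕ → ℝ) :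
    (𝔼 U : Fin (n + (n + (n + (d * n + (1 + 1))))) → Fin G,
      Ψ (fun i => drawAt U i) (fun i => drawAt U (n + i)) (fun i => drawAt U (n + (n + i)))
        (fun t i => drawAt U (n + (n + (n + (i + n * t))))) (drawAt U (n + (n + (n + (d * n)))))
        (drawAt U (n + (n + (n + (d * n + 1)))))) =
      𝔼 a : Fin n → Fin G, 𝔼 b : Fin n → Fin G, 𝔼 c : Fin n → Fin G, 𝔼 e : Fin d × Fin n → Fin G,
        𝔼 u : Fin G, 𝔼 w : Fin G,
        Ψ (fun i => a i) (fun i => b i) (fun i => c i) (fun t i => e (t, i)) u w := by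
  -- The decay draw of qubit i in layer t sits at offset i + n t of its block, which is the
  -- numbering of `finProdFinEquiv`.
  let ε : Fin n ⊕ (Fin n ⊕ (Fin n ⊕ ((Fin d × Fin n) ⊕ (Fin 1 ⊕ Fin 1)))) ≃
      Fin (n + (n + (n + (d * n + (1 + 1))))) :=
    (Equiv.sumCongr (Equiv.refl _) <| (Equiv.sumCongr (Equiv.refl _) <|
      (Equiv.sumCongr (Equiv.refl _) <| (Equiv.sumCongr finProdFinEquiv finSumFinEquiv).trans
        finSumFinEquiv).trans finSumFinEquiv).trans finSumFinEquiv).trans finSumFinEquiv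
  have key : ∀ (U : Fin (n + (n + (n + (d * n + (1 + 1))))) → Fin G) k x, (ε x : ℕ) = k →
      drawAt U k = U (ε x) := by
    rintro U k x rfl
    simp [drawAt]
  have h1 : ∀ F : (Fin n ⊕ (Fin n ⊕ (Fin n ⊕ ((Fin d × Fin n) ⊕ (Fin 1 ⊕ Fin 1)))) → Fin G) → ℝ,
      𝔼 U : Fin (n + (n + (n + (d * n + (1 + 1))))) → Fin G, F (fun x => U (ε x)) = 𝔼 U, F U :=
    fun F => Fintype.expect_equiv (Equiv.arrowCongr ε.symm (Equiv.refl _)) _ _ fun U => rfl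
  have h2 : ∀ F : Fin G → ℝ, 𝔼 u : Fin 1 → Fin G, F (u 0) = 𝔼 u, F u :=
    fun F => Fintype.expect_equiv (Equiv.funUnique (Fin 1) (Fin G)) _ _ fun U => rfl
  have h3 := h1 fun U => Ψ (fun i => U (Sum.inl i)) (fun i => U (Sum.inr (Sum.inl i)))
    (fun i => U (Sum.inr (Sum.inr (Sum.inl i))))
    (fun t i => U (Sum.inr (Sum.inr (Sum.inr (Sum.inl (t, i))))))
    (U (Sum.inr (Sum.inr (Sum.inr (Sum.inr (Sum.inl 0))))))
    (U (Sum.inr (Sum.inr (Sum.inr (Sum.inr (Sum.inr 0))))))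
  rw [expect_sum_arrow] at h3
  simp only [expect_sum_arrow (α := Fin n) (β := Fin n ⊕ ((Fin d × Fin n) ⊕ (Fin 1 ⊕ Fin 1))),
    expect_sum_arrow (α := Fin n) (β := (Fin d × Fin n) ⊕ (Fin 1 ⊕ Fin 1)),
    expect_sum_arrow (α := Fin d × Fin n) (β := Fin 1 ⊕ Fin 1),
    expect_sum_arrow (α := Fin 1) (β := Fin 1), Sum.elim_inl, Sum.elim_inr] at h3
  refine Eq.trans (Finset.expect_congr rfl fun U _ => ?_) (h3.trans ?_)
  · congr 1
    · funext i; exact key U _ _ (by simp [ε])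
    · funext i; exact key U _ _ (by simp [ε])
    · funext i; exact key U _ _ (by simp [ε])
    · funext t i; exact key U _ _ (by simp [ε])
    · exact key U _ _ (by simp [ε]; rfl)
    · exact key U _ _ (by simp [ε]; rfl)
  · refine Finset.expect_congr rfl fun a _ => Finset.expect_congr rfl fun b _ =>
      Finset.expect_congr rfl fun c _ => Finset.expect_congr rfl fun e _ => ?_
    rw [← h2]
    refine Finset.expect_congr rfl fun u _ => ?_
    rw [← h2]

/-- The integer with the given binary digits, least significant first, from position `a`. -/
def ofBits (r : ℕ → Bool) (a B : ℕ) : ℕ := ∑ j ∈ Finset.range B, if r (a + j) then 2 ^ j else 0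

theorem ofBits_lt (r : ℕ → Bool) (a B : ℕ) : ofBits r a B < 2 ^ B := by
  induction B with
  | zero => simp [ofBits]
  | succ B ih =>
    rw [ofBits, Finset.sum_range_succ, ← ofBits, pow_succ]
    split_ifs <;> omega

/-- The coin tosses as a sequence, continued by `false`. -/
def coinAt {T : ℕ} (r : Fin T → Bool) (k : ℕ) : Bool := if h : k < T then r ⟨k, h⟩ else false

/-- Coins that are never tossed average out. The time bound T also counts the available coins, and
it exceeds the number used. -/
theorem expect_castAdd (m T' : ℕ) (F : (Fin m → Bool) → ℝ) :
    𝔼 r : Fin (m + T') → Bool, F (fun k => r (Fin.castAdd T' k)) = 𝔼 r, F r := by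
  have h2 := Fintype.expect_equiv (Equiv.arrowCongr (finSumFinEquiv (m := m) (n := T')).symm
    (Equiv.refl Bool)) (fun r => F (fun k => r (Fin.castAdd T' k)))
    (fun r => F (fun k => r (Sum.inl k))) (fun r => rfl)
  rw [h2, expect_sum_arrow]
  simp only [Sum.elim_inl]
  exact Finset.expect_congr rfl fun a _ => Fintype.expect_const _

/-- Disjoint blocks of B fair bits, read in binary, are independent and uniform below 2^B. -/
theorem expect_coins (m B T' : ℕ) (F : (Fin m → Fin (2 ^ B)) → ℝ) :
    𝔼 r : Fin (m * B + T') → Bool,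
      F (fun k => ⟨ofBits (coinAt r) (B * k) B, ofBits_lt _ _ _⟩) = 𝔼 U, F U := by
  let φ : (Fin (m * B) → Bool) ≃ (Fin m → Fin (2 ^ B)) :=
    (Equiv.arrowCongr finProdFinEquiv.symm finTwoEquiv.symm).trans <|
      (Equiv.curry _ _ _).trans <| Equiv.arrowCongr (Equiv.refl _) finFunctionFinEquiv
  have h3 : 𝔼 r : Fin (m * B) → Bool, F (φ r) = 𝔼 U, F U :=
    Fintype.expect_equiv φ _ _ fun _ => rfl
  rw [← h3, ← expect_castAdd (m * B) T' (fun r => F (φ r))]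
  refine Finset.expect_congr rfl fun r _ => ?_
  congr 1
  funext k
  apply Fin.ext
  simp only [φ, Equiv.trans_apply, Equiv.arrowCongr_apply, Equiv.refl_symm, Equiv.coe_refl,
    Function.comp_apply, id, finFunctionFinEquiv_apply, ofBits, Finset.sum_range]
  refine Finset.sum_congr rfl fun j _ => ?_
  have hk : B * (k : ℕ) + j < m * B + T' := by
    have := (finProdFinEquiv (k, j)).2
    rw [finProdFinEquiv_apply_val] at this
    simp only at this
    omega
  have e1 : coinAt r (B * k + j) = r (Fin.castAdd T' (finProdFinEquiv (k, j))) := by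
    rw [coinAt, dif_pos hk]
    congr 1
    apply Fin.ext
    simp only [Fin.val_castAdd, finProdFinEquiv_apply_val]
    omega
  rw [e1]
  simp only [Equiv.curry_apply, Function.curry_apply, Function.comp_apply, Equiv.symm_symm,
    Equiv.arrowCongr_apply]
  generalize r (Fin.castAdd T' (finProdFinEquiv (k, j))) = b
  cases b <;> simp [finTwoEquiv]

theorem toReal_map_uniform {T : ℕ} {α : Type*} [DecidableEq α] (f : (Fin T → Bool) → α) (a : α) :
    (((PMF.uniformOfFintype (Fin T → Bool)).map f) a).toReal =
      𝔼 r, if f r = a then (1 : ℝ) else 0 := by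
  rw [PMF.map_apply, tsum_fintype, Fintype.expect_eq_sum_div_card, ENNReal.toReal_sum]
  · rw [Finset.sum_div]
    refine Finset.sum_congr rfl fun r _ => ?_
    by_cases h : f r = a
    · simp [h]
    · simp [h, Ne.symm h]
  · intro r _
    split_ifs
    · exact PMF.apply_ne_top _ _
    · simp

/-- The output distribution of a test that keeps or negates a uniform bit string. -/
theorem sum_expect_keep {X : Type*} [Fintype X] [Nonempty X] (S : Fin n → Bool)
    (keep : ℤ → X → Prop) [∀ χ ξ, Decidable (keep χ ξ)] (y : Fin n → Bool) :
    ∑ x : Fin n → Bool, (𝔼 ξ, if (if keep (sgn S x) ξ then x else flipLast S x) = y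
      then (1 : ℝ) else 0) = 1 + if ∀ i, S i = false then 0 else
        (sgn S y : ℝ) * ((𝔼 ξ, if keep 1 ξ then (1 : ℝ) else 0) -
          𝔼 ξ, if keep (-1) ξ then (1 : ℝ) else 0) := by
  split_ifs with hS
  · simp [flipLast_of_forall_eq_false hS]
  · have h1 : ∀ x ξ, (if (if keep (sgn S x) ξ then x else flipLast S x) = y
        then (1 : ℝ) else 0) = (if x = y then if keep (sgn S y) ξ then (1 : ℝ) else 0 else 0) +
        (if x = flipLast S y then 1 - if keep (-sgn S y) ξ then (1 : ℝ) else 0 else 0) := by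
      intro x ξ
      have hne : flipLast S y ≠ y := by
        intro h
        have := sgn_flipLast hS y
        rw [h] at this
        rcases sgn_eq_one_or S y with h' | h' <;> rw [h'] at this <;> norm_num at this
      have hiff : flipLast S x = y ↔ x = flipLast S y :=
        ⟨fun h => by rw [← h, flipLast_flipLast], fun h => by rw [h, flipLast_flipLast]⟩
      by_cases hx : x = y
      · subst hx
        by_cases hk : keep (sgn S x) ξ <;> simp [hk, Ne.symm hne, hne]
      · by_cases hx' : x = flipLast S y
        · subst hx'
          rw [sgn_flipLast hS]
          by_cases hk : keep (-sgn S y) ξ <;> simp [hk, hne, flipLast_flipLast]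
        · by_cases hk : keep (sgn S x) ξ <;> simp [hk, hx, hx', hiff]
    simp only [h1, Finset.expect_add_distrib, Finset.sum_add_distrib]
    have h2 : ∀ (z : Fin n → Bool) (f : X → ℝ),
        ∑ x : Fin n → Bool, (𝔼 ξ, if x = z then f ξ else 0) = 𝔼 ξ, f ξ := by
      intro z f
      rw [Finset.sum_eq_single z]
      · simp
      · intro x _ hx; simp [hx]
      · simp
    rw [h2, h2, Finset.expect_sub_distrib]
    simp only [Fintype.expect_const]
    rcases sgn_eq_one_or S y with h | h <;> simp [h] <;> ring

/-! ### The cosine of an integer angle -/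

/-- Numerator of an approximation of `cos (D / G)` with denominator `(N * G) ^ N`. -/
def cosNum (N G : ℕ) (D : ℤ) : ℤ := ((⟨N * G, D⟩ : GaussianInt) ^ N).re

theorem norm_pow_sub_pow_le_of_norm_eq_one {a b : ℂ} {η : ℝ} (hb : ‖b‖ = 1) (h : ‖a - b‖ ≤ η)
    (k : ℕ) : ‖a ^ k - b ^ k‖ ≤ (1 + η) ^ k - 1 := by
  have hη : 0 ≤ η := (norm_nonneg _).trans h
  have ha : ‖a‖ ≤ 1 + η := by
    calc ‖a‖ = ‖b + (a - b)‖ := by ring_nf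
      _ ≤ ‖b‖ + ‖a - b‖ := norm_add_le _ _
      _ ≤ _ := by linarith
  induction k with
  | zero => simp
  | succ k ih =>
    calc ‖a ^ (k + 1) - b ^ (k + 1)‖ = ‖a ^ k * (a - b) + (a ^ k - b ^ k) * b‖ := by ring_nf
      _ ≤ ‖a ^ k * (a - b)‖ + ‖(a ^ k - b ^ k) * b‖ := norm_add_le _ _
      _ = ‖a‖ ^ k * ‖a - b‖ + ‖a ^ k - b ^ k‖ := by rw [norm_mul, norm_mul, hb, norm_pow, mul_one]
      _ ≤ (1 + η) ^ k * η + ((1 + η) ^ k - 1) := by gcongr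
      _ = _ := by ring

/-- With w = iδ/N, the numbers 1 + w and e^w differ by at most |w|², and |e^w| = 1. After N factors
the error is at most (1 + |w|²)^N - 1 ≤ e^(δ²/N) - 1 ≤ 2δ²/N. An error of order 1/N is enough, and
it avoids any Taylor series in the program. -/
theorem abs_re_pow_sub_cos_le {N : ℕ} (hN : 0 < N) {δ : ℝ} (h : δ ^ 2 ≤ N) :
    |((1 + (δ / N : ℝ) * Complex.I) ^ N).re - Real.cos δ| ≤ 2 * δ ^ 2 / N := by
  have hN' : (0 : ℝ) < N := by exact_mod_cast hN
  have hN1 : (1 : ℝ) ≤ N := by exact_mod_cast hN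
  set w : ℂ := (δ / N : ℝ) * Complex.I with hw
  have hnw : ‖w‖ = |δ| / N := by
    rw [hw, norm_mul, Complex.norm_I, mul_one, Complex.norm_real, Real.norm_eq_abs, abs_div,
      abs_of_pos hN']
  have hle : ‖w‖ ≤ 1 := by
    rw [hnw, div_le_one hN']
    exact abs_le_of_sq_le_sq (by nlinarith) hN'.le
  have hb : ‖Complex.exp w‖ = 1 := by rw [hw, Complex.norm_exp_ofReal_mul_I]
  have hab : ‖(1 + w) - Complex.exp w‖ ≤ ‖w‖ ^ 2 := by
    rw [← norm_neg]
    refine le_trans (le_of_eq ?_) (Complex.norm_exp_sub_one_sub_id_le hle)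
    congr 1; ring
  have h1 := norm_pow_sub_pow_le_of_norm_eq_one hb hab N
  have h2 : Complex.exp w ^ N = Complex.exp (δ * Complex.I) := by
    rw [← Complex.exp_nat_mul, hw]
    congr 1
    have : (N : ℂ) ≠ 0 := by exact_mod_cast hN.ne'
    push_cast
    field_simp
  have h3 : (1 + ‖w‖ ^ 2) ^ N ≤ Real.exp (δ ^ 2 / N) := by
    calc (1 + ‖w‖ ^ 2) ^ N ≤ Real.exp (‖w‖ ^ 2) ^ N := by
          gcongr
          rw [add_comm]; exact Real.add_one_le_exp _
      _ = Real.exp (δ ^ 2 / N) := by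
          rw [← Real.exp_nat_mul, hnw, div_pow, sq_abs]
          congr 1
          field_simp
  have h4 : δ ^ 2 / N ≤ 1 := (div_le_one hN').mpr h
  have h5 := Real.abs_exp_sub_one_le (x := δ ^ 2 / N)
    (by rwa [abs_of_nonneg (by positivity)])
  rw [abs_of_nonneg (by positivity : 0 ≤ δ ^ 2 / N)] at h5
  have h6 := (abs_le.mp h5).2
  calc _ = |((1 + w) ^ N - Complex.exp w ^ N).re| := by
        rw [h2, Complex.sub_re, Complex.exp_ofReal_mul_I_re]
    _ ≤ ‖(1 + w) ^ N - Complex.exp w ^ N‖ := Complex.abs_re_le_norm _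
    _ ≤ 2 * (δ ^ 2 / N) := by linarith
    _ = _ := by ring

theorem abs_cosNum_sub_le {N G : ℕ} (hN : 0 < N) (hG : 0 < G) {D : ℤ}
    (h : ((D : ℝ) / G) ^ 2 ≤ N) :
    |(cosNum N G D : ℝ) / ((N : ℝ) * G) ^ N - Real.cos (D / G)| ≤ 2 * ((D : ℝ) / G) ^ 2 / N := by
  have hG' : (G : ℂ) ≠ 0 := by exact_mod_cast hG.ne'
  have hN' : (N : ℂ) ≠ 0 := by exact_mod_cast hN.ne'
  refine le_trans (le_of_eq ?_) (abs_re_pow_sub_cos_le hN h)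
  congr 2
  have h1 : (cosNum N G D : ℝ) = (((N : ℂ) * G + D * Complex.I) ^ N).re := by
    rw [cosNum, GaussianInt.intCast_re, map_pow, GaussianInt.toComplex_def']
    push_cast; rfl
  have h2 : ((N : ℂ) * G + D * Complex.I) ^ N =
      ((((N : ℝ) * G) ^ N : ℝ) : ℂ) * (1 + (((D : ℝ) / G / N : ℝ) : ℂ) * Complex.I) ^ N := by
    push_cast
    rw [← mul_pow]
    congr 1
    field_simp
  rw [h1, h2, Complex.re_ofReal_mul, mul_div_cancel_left₀]
  have : (0 : ℝ) < N * G := by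
    have : 0 < N * G := Nat.mul_pos hN hG
    exact_mod_cast this
  positivity

/-! ### Phases with approximate angles -/

theorem map_layerPhase {R R' : Type*} [CommRing R] [CommRing R'] (f : R →+ R')
    (ang : Gate n → R) (L : List (Gate n)) (b : Fin n → Bool) :
    f (layerPhase ang L b) = layerPhase (fun g => f (ang g)) L b := by
  induction L with
  | nil => simp [layerPhase]
  | cons g L ih =>
    simp only [layerPhase, List.map_cons, List.sum_cons, map_add] at ih ⊢
    rw [ih, ← zsmul_eq_mul, map_zsmul, zsmul_eq_mul]

/-- The phase is an integer combination of the angles, hence natural for additive maps. It is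
applied to k ↦ k/G and to k ↦ 2πk. -/
theorem map_phaseDiff {R R' : Type*} [CommRing R] [CommRing R'] (f : R →+ R')
    (ang : Gate n → R) (S : Fin n → Bool) (Ls : List (List (Gate n))) (e : ℕ → Fin n → Bool)
    (b : Fin n → Bool) :
    f (phaseDiff ang S Ls e b) = phaseDiff (fun g => f (ang g)) S Ls e b := by
  induction Ls generalizing e b with
  | nil => simp [phaseDiff]
  | cons L Ls ih =>
    rw [phaseDiff, phaseDiff, map_add, map_sub, ih, map_layerPhase, map_layerPhase]

theorem layerPhase_sub {R : Type*} [CommRing R] (a a' : Gate n → R) (L : List (Gate n))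
    (b : Fin n → Bool) :
    layerPhase (fun g => a g - a' g) L b = layerPhase a L b - layerPhase a' L b := by
  induction L with
  | nil => simp [layerPhase]
  | cons g L ih =>
    simp only [layerPhase, List.map_cons, List.sum_cons] at ih ⊢
    rw [ih]; ring

theorem phaseDiff_sub {R : Type*} [CommRing R] (a a' : Gate n → R) (S : Fin n → Bool)
    (Ls : List (List (Gate n))) (e : ℕ → Fin n → Bool) (b : Fin n → Bool) :
    phaseDiff (fun g => a g - a' g) S Ls e b = phaseDiff a S Ls e b - phaseDiff a' S Ls e b := by
  induction Ls generalizing e b with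
  | nil => simp [phaseDiff]
  | cons L Ls ih =>
    rw [phaseDiff, phaseDiff, phaseDiff, ih, layerPhase_sub, layerPhase_sub]; ring

theorem abs_coef_mul_active_sub_le (g : Gate n) (b b' : Fin n → Bool) :
    |g.coef * g.active b - g.coef * g.active b'| ≤ 2 := by
  have h : ∀ b, g.active b = 0 ∨ g.active b = 1 := by
    intro b; rw [Gate.active]; split_ifs <;> simp
  have h' : g.coef = -2 ∨ g.coef = 1 := by cases g <;> simp [Gate.coef]
  rcases h b with h1 | h1 <;> rcases h b' with h2 | h2 <;> rcases h' with h3 | h3 <;>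
    rw [h1, h2, h3] <;> norm_num

theorem abs_layerPhase_sub_le {R : Type*} [CommRing R] [LinearOrder R] [IsStrictOrderedRing R]
    {c : R} (ang : Gate n → R) (h : ∀ g, |ang g| ≤ c)
    (L : List (Gate n)) (b b' : Fin n → Bool) :
    |layerPhase ang L b - layerPhase ang L b'| ≤ 2 * L.length * c := by
  induction L with
  | nil => simp [layerPhase]
  | cons g L ih =>
    simp only [layerPhase, List.map_cons, List.sum_cons] at ih ⊢
    have h1 : |((g.coef * g.active b - g.coef * g.active b' : ℤ) : R) * ang g| ≤ 2 * c := by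
      rw [abs_mul]
      have h2 : |((g.coef * g.active b - g.coef * g.active b' : ℤ) : R)| ≤ 2 := by
        rw [← Int.cast_abs]
        exact_mod_cast abs_coef_mul_active_sub_le g b b'
      exact mul_le_mul h2 (h g) (abs_nonneg _) (by norm_num)
    rw [show ∀ a a' s s' : R, a + s - (a' + s') = (a - a') + (s - s') by intros; ring]
    refine (abs_add_le _ _).trans ?_
    rw [← sub_mul, ← Int.cast_sub, List.length_cons]
    push_cast at ih h1 ⊢
    calc _ ≤ 2 * c + 2 * L.length * c := add_le_add h1 ih
      _ = _ := by ring

/-- Between two basis states a gate changes the phase by at most twice its angle, and there are at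
most n gates in a layer. -/
theorem abs_phaseDiff_le {R : Type*} [CommRing R] [LinearOrder R] [IsStrictOrderedRing R]
    {c : R} (hc : 0 ≤ c) (ang : Gate n → R) (h : ∀ g, |ang g| ≤ c)
    (S : Fin n → Bool) (Ls : List (List (Gate n))) (hL : ∀ L ∈ Ls, L.length ≤ n)
    (e : ℕ → Fin n → Bool) (b : Fin n → Bool) :
    |phaseDiff ang S Ls e b| ≤ 2 * n * Ls.length * c := by
  induction Ls generalizing e b with
  | nil => simp [phaseDiff]
  | cons L Ls ih =>
    rw [phaseDiff]
    have h1 := abs_layerPhase_sub_le ang h L b (flipOn S b)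
    have h2 := ih (fun L' hL' => hL L' (List.mem_cons_of_mem _ hL')) (fun t => e (t + 1))
      (damp S b (e 0))
    have h3 : (L.length : R) ≤ n := by exact_mod_cast hL L List.mem_cons_self
    refine (abs_add_le _ _).trans ?_
    rw [List.length_cons]
    push_cast
    nlinarith [mul_le_mul_of_nonneg_right h3 hc]

theorem phaseDiff_congr {R : Type*} [CommRing R] (ang : Gate n → R) (S : Fin n → Bool)
    (Ls : List (List (Gate n))) (e e' : ℕ → Fin n → Bool) (b : Fin n → Bool)
    (h : ∀ t < Ls.length, e t = e' t) : phaseDiff ang S Ls e b = phaseDiff ang S Ls e' b := by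
  induction Ls generalizing e e' b with
  | nil => simp [phaseDiff]
  | cons L Ls ih =>
    rw [phaseDiff, phaseDiff, h 0 (by simp), ih _ (fun t => e' (t + 1))]
    intro t ht
    exact h (t + 1) (by simpa using ht)

/-- The angle of a gate reduced modulo `2π`. -/
noncomputable def Gate.angleMod (g : Gate n) : ℝ := toIcoMod Real.two_pi_pos 0 g.angle

theorem Gate.angleMod_nonneg (g : Gate n) : 0 ≤ g.angleMod :=
  (toIcoMod_mem_Ico Real.two_pi_pos 0 g.angle).1

theorem Gate.angleMod_lt (g : Gate n) : g.angleMod < 7 := by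
  have h := (toIcoMod_mem_Ico Real.two_pi_pos 0 g.angle).2
  have := Real.pi_lt_d2
  rw [Gate.angleMod]
  linarith

/-- The angle of a gate in multiples of `1 / G`. -/
noncomputable def Gate.angleInt (G : ℕ) (g : Gate n) : ℤ := ⌊(G : ℝ) * g.angleMod⌋

theorem Gate.angleInt_nonneg (G : ℕ) (g : Gate n) : 0 ≤ g.angleInt G :=
  Int.floor_nonneg.mpr (mul_nonneg (Nat.cast_nonneg G) g.angleMod_nonneg)

theorem Gate.angleInt_le (G : ℕ) (g : Gate n) : g.angleInt G ≤ 7 * G := by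
  have h1 : (g.angleInt G : ℝ) ≤ G * g.angleMod := Int.floor_le _
  have h2 : (g.angleInt G : ℝ) ≤ (7 * G : ℤ) := by
    push_cast
    nlinarith [g.angleMod_lt, (Nat.cast_nonneg G : (0 : ℝ) ≤ G)]
  exact_mod_cast h2

/-- Since the coefficients -2 and 1 are integers, reducing the angles shifts the phase difference by
an integer multiple of 2π. -/
theorem cos_phaseDiff_angleMod (S : Fin n → Bool) (Ls : List (List (Gate n)))
    (e : ℕ → Fin n → Bool) (b : Fin n → Bool) :
    Real.cos (phaseDiff Gate.angleMod S Ls e b) = Real.cos (phaseDiff Gate.angle S Ls e b) := by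
  have h1 := phaseDiff_sub Gate.angle Gate.angleMod S Ls e b
  have h2 : (fun g : Gate n => g.angle - g.angleMod) =
      fun g => (zmultiplesHom ℝ (2 * Real.pi)) (toIcoDiv Real.two_pi_pos 0 g.angle) := by
    funext g
    rw [Gate.angleMod, self_sub_toIcoMod]; rfl
  rw [h2, ← map_phaseDiff] at h1
  rw [zmultiplesHom_apply, zsmul_eq_mul] at h1
  rw [← sub_add_cancel (phaseDiff Gate.angle S Ls e b) (phaseDiff Gate.angleMod S Ls e b), ← h1,
    add_comm, Real.cos_add_int_mul_two_pi]

/-- Integer angles are at most 7G, as 2π < 7, so |D/G| ≤ 2nd·7 = 14nd. The first error term comes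
from the power approximation of the cosine, the second from truncating the angles, the cosine being
1-Lipschitz. -/
theorem abs_cosNum_sub_cos_le {N G : ℕ} (hN : 0 < N) (hG : 0 < G) (S : Fin n → Bool)
    (Ls : List (List (Gate n))) (hL : ∀ L ∈ Ls, L.length ≤ n)
    (e : ℕ → Fin n → Bool) (b : Fin n → Bool)
    (h : ((14 : ℝ) * n * Ls.length) ^ 2 ≤ N) :
    |(cosNum N G (phaseDiff (Gate.angleInt G) S Ls e b) : ℝ) / ((N : ℝ) * G) ^ N -
      Real.cos (phaseDiff Gate.angle S Ls e b)| ≤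
      2 * ((14 : ℝ) * n * Ls.length) ^ 2 / N + 2 * n * Ls.length / G := by
  have hG' : (0 : ℝ) < G := by exact_mod_cast hG
  have hN' : (0 : ℝ) < N := by exact_mod_cast hN
  set D := phaseDiff (Gate.angleInt G) S Ls e b with hD
  have h1 : |D| ≤ 2 * n * Ls.length * (7 * G : ℤ) :=
    abs_phaseDiff_le (by positivity) _
      (fun g => by rw [abs_of_nonneg (g.angleInt_nonneg G)]; exact g.angleInt_le G) S Ls hL e b
  have h2 : |(D : ℝ) / G| ≤ 14 * n * Ls.length := by
    rw [abs_div, abs_of_pos hG', div_le_iff₀ hG']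
    have : ((|D| : ℤ) : ℝ) ≤ ((2 * n * Ls.length * (7 * G : ℤ) : ℤ) : ℝ) := by exact_mod_cast h1
    push_cast at this
    linarith
  have h3 : ((D : ℝ) / G) ^ 2 ≤ ((14 : ℝ) * n * Ls.length) ^ 2 := by
    rw [← sq_abs]
    gcongr
  have h4 := abs_cosNum_sub_le hN hG (h3.trans h)
  have h5 : (D : ℝ) / G = phaseDiff (fun g => (g.angleInt G : ℝ) / G) S Ls e b := by
    have := map_phaseDiff ((AddMonoidHom.mulRight ((G : ℝ)⁻¹)).comp (Int.castAddHom ℝ))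
      (Gate.angleInt G) S Ls e b
    simpa [div_eq_mul_inv] using this
  have h6 : |(D : ℝ) / G - phaseDiff Gate.angleMod S Ls e b| ≤ 2 * n * Ls.length * (1 / G) := by
    rw [h5, ← phaseDiff_sub]
    refine abs_phaseDiff_le (by positivity) _ (fun g => ?_) S Ls hL e b
    have e1 : (g.angleInt G : ℝ) ≤ G * g.angleMod := Int.floor_le _
    have e2 : G * g.angleMod < (g.angleInt G : ℝ) + 1 := Int.lt_floor_add_one _
    rw [abs_le]
    constructor
    · rw [neg_le_sub_iff_le_add, ← add_div, le_div_iff₀ hG']; linarith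
    · rw [sub_le_iff_le_add, div_le_iff₀ hG', add_mul, div_mul_cancel₀ _ hG'.ne']; linarith
  have h7 := Real.abs_cos_sub_cos_le (D / G : ℝ) (phaseDiff Gate.angleMod S Ls e b)
  rw [cos_phaseDiff_angleMod] at h7
  calc _ ≤ |(cosNum N G D : ℝ) / ((N : ℝ) * G) ^ N - Real.cos (D / G)| +
        |Real.cos (D / G) - Real.cos (phaseDiff Gate.angle S Ls e b)| := abs_sub_le _ _ _
    _ ≤ 2 * ((D : ℝ) / G) ^ 2 / N + 2 * n * Ls.length * (1 / G) :=
        add_le_add h4 (h7.trans h6)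
    _ ≤ 2 * ((14 : ℝ) * n * Ls.length) ^ 2 / N + 2 * n * Ls.length * (1 / G) := by gcongr
    _ = _ := by ring

/-! ### The sampler -/

/-- Test whether `u < G c`, where `c` is the ratio of the weight of `S` in the signed mixture and
the probability of `S`. -/
def ampTest (d G V P : ℕ) (S : Fin n → Bool) (u : ℕ) : Prop :=
  (u : ℤ) ^ 2 * ∏ i, (if S i then (V : ℤ) ^ 2 * (G : ℤ) ^ d else ((G : ℤ) - V) ^ 2) <
    (G : ℤ) ^ 2 * ∏ i, (if S i then (G : ℤ) ^ 2 * ((G : ℤ) - P) ^ d else (G : ℤ) ^ 2)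

/-- Test whether `w < G (1 + χ κ cos (D / G)) / 2`, with approximate cosine. -/
def keepTest (N G : ℕ) (D χ κ : ℤ) (w : ℕ) : Prop :=
  0 < (G : ℤ) * (((N : ℤ) * G) ^ N + χ * cosNum N G D * κ) - 2 * w * ((N : ℤ) * G) ^ N

open Classical in
/-- The output of the sampler as a function of its random choices. -/
noncomputable def sampler (N G V P : ℕ) (Ls : List (List (Gate n))) (S b x : Fin n → Bool)
    (e : ℕ → Fin n → Bool) (u w : ℕ) : Fin n → Bool :=
  if keepTest N G (phaseDiff (Gate.angleInt G) S Ls e b) (sgn S x)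
    (if ampTest Ls.length G V P S u then 1 else 0) w then x else flipLast S x

/-! ### Accuracy of the two tests -/

/-- For n ≥ 2, τ = V/G lies between 1/(2n) and 1/(2n-1), so (1-τ)^n ≥ 1 - nτ ≥ 1/3 by Bernoulli,
whereas s ≤ 1/(6n) ≤ τ/3. One spare factor 1/3 pays for all qubits outside S. The divisor 2n-1 makes
τ = 1 for n = 1, where only s ≤ 1 is known and the nonempty set must carry the full weight. The
second bound limits the loss on dividing by the weight. -/
theorem bernWeight_bounds {G V : ℕ} (hn : 0 < n) (hG : 2 * n * (2 * n - 1) ≤ G)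
    (hV : V = G / (2 * n - 1)) {s : ℝ} (hs0 : 0 ≤ s) (hs1 : s ≤ 1) (hs : s * (n : ℝ) ^ 4 ≤ 1)
    {S : Fin n → Bool} (hS : ¬ ∀ i, S i = false) :
    s ^ wt S ≤ bernWeight ((V : ℝ) / G) S ∧
      (1 / (6 * (n : ℝ))) ^ n ≤ bernWeight ((V : ℝ) / G) S := by
  have hk := wt_pos_iff.mpr hS
  have hkn := wt_le S
  have hGpos : 0 < G := lt_of_lt_of_le (Nat.mul_pos (by omega) (by omega)) hG
  have hGR : (0 : ℝ) < G := by exact_mod_cast hGpos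
  rw [bernWeight_eq]
  rcases Nat.lt_or_ge n 2 with h1 | h2
  · obtain rfl : n = 1 := by omega
    have hw : wt S = 1 := by omega
    have : (V : ℝ) / G = 1 := by
      rw [hV]; simp [hGR.ne']
    rw [hw, this]
    norm_num
    exact hs1
  · have hm : (0 : ℝ) < 2 * n - 1 := by
      have : (2 : ℝ) ≤ n := by exact_mod_cast h2
      linarith
    have hn2 : (2 : ℝ) ≤ n := by exact_mod_cast h2
    have hmc : ((2 * n - 1 : ℕ) : ℝ) = 2 * n - 1 := by
      rw [Nat.cast_sub (by omega)]; push_cast; rfl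
    have hτ1 : (V : ℝ) / G ≤ 1 / (2 * n - 1) := by
      rw [div_le_div_iff₀ hGR hm, one_mul, hV, ← hmc]
      exact_mod_cast Nat.div_mul_le_self G (2 * n - 1)
    have hτ0 : 1 / (2 * (n : ℝ)) ≤ (V : ℝ) / G := by
      have e1 : (G : ℝ) < (V + 1) * (2 * n - 1) := by
        rw [← hmc, hV]
        exact_mod_cast Nat.lt_mul_of_div_lt (Nat.lt_succ_self _) (show 0 < 2 * n - 1 by omega)
      have e2 : 2 * (n : ℝ) * (2 * n - 1) ≤ G := by
        rw [← hmc]; exact_mod_cast hG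
      rw [div_le_div_iff₀ (by positivity) hGR]
      nlinarith
    set τ := (V : ℝ) / G with hτ
    have hτpos : 0 < τ := lt_of_lt_of_le (by positivity) hτ0
    have hτle : τ ≤ 1 := hτ1.trans (by rw [div_le_one hm]; linarith)
    have h3 : (1 : ℝ) / 3 ≤ (1 - τ) ^ (n - wt S) := by
      calc (1 : ℝ) / 3 ≤ 1 + n * (-τ) := by
            have : (n : ℝ) * τ ≤ n * (1 / (2 * n - 1)) := by gcongr
            have h' : (n : ℝ) * (1 / (2 * n - 1)) ≤ 2 / 3 := by
              rw [mul_one_div, div_le_div_iff₀ hm (by norm_num)]; linarith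
            linarith
        _ ≤ (1 + -τ) ^ n := one_add_mul_le_pow (by linarith) n
        _ = (1 - τ) ^ n := by rw [sub_eq_add_neg]
        _ ≤ (1 - τ) ^ (n - wt S) := pow_le_pow_of_le_one (by linarith) (by linarith) (by omega)
    constructor
    · have h4 : s ≤ τ / 3 := by
        have : s ≤ 1 / (6 * n) := by
          rw [le_div_iff₀ (by positivity)]
          have h8 : (8 : ℝ) ≤ (n : ℝ) ^ 3 := by
            calc (8 : ℝ) = 2 ^ 3 := by norm_num
              _ ≤ _ := by gcongr
          calc s * (6 * n) ≤ s * ((n : ℝ) ^ 3 * n) := by gcongr; linarith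
            _ = s * (n : ℝ) ^ 4 := by ring
            _ ≤ 1 := hs
        calc s ≤ 1 / (6 * n) := this
          _ = (1 / (2 * n)) / 3 := by field_simp; norm_num
          _ ≤ _ := by gcongr
      have h5 : s ^ wt S ≤ τ ^ wt S / 3 := by
        obtain ⟨k, hk'⟩ : ∃ k, wt S = k + 1 := ⟨wt S - 1, by omega⟩
        rw [hk', pow_succ, pow_succ, mul_div_assoc]
        exact mul_le_mul (pow_le_pow_left₀ hs0 (by linarith) k) h4 hs0 (by positivity)
      calc s ^ wt S ≤ τ ^ wt S * (1 / 3) := by linarith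
        _ ≤ _ := by gcongr
    · calc (1 / (6 * (n : ℝ))) ^ n = (1 / (2 * n)) ^ n * (1 / 3) ^ n := by
            rw [← mul_pow]; congr 1; field_simp; norm_num
        _ ≤ τ ^ wt S * (1 / 3) := by
            gcongr ?_ * ?_
            · calc (1 / (2 * (n : ℝ))) ^ n ≤ (1 / (2 * n)) ^ wt S :=
                  pow_le_pow_of_le_one (by positivity)
                    (by rw [div_le_one (by positivity)]; linarith) hkn
                _ ≤ _ := by gcongr
            · calc (1 / 3 : ℝ) ^ n ≤ (1 / 3) ^ 1 :=
                  pow_le_pow_of_le_one (by norm_num) (by norm_num) hn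
                _ = _ := by norm_num
        _ ≤ _ := by gcongr

/-- Squaring removes the root, and the common positive factor G^(2n) G^(d|S|) clears the
denominators. Comparing two integer products thus decides u < G c exactly, for the truncated
strength P/G. -/
theorem ampTest_iff {d G V P : ℕ} (hG : 0 < G) (hP : P ≤ G) {S : Fin n → Bool}
    (hμ : 0 < bernWeight ((V : ℝ) / G) S) (u : ℕ) :
    ampTest d G V P S u ↔
      (u : ℝ) < Real.sqrt ((1 - (P : ℝ) / G) ^ (d * wt S)) / bernWeight ((V : ℝ) / G) S * G := by
  have hGR : (0 : ℝ) < G := by exact_mod_cast hG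
  set q : ℝ := 1 - (P : ℝ) / G with hq
  have hq0 : 0 ≤ q := by
    rw [hq, sub_nonneg, div_le_one hGR]; exact_mod_cast hP
  set μ := bernWeight ((V : ℝ) / G) S with hμdef
  have e1 : ∏ i, (if S i then (V : ℝ) ^ 2 * (G : ℝ) ^ d else ((G : ℝ) - V) ^ 2) =
      ((G : ℝ) ^ 2) ^ n * ((G : ℝ) ^ d) ^ wt S * μ ^ 2 := by
    rw [← prod_ite_eq_pow_wt, hμdef, bernWeight, ← Finset.prod_pow]
    have : ((G : ℝ) ^ 2) ^ n = ∏ _i : Fin n, (G : ℝ) ^ 2 := by simp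
    rw [this, ← Finset.prod_mul_distrib, ← Finset.prod_mul_distrib]
    refine Finset.prod_congr rfl fun i _ => ?_
    split_ifs <;> field_simp
  have e2 : ∏ i, (if S i then (G : ℝ) ^ 2 * ((G : ℝ) - P) ^ d else (G : ℝ) ^ 2) =
      ((G : ℝ) ^ 2) ^ n * ((G : ℝ) ^ d) ^ wt S * q ^ (d * wt S) := by
    rw [pow_mul q, ← prod_ite_eq_pow_wt, ← prod_ite_eq_pow_wt]
    have : ((G : ℝ) ^ 2) ^ n = ∏ _i : Fin n, (G : ℝ) ^ 2 := by simp
    rw [this, ← Finset.prod_mul_distrib, ← Finset.prod_mul_distrib]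
    refine Finset.prod_congr rfl fun i _ => ?_
    have : (G : ℝ) - P = G * q := by rw [hq]; field_simp
    split_ifs
    · rw [this, mul_pow]; ring
    · ring
  have e3 : ampTest d G V P S u ↔
      (u : ℝ) ^ 2 * ∏ i, (if S i then (V : ℝ) ^ 2 * (G : ℝ) ^ d else ((G : ℝ) - V) ^ 2) <
      (G : ℝ) ^ 2 * ∏ i, (if S i then (G : ℝ) ^ 2 * ((G : ℝ) - P) ^ d else (G : ℝ) ^ 2) := by
    rw [ampTest, ← Int.cast_lt (R := ℝ)]
    push_cast
    rfl
  have hc : 0 < ((G : ℝ) ^ 2) ^ n * ((G : ℝ) ^ d) ^ wt S := by positivity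
  have e4 : (u : ℝ) ^ 2 * (((G : ℝ) ^ 2) ^ n * ((G : ℝ) ^ d) ^ wt S * μ ^ 2) <
      (G : ℝ) ^ 2 * (((G : ℝ) ^ 2) ^ n * ((G : ℝ) ^ d) ^ wt S * q ^ (d * wt S)) ↔
      (u * μ / G : ℝ) ^ 2 < q ^ (d * wt S) := by
    rw [div_pow, div_lt_iff₀ (by positivity), ← mul_lt_mul_iff_right₀ hc
      (b := (u * μ : ℝ) ^ 2) (c := q ^ (d * wt S) * (G : ℝ) ^ 2)]
    ring_nf
  rw [e3, e1, e2, e4, ← Real.lt_sqrt (by positivity), div_lt_iff₀ hGR, div_mul_eq_mul_div,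
    lt_div_iff₀ hμ]

/-- Only Hölder continuity of order 1/2 is available, as 1-p may vanish. This is why the lower bound
`hbig` on G below involves squares of E and (6n)^n. -/
theorem abs_sqrt_sub_sqrt_le {x y : ℝ} (hx : 0 ≤ x) (hy : 0 ≤ y) :
    |Real.sqrt x - Real.sqrt y| ≤ Real.sqrt |x - y| := by
  have key : ∀ a b : ℝ, 0 ≤ a → 0 ≤ b → Real.sqrt a ≤ Real.sqrt b + Real.sqrt |a - b| := by
    intro a b ha hb
    rw [Real.sqrt_le_left (by positivity), add_sq, Real.sq_sqrt hb, Real.sq_sqrt (abs_nonneg _)]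
    have := mul_nonneg (Real.sqrt_nonneg b) (Real.sqrt_nonneg |a - b|)
    linarith [le_abs_self (a - b)]
  have h1 := key x y hx hy
  have h2 := key y x hy hx
  rw [abs_sub_comm] at h2
  rw [abs_le]
  constructor <;> linarith

theorem expect_boole {G : ℕ} (P : Fin G → Prop) [DecidablePred P] :
    (𝔼 w, if P w then (1 : ℝ) else 0) = ((Finset.univ.filter P).card : ℝ) / G := by
  rw [Fintype.expect_eq_sum_div_card, Finset.sum_boole, Fintype.card_fin]

-- Truncating p to P/G moves (1-p)^(d|S|) by at most dn/G, hence its root by √(dn/G). Dividing by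
-- μ(S) ≥ (6n)^(-n) leaves at most 1/(4E) by `hbig`, and the threshold adds 1/G.
open Classical in
theorem abs_expect_ampTest_sub_le {d G V P E : ℕ} (hG : 0 < G) (hP : P ≤ G) (hE : 0 < E)
    (hn : 0 < n) {p : ℝ} (hp0 : 0 ≤ p) (hp1 : p ≤ 1) (hPp : |(P : ℝ) / G - p| ≤ 1 / G)
    {S : Fin n → Bool}
    (hμ1 : Real.sqrt (1 - p) ^ (d * wt S) ≤ bernWeight ((V : ℝ) / G) S)
    (hμ2 : (1 / (6 * (n : ℝ))) ^ n ≤ bernWeight ((V : ℝ) / G) S)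
    (hbig : 16 * (E : ℝ) ^ 2 * (d * n) * ((6 * (n : ℝ)) ^ n) ^ 2 ≤ G) :
    |(𝔼 u : Fin G, if ampTest d G V P S u then (1 : ℝ) else 0) -
      Real.sqrt (1 - p) ^ (d * wt S) / bernWeight ((V : ℝ) / G) S| ≤ 1 / (4 * E) + 1 / G := by
  have hGR : (0 : ℝ) < G := by exact_mod_cast hG
  have hER : (0 : ℝ) < E := by exact_mod_cast hE
  have hnR : (0 : ℝ) < n := by exact_mod_cast hn
  set μ := bernWeight ((V : ℝ) / G) S with hμdef
  have hμ : 0 < μ := lt_of_lt_of_le (by positivity) hμ2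
  simp only [ampTest_iff hG hP hμ]
  rw [expect_boole]
  refine abs_card_lt_div_sub_le hG (by positivity) ((div_le_one hμ).mpr hμ1) ?_
  rw [← sub_div, abs_div, abs_of_pos hμ, div_le_iff₀ hμ]
  have h1 : Real.sqrt (1 - p) ^ (d * wt S) = Real.sqrt ((1 - p) ^ (d * wt S)) := by
    rw [eq_comm, Real.sqrt_eq_iff_mul_self_eq (pow_nonneg (by linarith) _) (by positivity),
      ← mul_pow, Real.mul_self_sqrt (by linarith)]
  have hq0 : 0 ≤ 1 - (P : ℝ) / G := by
    rw [sub_nonneg, div_le_one hGR]; exact_mod_cast hP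
  have hq1 : 1 - (P : ℝ) / G ≤ 1 := by
    have : (0 : ℝ) ≤ (P : ℝ) / G := by positivity
    linarith
  rw [h1]
  refine (abs_sqrt_sub_sqrt_le (pow_nonneg hq0 _) (pow_nonneg (by linarith) _)).trans ?_
  rw [Real.sqrt_le_left (by positivity)]
  have h2 : |(1 - (P : ℝ) / G) ^ (d * wt S) - (1 - p) ^ (d * wt S)| ≤ (d * n : ℝ) / G := by
    refine (abs_pow_sub_pow_le _ _ _).trans ?_
    have e1 : |1 - (P : ℝ) / G - (1 - p)| ≤ 1 / G := by
      rw [show 1 - (P : ℝ) / G - (1 - p) = -((P : ℝ) / G - p) by ring, abs_neg]; exact hPp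
    have e2 : max |1 - (P : ℝ) / G| |1 - p| ^ (d * wt S - 1) ≤ 1 := by
      refine pow_le_one₀ (le_max_of_le_left (abs_nonneg _)) (max_le ?_ ?_)
      · rwa [abs_of_nonneg hq0]
      · rw [abs_of_nonneg (by linarith)]; linarith
    have e3 : ((d * wt S : ℕ) : ℝ) ≤ d * n := by
      push_cast
      gcongr
      exact wt_le S
    calc _ ≤ 1 / G * (d * n : ℝ) * 1 := by gcongr
      _ = _ := by ring
  refine h2.trans ?_
  rw [div_le_iff₀ hGR]
  have h3 : 1 ≤ (6 * (n : ℝ)) ^ n * μ := by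
    calc (1 : ℝ) = (6 * (n : ℝ)) ^ n * (1 / (6 * (n : ℝ))) ^ n := by
          rw [← mul_pow, mul_one_div_cancel (by positivity), one_pow]
      _ ≤ _ := by gcongr
  have h4 : 1 ≤ ((6 * (n : ℝ)) ^ n * μ) ^ 2 := one_le_pow₀ h3
  calc (d * n : ℝ) ≤ d * n * ((6 * (n : ℝ)) ^ n * μ) ^ 2 := le_mul_of_one_le_right (by positivity) h4
    _ = (1 / (4 * E) * μ) ^ 2 * (16 * (E : ℝ) ^ 2 * (d * n) * ((6 * (n : ℝ)) ^ n) ^ 2) := by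
        field_simp; norm_num
    _ ≤ _ := by gcongr

open Classical in
theorem abs_expect_keepTest_sub_le {N G : ℕ} (hN : 0 < N) (hG : 0 < G) {D χ : ℤ} (hχ : χ = 1 ∨ χ = -1)
    {η c : ℝ} (hc : |c| ≤ 1) (h : |(cosNum N G D : ℝ) / ((N : ℝ) * G) ^ N - c| ≤ η) :
    |(𝔼 w : Fin G, if keepTest N G D χ 1 w then (1 : ℝ) else 0) - (1 + χ * c) / 2| ≤
      η / 2 + 1 / G := by
  have hGR : (0 : ℝ) < G := by exact_mod_cast hG
  have hNR : (0 : ℝ) < N := by exact_mod_cast hN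
  set M : ℝ := ((N : ℝ) * G) ^ N with hM
  have hM0 : 0 < M := by positivity
  have h1 : ∀ w : Fin G, keepTest N G D χ 1 w ↔
      ((w : ℕ) : ℝ) < ((1 + χ * ((cosNum N G D : ℝ) / M)) / 2) * G := by
    intro w
    rw [keepTest, ← Int.cast_lt (R := ℝ)]
    push_cast
    rw [← hM, sub_pos, mul_one, show ((1 + χ * ((cosNum N G D : ℝ) / M)) / 2) * G =
      (G * (M + χ * cosNum N G D)) / (2 * M) by field_simp, lt_div_iff₀ (by positivity)]
    ring_nf
  simp only [h1]
  rw [expect_boole]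
  have hχ' : |(χ : ℝ)| = 1 := by rcases hχ with rfl | rfl <;> simp
  have h2 : |χ * c| ≤ 1 := by rwa [abs_mul, hχ', one_mul]
  obtain ⟨h3, h4⟩ := abs_le.mp h2
  refine abs_card_lt_div_sub_le hG (by linarith) (by linarith) ?_
  rw [← sub_div, add_sub_add_left_eq_sub, ← mul_sub, abs_div, abs_mul, hχ', one_mul, abs_two]
  gcongr

/-- Difference of the probabilities that the sampler keeps strings of even and of odd parity. -/
noncomputable def keepBias (d N G V P : ℕ) (D : ℤ) (S : Fin n → Bool) : ℝ := by
  classical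
  exact (𝔼 ξ : Fin G × Fin G,
      if keepTest N G D 1 (if ampTest d G V P S ξ.1 then 1 else 0) ξ.2 then (1 : ℝ) else 0) -
    𝔼 ξ : Fin G × Fin G,
      if keepTest N G D (-1) (if ampTest d G V P S ξ.1 then 1 else 0) ξ.2 then (1 : ℝ) else 0

-- If the amplitude test fails, then κ = 0 and keeping no longer depends on the parity, so such
-- draws cancel in the difference. The amplitude therefore acts as a multiplicative factor and never
-- has to be computed.
open Classical in
theorem keepBias_eq {d N G V P : ℕ} (D : ℤ) (S : Fin n → Bool) :
    keepBias d N G V P D S = (𝔼 u : Fin G, if ampTest d G V P S u then (1 : ℝ) else 0) *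
      ((𝔼 w : Fin G, if keepTest N G D 1 1 w then (1 : ℝ) else 0) -
        𝔼 w : Fin G, if keepTest N G D (-1) 1 w then (1 : ℝ) else 0) := by
  have h0 : ∀ w : Fin G, keepTest N G D (-1) 0 w ↔ keepTest N G D 1 0 w := by
    intro w; simp [keepTest]
  have h1 : ∀ χ : ℤ, (𝔼 ξ : Fin G × Fin G,
      if keepTest N G D χ (if ampTest d G V P S ξ.1 then 1 else 0) ξ.2 then (1 : ℝ) else 0) =
      𝔼 u : Fin G, ((if ampTest d G V P S u then (1 : ℝ) else 0) *
        ((𝔼 w : Fin G, if keepTest N G D χ 1 w then (1 : ℝ) else 0) -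
          𝔼 w : Fin G, if keepTest N G D χ 0 w then (1 : ℝ) else 0) +
        𝔼 w : Fin G, if keepTest N G D χ 0 w then (1 : ℝ) else 0) := by
    intro χ
    rw [← Finset.univ_product_univ, Finset.expect_product]
    refine Finset.expect_congr rfl fun u _ => ?_
    by_cases hu : ampTest d G V P S u
    · simp [hu]
    · simp [hu]
  rw [keepBias]
  simp only [h1, h0, Finset.expect_add_distrib, ← Finset.expect_mul]
  ring

theorem abs_keepBias_sub_le {d N G V P E : ℕ} (hN : 0 < N) (hG : 0 < G) (hP : P ≤ G) (hE : 0 < E)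
    (hn : 0 < n) {p : ℝ} (hp0 : 0 ≤ p) (hp1 : p ≤ 1) (hPp : |(P : ℝ) / G - p| ≤ 1 / G)
    {S : Fin n → Bool}
    (hμ1 : Real.sqrt (1 - p) ^ (d * wt S) ≤ bernWeight ((V : ℝ) / G) S)
    (hμ2 : (1 / (6 * (n : ℝ))) ^ n ≤ bernWeight ((V : ℝ) / G) S)
    (hbig : 16 * (E : ℝ) ^ 2 * (d * n) * ((6 * (n : ℝ)) ^ n) ^ 2 ≤ G)
    {D : ℤ} {c η : ℝ} (hc : |c| ≤ 1) (h : |(cosNum N G D : ℝ) / ((N : ℝ) * G) ^ N - c| ≤ η) :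
    |bernWeight ((V : ℝ) / G) S * keepBias d N G V P D S -
      Real.sqrt (1 - p) ^ (d * wt S) * c| ≤
      bernWeight ((V : ℝ) / G) S * (η + 3 / G + 1 / (4 * E)) := by
  classical
  have hnR : (0 : ℝ) < n := by exact_mod_cast hn
  set μ := bernWeight ((V : ℝ) / G) S with hμdef
  have hμ : 0 < μ := lt_of_lt_of_le (by positivity) hμ2
  have h1 := abs_expect_ampTest_sub_le hG hP hE hn hp0 hp1 hPp hμ1 hμ2 hbig
  have h2 := abs_expect_keepTest_sub_le hN hG (Or.inl rfl) hc h
  have h3 := abs_expect_keepTest_sub_le hN hG (Or.inr rfl) hc h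
  rw [keepBias_eq]
  have hA0 : 0 ≤ (𝔼 u : Fin G, if ampTest d G V P S u then (1 : ℝ) else 0) :=
    Finset.expect_nonneg fun u _ => by split_ifs <;> norm_num
  have hA1 : (𝔼 u : Fin G, if ampTest d G V P S u then (1 : ℝ) else 0) ≤ 1 := by
    have : Nonempty (Fin G) := ⟨⟨0, hG⟩⟩
    exact Finset.expect_le Finset.univ_nonempty fun u _ => by split_ifs <;> norm_num
  set A := (𝔼 u : Fin G, if ampTest d G V P S u then (1 : ℝ) else 0)
  set r := (𝔼 w : Fin G, if keepTest N G D 1 1 w then (1 : ℝ) else 0)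
  set r' := (𝔼 w : Fin G, if keepTest N G D (-1) 1 w then (1 : ℝ) else 0)
  rw [← hμdef] at h1
  set s := Real.sqrt (1 - p) ^ (d * wt S)
  have h4 : |r - r' - c| ≤ η + 2 / G := by
    push_cast at h2 h3
    obtain ⟨a1, a2⟩ := abs_le.mp h2
    obtain ⟨b1, b2⟩ := abs_le.mp h3
    have : (2 : ℝ) / G = 1 / G + 1 / G := by ring
    rw [abs_le, this]
    constructor <;> linarith
  -- With μ factored out, the comparison is between the products of A by r - r' and of s/μ by c, all
  -- of which are close to numbers of modulus at most one.
  have h5 : μ * (A * (r - r')) - s * c = μ * (A * (r - r' - c) + (A - s / μ) * c) := by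
    field_simp; ring
  rw [h5, abs_mul, abs_of_pos hμ]
  refine mul_le_mul_of_nonneg_left ?_ hμ.le
  calc _ ≤ |A * (r - r' - c)| + |(A - s / μ) * c| := abs_add_le _ _
    _ = A * |r - r' - c| + |A - s / μ| * |c| := by rw [abs_mul, abs_mul, abs_of_nonneg hA0]
    _ ≤ 1 * (η + 2 / G) + (1 / (4 * E) + 1 / G) * 1 := by
        have : 0 ≤ η + 2 / G := (abs_nonneg _).trans h4
        gcongr
    _ = _ := by ring

/-! ### The law of the sampler and its error -/

-- The averages are evaluated from the inside out: the decay path, then x (through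
-- `sum_expect_keep`), then b, then S. All are exact, G being even for the fair bits. What remains
-- unevaluated is the average over u and w in `keepBias`.
open Classical in
theorem expect_sampler_eq {G V P N : ℕ} (hG : 0 < G) (hG2 : 2 ∣ G) (hV : V ≤ G) (hP : P ≤ G)
    (Ls : List (List (Gate n))) (x : Fin n → Bool) :
    (𝔼 U : Fin (n + (n + (n + (Ls.length * n + (1 + 1))))) → Fin G,
      if sampler N G V P Ls (fun i => decide (drawAt U i < V))
        (fun i => decide (drawAt U (n + i) < G / 2))
        (fun i => decide (drawAt U (n + (n + i)) < G / 2))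
        (fun t i => decide (drawAt U (n + (n + (n + (i + n * t)))) < P))
        (drawAt U (n + (n + (n + (Ls.length * n)))))
        (drawAt U (n + (n + (n + (Ls.length * n + 1))))) = x then (1 : ℝ) else 0) =
    (1 / 2) ^ n * ∑ S : Fin n → Bool, bernWeight ((V : ℝ) / G) S *
      (1 + if ∀ i, S i = false then 0 else (sgn S x : ℝ) *
        ((1 / 2) ^ n * ∑ b : Fin n → Bool, ∑ e : Fin Ls.length → Fin n → Bool,
          (∏ t, bernWeight ((P : ℝ) / G) (e t)) *
            keepBias Ls.length N G V P (phaseDiff (Gate.angleInt G) S Ls (extend e) b) S)) := by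
  have : Nonempty (Fin G) := ⟨⟨0, hG⟩⟩
  have hhalf : ((G / 2 : ℕ) : ℝ) / G = 1 / 2 := by
    have : (G : ℝ) ≠ 0 := by exact_mod_cast hG.ne'
    rw [Nat.cast_div hG2 (by norm_num)]
    push_cast
    field_simp
  let Φ : (Fin n → Bool) → (Fin n → Bool) → (Fin n → Bool) → (Fin Ls.length → Fin n → Bool) →
      ℕ → ℕ → ℝ := fun S b y e u w =>
    if sampler N G V P Ls S b y (extend e) u w = x then (1 : ℝ) else 0
  have h1 := expect_draws (n := n) (d := Ls.length) (G := G) fun a b c e u w =>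
    Φ (fun i => decide (a i < V)) (fun i => decide (b i < G / 2)) (fun i => decide (c i < G / 2))
      (fun t i => decide (e t i < P)) u w
  have h2 : ∀ U : Fin (n + (n + (n + (Ls.length * n + (1 + 1))))) → Fin G,
      sampler N G V P Ls (fun i => decide (drawAt U i < V))
        (fun i => decide (drawAt U (n + i) < G / 2))
        (fun i => decide (drawAt U (n + (n + i)) < G / 2))
        (fun t i => decide (drawAt U (n + (n + (n + (i + n * t)))) < P)) =
      sampler N G V P Ls (fun i => decide (drawAt U i < V))
        (fun i => decide (drawAt U (n + i) < G / 2))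
        (fun i => decide (drawAt U (n + (n + i)) < G / 2))
        (extend (d := Ls.length) fun t i => decide (drawAt U (n + (n + (n + (i + n * t)))) < P)) := by
    intro U
    funext u w
    rw [sampler, sampler, phaseDiff_congr _ _ _ _ (extend (d := Ls.length) fun t i =>
      decide (drawAt U (n + (n + (n + (i + n * t)))) < P))]
    intro t ht
    simp [extend, ht]
  simp only [h2]
  refine h1.trans ?_
  have hcurry : ∀ F : (Fin Ls.length → Fin n → Bool) → ℝ,
      ∑ e : Fin Ls.length × Fin n → Bool, bernWeight ((P : ℝ) / G) e * F (fun t i => e (t, i)) =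
      ∑ e : Fin Ls.length → Fin n → Bool, (∏ t, bernWeight ((P : ℝ) / G) (e t)) * F e := by
    intro F
    refine Fintype.sum_equiv (Equiv.curry _ _ _) _ _ fun e => ?_
    congr 1
    rw [bernWeight, Fintype.prod_prod_type]
    rfl
  have h3 : ∀ (a b c : Fin n → Bool),
      (𝔼 e : Fin Ls.length × Fin n → Fin G, 𝔼 u : Fin G, 𝔼 w : Fin G,
        Φ a b c (fun t i => decide ((e (t, i) : ℕ) < P)) u w) =
      ∑ e : Fin Ls.length → Fin n → Bool, (∏ t, bernWeight ((P : ℝ) / G) (e t)) *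
        𝔼 u : Fin G, 𝔼 w : Fin G, Φ a b c e u w := by
    intro a b c
    rw [← hcurry fun e => 𝔼 u : Fin G, 𝔼 w : Fin G, Φ a b c e u w]
    exact expect_threshold hG hP fun e : Fin Ls.length × Fin n → Bool =>
      𝔼 u : Fin G, 𝔼 w : Fin G, Φ a b c (fun t i => e (t, i)) u w
  simp only [h3]
  have h4 : ∀ (a b : Fin n → Bool), (𝔼 c : Fin n → Fin G,
      ∑ e : Fin Ls.length → Fin n → Bool, (∏ t, bernWeight ((P : ℝ) / G) (e t)) *
        𝔼 u : Fin G, 𝔼 w : Fin G, Φ a b (fun i => decide ((c i : ℕ) < G / 2)) e u w) =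
      (1 / 2) ^ n * ∑ e : Fin Ls.length → Fin n → Bool, (∏ t, bernWeight ((P : ℝ) / G) (e t)) *
        (1 + if ∀ i, a i = false then 0 else (sgn a x : ℝ) *
          keepBias Ls.length N G V P (phaseDiff (Gate.angleInt G) a Ls (extend e) b) a) := by
    intro a b
    rw [expect_threshold hG (Nat.div_le_self G 2) fun c : Fin n → Bool =>
      ∑ e : Fin Ls.length → Fin n → Bool, (∏ t, bernWeight ((P : ℝ) / G) (e t)) *
        𝔼 u : Fin G, 𝔼 w : Fin G, Φ a b c e u w]
    simp only [hhalf, bernWeight_half]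
    rw [← Finset.mul_sum, Finset.sum_comm]
    congr 1
    refine Finset.sum_congr rfl fun e _ => ?_
    rw [← Finset.mul_sum]
    congr 1
    rw [keepBias, ← sum_expect_keep a (fun χ (ξ : Fin G × Fin G) => keepTest N G
      (phaseDiff (Gate.angleInt G) a Ls (extend e) b) χ
      (if ampTest Ls.length G V P a ξ.1 then 1 else 0) ξ.2) x]
    refine Finset.sum_congr rfl fun c _ => ?_
    rw [← Finset.univ_product_univ, Finset.expect_product]
    rfl
  simp only [h4]
  have h5 : ∀ a : Fin n → Bool, (𝔼 b : Fin n → Fin G, (1 / 2) ^ n *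
      ∑ e : Fin Ls.length → Fin n → Bool, (∏ t, bernWeight ((P : ℝ) / G) (e t)) *
        (1 + if ∀ i, a i = false then 0 else (sgn a x : ℝ) *
          keepBias Ls.length N G V P (phaseDiff (Gate.angleInt G) a Ls (extend e)
            (fun i => decide ((b i : ℕ) < G / 2))) a)) =
      (1 / 2) ^ n * (1 + if ∀ i, a i = false then 0 else (sgn a x : ℝ) *
        ((1 / 2) ^ n * ∑ b : Fin n → Bool, ∑ e : Fin Ls.length → Fin n → Bool,
          (∏ t, bernWeight ((P : ℝ) / G) (e t)) *
            keepBias Ls.length N G V P (phaseDiff (Gate.angleInt G) a Ls (extend e) b) a)) := by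
    intro a
    rw [expect_threshold hG (Nat.div_le_self G 2) fun b : Fin n → Bool => (1 / 2) ^ n *
      ∑ e : Fin Ls.length → Fin n → Bool, (∏ t, bernWeight ((P : ℝ) / G) (e t)) *
        (1 + if ∀ i, a i = false then 0 else (sgn a x : ℝ) *
          keepBias Ls.length N G V P (phaseDiff (Gate.angleInt G) a Ls (extend e) b) a)]
    simp only [hhalf, bernWeight_half]
    have hW : ∑ e : Fin Ls.length → Fin n → Bool, ∏ t, bernWeight ((P : ℝ) / G) (e t) = 1 := by
      rw [← Fintype.prod_sum (fun (_ : Fin Ls.length) a => bernWeight ((P : ℝ) / G) a),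
        sum_bernWeight]; simp
    rw [← Finset.mul_sum, ← Finset.mul_sum]
    have hone : (1 / 2 : ℝ) ^ n * 2 ^ n = 1 := by rw [← mul_pow]; norm_num
    split_ifs with ha
    · simp only [add_zero, mul_one, hW, Finset.sum_const, Finset.card_univ, Fintype.card_pi,
        Fintype.card_bool, Finset.prod_const, Fintype.card_fin, nsmul_eq_mul]
      push_cast
      rw [hone, mul_one]
    · simp only [mul_add, mul_one, Finset.sum_add_distrib, hW, Finset.sum_const, Finset.card_univ,
        Fintype.card_pi, Fintype.card_bool, Finset.prod_const, Fintype.card_fin, nsmul_eq_mul]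
      push_cast
      rw [hone, mul_one]
      congr 2
      simp only [Finset.mul_sum]
      refine Finset.sum_congr rfl fun b _ => Finset.sum_congr rfl fun e _ => ?_
      ring
  simp only [h5]
  rw [expect_threshold hG hV fun a : Fin n → Bool => (1 / 2) ^ n *
      (1 + if ∀ i, a i = false then 0 else (sgn a x : ℝ) *
        ((1 / 2) ^ n * ∑ b : Fin n → Bool, ∑ e : Fin Ls.length → Fin n → Bool,
          (∏ t, bernWeight ((P : ℝ) / G) (e t)) *
            keepBias Ls.length N G V P (phaseDiff (Gate.angleInt G) a Ls (extend e) b) a)),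
    Finset.mul_sum]
  refine Finset.sum_congr rfl fun S _ => ?_
  ring

-- The error budget, relative to μ(S) for each nonempty S, is 1/(4E) for the cosine, 1/(4E) for the
-- amplitude, and (4nd+3)/G ≤ 1/(2E) for the truncated angles, the thresholds and the decay
-- probability.
open Classical in
theorem sum_abs_expect_sampler_sub_le {l : ℕ} (C : Circuit n l) {p : ℝ} {E N G V P : ℕ}
    (hn : 0 < n) (hE : 0 < E) (hp0 : 0 ≤ p) (hp1 : p ≤ 1)
    (hG2 : 2 ∣ G) (hbig : 16 * (E : ℝ) ^ 2 * (C.depth * n) * ((6 * (n : ℝ)) ^ n) ^ 2 ≤ G)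
    (hGn : 2 * n * (2 * n - 1) ≤ G) (hGd : 14 * E * (n * C.depth) ≤ G)
    (hV : V = G / (2 * n - 1)) (hP : P ≤ G) (hPp : |(P : ℝ) / G - p| ≤ 1 / G)
    (hN : N = 1600 * E * (n * C.depth) ^ 2) (hd : 0 < C.depth)
    (hs : Real.sqrt (1 - p) ^ C.depth * (n : ℝ) ^ 4 ≤ 1)
    (hL : ∀ L ∈ C.layers, L.length ≤ n) :
    ∑ x : Fin n → Bool, |(𝔼 U : Fin (n + (n + (n + (C.layers.length * n + (1 + 1))))) → Fin G,
      if sampler N G V P C.layers (fun i => decide (drawAt U i < V))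
        (fun i => decide (drawAt U (n + i) < G / 2))
        (fun i => decide (drawAt U (n + (n + i)) < G / 2))
        (fun t i => decide (drawAt U (n + (n + (n + (i + n * t)))) < P))
        (drawAt U (n + (n + (n + (C.layers.length * n)))))
        (drawAt U (n + (n + (n + (C.layers.length * n + 1))))) = x then (1 : ℝ) else 0) -
      bornProb C p x| ≤ 1 / E := by
  have hnd : 0 < n * C.depth := Nat.mul_pos hn hd
  have hG : 0 < G := lt_of_lt_of_le (Nat.mul_pos (Nat.mul_pos (by norm_num) hE) hnd) hGd
  have hGR : (0 : ℝ) < G := by exact_mod_cast hG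
  have hER : (0 : ℝ) < E := by exact_mod_cast hE
  have hndR : (1 : ℝ) ≤ n * C.depth := by exact_mod_cast hnd
  have hNpos : 0 < N := by rw [hN]; positivity
  have hNR : (0 : ℝ) < N := by exact_mod_cast hNpos
  have hVG : V ≤ G := hV ▸ Nat.div_le_self _ _
  have hP01 : (P : ℝ) / G ≤ 1 := by rw [div_le_one hGR]; exact_mod_cast hP
  have hP00 : (0 : ℝ) ≤ (P : ℝ) / G := by positivity
  have hV01 : (V : ℝ) / G ≤ 1 := by rw [div_le_one hGR]; exact_mod_cast hVG
  have hs0 : 0 ≤ Real.sqrt (1 - p) := Real.sqrt_nonneg _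
  have hs1 : Real.sqrt (1 - p) ≤ 1 := Real.sqrt_le_iff.mpr ⟨zero_le_one, by linarith⟩
  have hhalf : (1 / 2 : ℝ) ^ n * 2 ^ n = 1 := by rw [← mul_pow]; norm_num
  have hWsum : ∀ q : ℝ, ∑ e : Fin C.depth → Fin n → Bool, ∏ t, bernWeight q (e t) = 1 := by
    intro q
    rw [← Fintype.prod_sum (fun (_ : Fin C.depth) a => bernWeight q a), sum_bernWeight]; simp
  set δ : ℝ := 2 * ((14 : ℝ) * n * C.depth) ^ 2 / N + 2 * n * C.depth / G + 3 / G + 1 / (4 * E) +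
    2 * n * C.depth * (1 / G) with hδ
  have hδE : δ ≤ 1 / E := by
    -- Here 2·14² = 392 ≤ 1600/4, which accounts for the 1600 in N.
    have e1 : 2 * ((14 : ℝ) * n * C.depth) ^ 2 / N ≤ 1 / (4 * E) := by
      rw [div_le_div_iff₀ hNR (by positivity), hN]
      push_cast
      nlinarith [mul_nonneg hER.le (sq_nonneg ((n : ℝ) * C.depth))]
    -- Since nd ≥ 1, the numerator is at most 7nd, and `hGd` provides 14 E nd ≤ G.
    have e2 : (4 * (n * C.depth) + 3 : ℝ) / G ≤ 1 / (2 * E) := by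
      rw [div_le_div_iff₀ hGR (by positivity)]
      have : (14 * E * (n * C.depth) : ℝ) ≤ G := by exact_mod_cast hGd
      nlinarith
    have e3 : δ = 2 * ((14 : ℝ) * n * C.depth) ^ 2 / N + (4 * (n * C.depth) + 3 : ℝ) / G +
        1 / (4 * E) := by rw [hδ]; ring
    have e4 : (1 : ℝ) / E = 1 / (4 * E) + 1 / (2 * E) + 1 / (4 * E) := by field_simp; norm_num
    rw [e3, e4]
    linarith
  refine le_trans ?_ hδE
  have hδ0 : 0 ≤ δ := by rw [hδ]; positivity
  simp only [expect_sampler_eq hG hG2 hVG hP, bornProb_eq C p hp0 hp1]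
  refine sum_abs_mixture_sub_le ((V : ℝ) / G) (Real.sqrt (1 - p) ^ C.depth) δ (by positivity) hV01
    hδ0 (fun S => (1 / 2) ^ n * ∑ b : Fin n → Bool, ∑ e : Fin C.depth → Fin n → Bool,
          (∏ t, bernWeight p (e t)) * Real.cos (phaseDiff Gate.angle S C.layers (extend e) b))
    (fun S => (1 / 2) ^ n * ∑ b : Fin n → Bool, ∑ e : Fin C.layers.length → Fin n → Bool,
          (∏ t, bernWeight ((P : ℝ) / G) (e t)) * keepBias C.layers.length N G V P
            (phaseDiff (Gate.angleInt G) S C.layers (extend e) b) S) ?_ ?_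
  · intro S hS
    have hflip : ∀ b, flipOn S b = b := by intro b; funext i; simp [flipOn, hS i]
    have hph : ∀ (Ls : List (List (Gate n))) (e : ℕ → Fin n → Bool) (b : Fin n → Bool),
        phaseDiff Gate.angle S Ls e b = 0 := by
      intro Ls
      induction Ls with
      | nil => intro e b; rfl
      | cons L Ls ih => intro e b; rw [phaseDiff, hflip, sub_self, ih, add_zero]
    simp only [hph, Real.cos_zero, mul_one, hWsum]
    simp
  · intro S hS
    obtain ⟨hμ1, hμ2⟩ := bernWeight_bounds hn hGn hV (pow_nonneg hs0 _)
      (pow_le_one₀ hs0 hs1) hs hS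
    rw [← pow_mul] at hμ1 ⊢
    set μ := bernWeight ((V : ℝ) / G) S with hμ
    set σ := Real.sqrt (1 - p) ^ (C.depth * wt S) with hσ
    have hσ0 : 0 ≤ σ := pow_nonneg hs0 _
    have hμ0 : 0 ≤ μ := hσ0.trans hμ1
    have hb : ∀ b : Fin n → Bool,
        |μ * (∑ e : Fin C.depth → Fin n → Bool, (∏ t, bernWeight ((P : ℝ) / G) (e t)) *
          keepBias C.depth N G V P (phaseDiff (Gate.angleInt G) S C.layers (extend e) b) S) -
        σ * (∑ e : Fin C.depth → Fin n → Bool, (∏ t, bernWeight p (e t)) *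
          Real.cos (phaseDiff Gate.angle S C.layers (extend e) b))| ≤ μ * δ := by
      intro b
      have hterm : ∀ e : Fin C.depth → Fin n → Bool,
          |μ * ((∏ t, bernWeight ((P : ℝ) / G) (e t)) *
            keepBias C.depth N G V P (phaseDiff (Gate.angleInt G) S C.layers (extend e) b) S) -
          σ * ((∏ t, bernWeight p (e t)) *
            Real.cos (phaseDiff Gate.angle S C.layers (extend e) b))| ≤
          (∏ t, bernWeight ((P : ℝ) / G) (e t)) * (μ *
            (2 * ((14 : ℝ) * n * C.depth) ^ 2 / N + 2 * n * C.depth / G + 3 / G + 1 / (4 * E))) +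
          μ * |∏ t, bernWeight p (e t) - ∏ t, bernWeight ((P : ℝ) / G) (e t)| := by
        intro e
        have hW : 0 ≤ ∏ t, bernWeight ((P : ℝ) / G) (e t) :=
          Finset.prod_nonneg fun t _ => bernWeight_nonneg hP00 hP01 _
        have h1 := abs_cosNum_sub_cos_le hNpos hG S C.layers hL (extend e) b (by
          rw [hN]; push_cast
          have : (1 : ℝ) ≤ E := by exact_mod_cast hE
          have h' : ((n : ℝ) * C.depth) ^ 2 ≤ E * ((n : ℝ) * C.depth) ^ 2 :=
            le_mul_of_one_le_left (by positivity) this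
          show (14 * (n : ℝ) * C.depth) ^ 2 ≤ _
          nlinarith)
        have h2 := abs_keepBias_sub_le hNpos hG hP hE hn hp0 hp1 hPp hμ1 hμ2 hbig
          (Real.abs_cos_le_one _) h1
        set c := Real.cos (phaseDiff Gate.angle S C.layers (extend e) b)
        set W := ∏ t, bernWeight ((P : ℝ) / G) (e t)
        set W' := ∏ t, bernWeight p (e t)
        set k := keepBias C.depth N G V P (phaseDiff (Gate.angleInt G) S C.layers (extend e) b) S
        -- The error W' - W of the path law carries the factor σ; the domination σ ≤ μ makes it
        -- relative to μ as well.
        calc |μ * (W * k) - σ * (W' * c)| = |W * (μ * k - σ * c) + σ * (-(W' - W)) * c| := by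
              congr 1; ring
          _ ≤ |W * (μ * k - σ * c)| + |σ * (-(W' - W)) * c| := abs_add_le _ _
          _ = W * |μ * k - σ * c| + σ * |W' - W| * |c| := by
              rw [abs_mul, abs_mul, abs_mul, abs_neg, abs_of_nonneg hW, abs_of_nonneg hσ0]
          _ ≤ W * (μ * (2 * ((14 : ℝ) * n * C.depth) ^ 2 / N + 2 * n * C.depth / G + 3 / G +
                1 / (4 * E))) + μ * |W' - W| * 1 := by
              gcongr
              · exact h2
              · exact Real.abs_cos_le_one _
          _ = _ := by ring
      rw [Finset.mul_sum, Finset.mul_sum, ← Finset.sum_sub_distrib]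
      refine (Finset.abs_sum_le_sum_abs _ _).trans
        ((Finset.sum_le_sum fun e _ => hterm e).trans ?_)
      rw [Finset.sum_add_distrib, ← Finset.sum_mul, hWsum, one_mul, ← Finset.mul_sum, ← mul_add]
      refine mul_le_mul_of_nonneg_left ?_ hμ0
      rw [hδ]
      refine add_le_add le_rfl ((sum_bernWeight_sub_le hp0 hp1 hP00 hP01 C.depth).trans ?_)
      rw [abs_sub_comm]
      gcongr
    rw [Finset.mul_sum, Finset.mul_sum, Finset.mul_sum, Finset.mul_sum, ← Finset.sum_sub_distrib]
    refine (Finset.abs_sum_le_sum_abs _ _).trans ?_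
    calc _ ≤ ∑ b : Fin n → Bool, (1 / 2 : ℝ) ^ n * (μ * δ) := by
          refine Finset.sum_le_sum fun b _ => ?_
          refine le_trans (le_of_eq ?_) (mul_le_mul_of_nonneg_left (hb b)
            (by positivity : (0 : ℝ) ≤ (1 / 2) ^ n))
          rw [← abs_of_nonneg (by positivity : (0 : ℝ) ≤ (1 / 2) ^ n), ← abs_mul,
            abs_of_nonneg (by positivity : (0 : ℝ) ≤ (1 / 2) ^ n)]
          congr 1
          rw [mul_sub]
          congr 1
          · rw [mul_left_comm]; rfl
          · rw [mul_left_comm]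
      _ = μ * δ := by
          rw [Finset.sum_const, Finset.card_univ, Fintype.card_pi]
          simp only [Fintype.card_bool, Finset.prod_const, Finset.card_univ, Fintype.card_fin,
            nsmul_eq_mul]
          push_cast
          rw [← mul_assoc, mul_comm ((2 : ℝ) ^ n), hhalf, one_mul]

/-! ### Closeness to the uniform distribution -/

/-- The empty set gives the uniform distribution, every other term is at most s^|S| as |F| ≤ 1, and
∑_S s^|S| = (1+s)^n. -/
theorem sum_abs_uniform_sub_le {l : ℕ} (C : Circuit n l) {p : ℝ} (hp0 : 0 ≤ p) (hp1 : p ≤ 1) :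
    ∑ x : Fin n → Bool, |(1 / 2) ^ n - bornProb C p x| ≤
      (1 + Real.sqrt (1 - p) ^ C.depth) ^ n - 1 := by
  set s := Real.sqrt (1 - p) ^ C.depth with hs
  have hs0 : 0 ≤ s := pow_nonneg (Real.sqrt_nonneg _) _
  have hhalf : (1 / 2 : ℝ) ^ n * 2 ^ n = 1 := by rw [← mul_pow]; norm_num
  set F : (Fin n → Bool) → ℝ := fun S => (1 / 2) ^ n * ∑ b : Fin n → Bool,
    ∑ e : Fin C.depth → Fin n → Bool, (∏ t, bernWeight p (e t)) *
      Real.cos (phaseDiff Gate.angle S C.layers (extend e) b) with hF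
  have hWsum : ∑ e : Fin C.depth → Fin n → Bool, ∏ t, bernWeight p (e t) = 1 := by
    rw [← Fintype.prod_sum (fun (_ : Fin C.depth) a => bernWeight p a), sum_bernWeight]; simp
  have hcount : ∑ _b : Fin n → Bool, (1 : ℝ) = 2 ^ n := by simp
  have hF1 : ∀ S, |F S| ≤ 1 := by
    intro S
    rw [hF]
    simp only
    rw [abs_mul, abs_of_nonneg (by positivity : (0 : ℝ) ≤ (1 / 2) ^ n)]
    refine le_trans ?_ hhalf.le
    refine mul_le_mul_of_nonneg_left ?_ (by positivity : (0 : ℝ) ≤ (1 / 2) ^ n)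
    rw [← hcount]
    refine (Finset.abs_sum_le_sum_abs _ _).trans (Finset.sum_le_sum fun b _ => ?_)
    rw [← hWsum]
    refine (Finset.abs_sum_le_sum_abs _ _).trans (Finset.sum_le_sum fun e _ => ?_)
    have hW : 0 ≤ ∏ t, bernWeight p (e t) :=
      Finset.prod_nonneg fun t _ => bernWeight_nonneg hp0 hp1 _
    rw [abs_mul, abs_of_nonneg hW]
    exact mul_le_of_le_one_right hW (Real.abs_cos_le_one _)
  have hF0 : F (fun _ => false) = 1 := by
    have hflip : ∀ b : Fin n → Bool, flipOn (fun _ => false) b = b := by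
      intro b; funext i; simp [flipOn]
    have hph : ∀ (Ls : List (List (Gate n))) (e : ℕ → Fin n → Bool) (b : Fin n → Bool),
        phaseDiff Gate.angle (fun _ => false) Ls e b = 0 := by
      intro Ls
      induction Ls with
      | nil => intro e b; rfl
      | cons L Ls ih => intro e b; rw [phaseDiff, hflip, sub_self, ih, add_zero]
    simp only [hF, hph, Real.cos_zero, mul_one, hWsum, hcount, hhalf]
  have hsum : ∑ S : Fin n → Bool, s ^ wt S = (1 + s) ^ n := by
    simp only [← prod_ite_eq_pow_wt]
    rw [← Fintype.prod_sum (fun (_ : Fin n) (b : Bool) => if b then s else 1)]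
    simp [add_comm]
  have hx : ∀ x : Fin n → Bool, |(1 / 2) ^ n - bornProb C p x| ≤ (1 / 2) ^ n * ((1 + s) ^ n - 1) := by
    intro x
    have e1 : bornProb C p x = (1 / 2) ^ n * ∑ S : Fin n → Bool, (sgn S x : ℝ) * s ^ wt S * F S :=
      bornProb_eq C p hp0 hp1 x
    have hw0 : wt (fun _ : Fin n => false) = 0 := by simp [wt]
    rw [e1, ← Finset.add_sum_erase _ _ (Finset.mem_univ fun _ => false), hF0, hw0,
      sgn_of_forall_eq_false (fun _ => rfl), ← hsum,
      ← Finset.add_sum_erase _ (fun S : Fin n → Bool => s ^ wt S) (Finset.mem_univ fun _ => false), hw0]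
    simp only [Int.cast_one, pow_zero, mul_one, add_sub_cancel_left]
    rw [mul_add, mul_one, sub_add_cancel_left, abs_neg, abs_mul,
      abs_of_nonneg (by positivity : (0 : ℝ) ≤ (1 / 2) ^ n)]
    refine mul_le_mul_of_nonneg_left ?_ (by positivity : (0 : ℝ) ≤ (1 / 2) ^ n)
    refine (Finset.abs_sum_le_sum_abs _ _).trans (Finset.sum_le_sum fun S _ => ?_)
    have hsg : |(sgn S x : ℝ)| = 1 := by rcases sgn_eq_one_or S x with h | h <;> simp [h]
    rw [abs_mul, abs_mul, hsg, one_mul, abs_of_nonneg (pow_nonneg hs0 _)]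
    exact mul_le_of_le_one_right (pow_nonneg hs0 _) (hF1 S)
  calc _ ≤ ∑ _x : Fin n → Bool, (1 / 2 : ℝ) ^ n * ((1 + s) ^ n - 1) :=
        Finset.sum_le_sum fun x _ => hx x
    _ = ((1 / 2 : ℝ) ^ n * ∑ _x : Fin n → Bool, (1 : ℝ)) * ((1 + s) ^ n - 1) := by
        rw [Finset.mul_sum, Finset.sum_mul]; simp only [mul_one]
    _ = _ := by rw [hcount, hhalf, one_mul]

theorem one_add_pow_sub_one_le {s a : ℝ} (hs : 0 ≤ s) (h : n * s ≤ a) (ha : a ≤ 1) :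
    (1 + s) ^ n - 1 ≤ 2 * a := by
  have h0 : 0 ≤ n * s := by positivity
  have h1 : (1 + s) ^ n ≤ Real.exp (n * s) := by
    rw [Real.exp_nat_mul, add_comm]
    exact pow_le_pow_left₀ (by linarith) (Real.add_one_le_exp s) n
  have h2 := Real.abs_exp_sub_one_le (x := n * s) (by rw [abs_of_nonneg h0]; linarith)
  rw [abs_of_nonneg h0] at h2
  linarith [(abs_le.mp h2).2]

/-- From √(1-p) ≤ 1 - p/2, (1-p/2)^d (1+p/2)^d ≤ 1 and Bernoulli's inequality. Decay like 1/d
suffices for very deep circuits, and the program can test it by integer arithmetic. -/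
theorem sqrt_one_sub_pow_le {p : ℝ} (hp0 : 0 < p) (hp1 : p ≤ 1) {d : ℕ} (hd : 0 < d) :
    Real.sqrt (1 - p) ^ d ≤ 2 / (p * d) := by
  have hd' : (0 : ℝ) < d := by exact_mod_cast hd
  have h1 : Real.sqrt (1 - p) ≤ 1 - p / 2 := by
    rw [Real.sqrt_le_left (by linarith)]; nlinarith [sq_nonneg p]
  have h2 : 1 + (d : ℝ) * (p / 2) ≤ (1 + p / 2) ^ d :=
    one_add_mul_le_pow (by linarith) d
  have h3 : (1 - p / 2) ^ d * (1 + p / 2) ^ d ≤ 1 := by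
    rw [← mul_pow]
    exact pow_le_one₀ (by nlinarith) (by nlinarith [sq_nonneg p])
  have h4 : (0 : ℝ) ≤ (1 - p / 2) ^ d := pow_nonneg (by linarith) d
  calc Real.sqrt (1 - p) ^ d ≤ (1 - p / 2) ^ d := pow_le_pow_left₀ (Real.sqrt_nonneg _) h1 d
    _ ≤ 2 / (p * d) := by
        rw [le_div_iff₀ (by positivity)]
        nlinarith [mul_le_mul_of_nonneg_left h2 h4]

/-- In logarithms the claim is (d/2) log(1/(1-p)) ≥ 4 log n, whence the constant 8. -/
theorem sqrt_one_sub_pow_mul_le {p : ℝ} (hp0 : 0 < p) (hp1 : p ≤ 1) {d : ℕ} (hd : 0 < d)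
    (hn : 0 < n) (h : 8 * Real.log n / Real.log (1 - p)⁻¹ ≤ d) :
    Real.sqrt (1 - p) ^ d * (n : ℝ) ^ 4 ≤ 1 := by
  have hnR : (0 : ℝ) < n := by exact_mod_cast hn
  rcases hp1.eq_or_lt with rfl | hp
  -- For p = 1 the base is 0 and d > 0. The hypothesis says only 0 ≤ d here, by the conventions for
  -- log 0 and division by 0.
  · simp [hd.ne']
  · have hq : 0 < 1 - p := by linarith
    have hlog : 0 < Real.log (1 - p)⁻¹ := by
      rw [Real.log_inv]
      linarith [Real.log_neg hq (by linarith)]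
    rw [div_le_iff₀ hlog, Real.log_inv] at h
    have hsq : (0 : ℝ) < Real.sqrt (1 - p) := Real.sqrt_pos.mpr hq
    rw [← Real.log_nonpos_iff (by positivity), Real.log_mul (by positivity) (by positivity),
      Real.log_pow, Real.log_pow, Real.log_sqrt hq.le]
    push_cast
    linarith

end IQP

namespace RAM

/-! ### Bit lengths and the cost of expressions -/

theorem bitLen_pos (z : ℤ) : 1 ≤ bitLen z := by simp [bitLen]

theorem bitLen_le_of_abs_lt {z : ℤ} {k : ℕ} (h : |z| < 2 ^ k) : bitLen z ≤ k + 1 := by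
  rw [bitLen, Nat.add_le_add_iff_right, Nat.size_le]
  zify
  exact h

theorem bitLen_le_of_abs_le {z : ℤ} {k : ℕ} (h : |z| ≤ 2 ^ k) : bitLen z ≤ k + 2 := by
  refine bitLen_le_of_abs_lt (lt_of_le_of_lt h ?_)
  rw [pow_succ]
  have : (0 : ℤ) < 2 ^ k := by positivity
  linarith

theorem abs_lt_two_pow_bitLen (z : ℤ) : |z| < 2 ^ (bitLen z - 1) := by
  have := Nat.lt_size_self z.natAbs
  zify at this
  simpa [bitLen] using this

theorem bitLen_add_le (x y : ℤ) : bitLen (x + y) ≤ bitLen x + bitLen y := by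
  have hx := abs_lt_two_pow_bitLen x
  have hy := abs_lt_two_pow_bitLen y
  have h1 := bitLen_pos x
  have h2 := bitLen_pos y
  obtain ⟨a, ha⟩ : ∃ a, bitLen x = a + 1 := ⟨bitLen x - 1, by omega⟩
  obtain ⟨b, hb⟩ : ∃ b, bitLen y = b + 1 := ⟨bitLen y - 1, by omega⟩
  rw [ha] at hx ⊢
  rw [hb] at hy ⊢
  rw [Nat.add_sub_cancel] at hx hy
  refine (bitLen_le_of_abs_lt (k := a + b + 1) ?_).trans (by omega)
  have e1 : (2 : ℤ) ^ a ≤ 2 ^ (a + b) := pow_le_pow_right₀ (by norm_num) (by omega)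
  have e2 : (2 : ℤ) ^ b ≤ 2 ^ (a + b) := pow_le_pow_right₀ (by norm_num) (by omega)
  have := abs_add_le x y
  rw [pow_succ]
  linarith

theorem bitLen_neg (x : ℤ) : bitLen (-x) = bitLen x := by simp [bitLen]

theorem bitLen_sub_le (x y : ℤ) : bitLen (x - y) ≤ bitLen x + bitLen y := by
  rw [sub_eq_add_neg, ← bitLen_neg y]; exact bitLen_add_le _ _

theorem bitLen_mul_le (x y : ℤ) : bitLen (x * y) ≤ bitLen x + bitLen y := by
  have hx := abs_lt_two_pow_bitLen x
  have hy := abs_lt_two_pow_bitLen y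
  have h1 := bitLen_pos x
  have h2 := bitLen_pos y
  refine (bitLen_le_of_abs_lt (k := (bitLen x - 1) + (bitLen y - 1)) ?_).trans (by omega)
  rw [abs_mul, pow_add]
  exact mul_lt_mul'' hx hy (abs_nonneg _) (abs_nonneg _)

theorem bitLen_div_le (x y : ℤ) : bitLen (x / y) ≤ bitLen x := by
  rw [bitLen, bitLen, Nat.add_le_add_iff_right]
  exact Nat.size_le_size (Int.natAbs_ediv_le_natAbs x y)

/-- The size of an expression. -/
def Expr.sz : Expr → ℕ
  | lit c => c.natAbs + 1
  | get _ i => i.sz + 1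
  | int i => i.sz + 1
  | real j b => j.sz + b.sz + 1
  | add e f => e.sz + f.sz + 1
  | sub e f => e.sz + f.sz + 1
  | mul e f => e.sz + f.sz + 1
  | div e f => e.sz + f.sz + 1

/-- The data read by an expression has length at most `Z`. -/
def Expr.Prec (D : Data) (M : Mem) (Z : ℕ) : Expr → Prop
  | lit _ => True
  | get _ i => i.Prec D M Z
  | int i => i.Prec D M Z ∧ |D.ints.getD (i.eval D M).toNat 0| ≤ 2 ^ Z
  | real j b => j.Prec D M Z ∧ b.Prec D M Z ∧ (b.eval D M).toNat ≤ Z ∧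
      0 ≤ D.reals.getD (j.eval D M).toNat 0 ∧ D.reals.getD (j.eval D M).toNat 0 < 8
  | add e f => e.Prec D M Z ∧ f.Prec D M Z
  | sub e f => e.Prec D M Z ∧ f.Prec D M Z
  | mul e f => e.Prec D M Z ∧ f.Prec D M Z
  | div e f => e.Prec D M Z ∧ f.Prec D M Z

/-- All memory cells have length at most `Z`. -/
def Small (Z : ℕ) (M : Mem) : Prop := ∀ a i, |M a i| ≤ 2 ^ Z

/-- The offset 5 covers the longest datum: a real number below 8 read to Z places is at most 2^(Z+3)
and has length at most Z+5. The square accounts for products, which are charged the product of the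
lengths. Literals count their absolute value in `Expr.sz`, so the bound depends on syntax and Z
only. -/
theorem Expr.bounds {D : Data} {M : Mem} {Z : ℕ} (hM : Small Z M) (e : Expr)
    (he : e.Prec D M Z) :
    bitLen (e.eval D M) ≤ e.sz * (Z + 5) ∧ e.cost D M ≤ (e.sz * (Z + 5)) ^ 2 := by
  induction e with
  | lit c =>
    have h : bitLen c ≤ (c.natAbs + 1) * (Z + 5) := by
      have : c.natAbs.size ≤ c.natAbs := Nat.size_le.mpr Nat.lt_two_pow_self
      have h' : c.natAbs + 1 ≤ (c.natAbs + 1) * (Z + 5) := Nat.le_mul_of_pos_right _ (by omega)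
      simp only [bitLen]; omega
    exact ⟨h, h.trans (Nat.le_self_pow (by norm_num) _)⟩
  | get a i ih =>
    obtain ⟨h1, h2⟩ := ih he
    have h3 : bitLen (M a (i.eval D M)) ≤ Z + 2 := bitLen_le_of_abs_le (hM _ _)
    simp only [eval, cost, sz] at *
    constructor <;> nlinarith
  | int i ih =>
    obtain ⟨h1, h2⟩ := ih he.1
    have h3 := bitLen_le_of_abs_le he.2
    simp only [eval, cost, sz] at *
    constructor <;> nlinarith
  | real j b ihj ihb =>
    obtain ⟨hj, hb, h4, h5, h6⟩ := he
    obtain ⟨h1, h2⟩ := ihj hj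
    obtain ⟨h1', h2'⟩ := ihb hb
    have h3 : bitLen ⌊(2 : ℝ) ^ (b.eval D M).toNat * D.reals.getD (j.eval D M).toNat 0⌋ ≤ Z + 5 := by
      refine bitLen_le_of_abs_le (k := Z + 3) ?_
      have hp : (0 : ℝ) < 2 ^ (b.eval D M).toNat := by positivity
      rw [abs_of_nonneg (Int.floor_nonneg.mpr (mul_nonneg hp.le h5))]
      have hle : (2 : ℝ) ^ (b.eval D M).toNat ≤ 2 ^ Z := pow_le_pow_right₀ (by norm_num) h4
      have : ((⌊(2 : ℝ) ^ (b.eval D M).toNat * D.reals.getD (j.eval D M).toNat 0⌋ : ℤ) : ℝ) ≤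
          ((2 ^ (Z + 3) : ℤ) : ℝ) := by
        refine (Int.floor_le _).trans ?_
        push_cast
        rw [pow_add]
        nlinarith
      exact_mod_cast this
    simp only [eval, cost, sz] at *
    constructor <;> nlinarith
  | add e f ihe ihf =>
    obtain ⟨h1, h2⟩ := ihe he.1
    obtain ⟨h1', h2'⟩ := ihf he.2
    have h3 := bitLen_add_le (e.eval D M) (f.eval D M)
    simp only [eval, cost, sz] at *
    constructor <;> nlinarith
  | sub e f ihe ihf =>
    obtain ⟨h1, h2⟩ := ihe he.1
    obtain ⟨h1', h2'⟩ := ihf he.2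
    have h3 := bitLen_sub_le (e.eval D M) (f.eval D M)
    simp only [eval, cost, sz] at *
    constructor <;> nlinarith
  | mul e f ihe ihf =>
    obtain ⟨h1, h2⟩ := ihe he.1
    obtain ⟨h1', h2'⟩ := ihf he.2
    have h3 := bitLen_mul_le (e.eval D M) (f.eval D M)
    have h4 := Nat.mul_le_mul h1 h1'
    simp only [eval, cost, sz] at *
    constructor <;> nlinarith
  | div e f ihe ihf =>
    obtain ⟨h1, h2⟩ := ihe he.1
    obtain ⟨h1', h2'⟩ := ihf he.2
    have h3 := bitLen_div_le (e.eval D M) (f.eval D M)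
    have h4 := Nat.mul_le_mul h1 h1'
    simp only [eval, cost, sz] at *
    constructor <;> nlinarith

/-! ### A program logic with time bounds -/

/-- A bound for the time of a program in which all numbers have length less than `W` and all loops
are executed at most `W` times. -/
def Prog.time (W : ℕ) : Prog → ℕ
  | skip => 1
  | set _ i e => ((i.sz + e.sz + 1) * W) ^ 2
  | flip _ i => ((i.sz + 1) * W) ^ 2
  | emit e => ((e.sz + 1) * W) ^ 2
  | seq P Q => P.time W + Q.time W
  | branch e P Q => ((e.sz + 1) * W) ^ 2 + P.time W + Q.time W
  | loop e P => (W + 1) * (((e.sz + 1) * W) ^ 2 + P.time W)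

/-- For a fixed program the nesting depth of loops is fixed, so its time is polynomial in W. The
exponent is irrelevant in the end, because W will be bounded in terms of E alone. -/
theorem Prog.exists_time_le (P : Prog) : ∃ c k : ℕ, ∀ W, 1 ≤ W → P.time W ≤ c * W ^ k := by
  induction P with
  | skip => exact ⟨1, 0, fun W _ => by simp [time]⟩
  | set a i e => exact ⟨(i.sz + e.sz + 1) ^ 2, 2, fun W _ => by simp [time, mul_pow]⟩
  | flip a i => exact ⟨(i.sz + 1) ^ 2, 2, fun W _ => by simp [time, mul_pow]⟩
  | emit e => exact ⟨(e.sz + 1) ^ 2, 2, fun W _ => by simp [time, mul_pow]⟩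
  | seq P Q ihP ihQ =>
    obtain ⟨c, k, h⟩ := ihP
    obtain ⟨c', k', h'⟩ := ihQ
    refine ⟨c + c', k + k', fun W hW => ?_⟩
    have e1 : W ^ k ≤ W ^ (k + k') := Nat.pow_le_pow_right hW (by omega)
    have e2 : W ^ k' ≤ W ^ (k + k') := Nat.pow_le_pow_right hW (by omega)
    simp only [time]
    rw [add_mul]
    exact add_le_add ((h W hW).trans (Nat.mul_le_mul_left _ e1))
      ((h' W hW).trans (Nat.mul_le_mul_left _ e2))
  | branch e P Q ihP ihQ =>
    obtain ⟨c, k, h⟩ := ihP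
    obtain ⟨c', k', h'⟩ := ihQ
    refine ⟨(e.sz + 1) ^ 2 + c + c', 2 + k + k', fun W hW => ?_⟩
    have e1 : W ^ k ≤ W ^ (2 + k + k') := Nat.pow_le_pow_right hW (by omega)
    have e2 : W ^ k' ≤ W ^ (2 + k + k') := Nat.pow_le_pow_right hW (by omega)
    have e3 : W ^ 2 ≤ W ^ (2 + k + k') := Nat.pow_le_pow_right hW (by omega)
    simp only [time]
    rw [mul_pow, add_mul, add_mul]
    exact add_le_add (add_le_add (Nat.mul_le_mul_left _ e3)
      ((h W hW).trans (Nat.mul_le_mul_left _ e1))) ((h' W hW).trans (Nat.mul_le_mul_left _ e2))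
  | loop e P ih =>
    obtain ⟨c, k, h⟩ := ih
    refine ⟨2 * ((e.sz + 1) ^ 2 + c), 1 + (2 + k), fun W hW => ?_⟩
    have e1 : W ^ k ≤ W ^ (2 + k) := Nat.pow_le_pow_right hW (by omega)
    have e3 : W ^ 2 ≤ W ^ (2 + k) := Nat.pow_le_pow_right hW (by omega)
    simp only [time]
    have e4 : ((e.sz + 1) * W) ^ 2 + P.time W ≤ ((e.sz + 1) ^ 2 + c) * W ^ (2 + k) := by
      rw [mul_pow, add_mul]
      exact add_le_add (Nat.mul_le_mul_left _ e3) ((h W hW).trans (Nat.mul_le_mul_left _ e1))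
    calc _ ≤ (2 * W) * (((e.sz + 1) ^ 2 + c) * W ^ (2 + k)) := Nat.mul_le_mul (by omega) e4
      _ = _ := by rw [pow_add W 1]; ring

/-- `P` halts within its time bound in a state that satisfies `Φ`. -/
def WP (D : Data) (Z : ℕ) (P : Prog) (Φ : State → Prop) (s : State) : Prop :=
  ∃ t ≤ P.time (Z + 5), ∃ s', Exec D P s t s' ∧ Φ s'

variable {D : Data} {Z : ℕ} {Φ Ψ : State → Prop} {s : State}

theorem WP.mono {P : Prog} (h : WP D Z P Φ s) (hΦ : ∀ s, Φ s → Ψ s) : WP D Z P Ψ s := by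
  obtain ⟨t, ht, s', h1, h2⟩ := h
  exact ⟨t, ht, s', h1, hΦ _ h2⟩

theorem WP.skip (h : Φ s) : WP D Z .skip Φ s := ⟨1, le_rfl, s, .skip s, h⟩

theorem WP.seq {P Q : Prog} (h : WP D Z P (WP D Z Q Φ) s) : WP D Z (.seq P Q) Φ s := by
  obtain ⟨t, ht, s', h1, t', ht', s'', h2, h3⟩ := h
  exact ⟨t + t', add_le_add ht ht', s'', .seq _ _ _ _ _ _ _ h1 h2, h3⟩

theorem Small.write {M : Mem} (hM : Small Z M) {a : ℕ} {i v : ℤ} (hv : |v| ≤ 2 ^ Z) :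
    Small Z (write M a i v) := by
  intro b j
  by_cases hb : b = a
  · subst hb
    by_cases hj : j = i
    · subst hj; simpa [RAM.write] using hv
    · simpa [RAM.write, hj] using hM b j
  · simpa [RAM.write, hb] using hM b j

theorem WP.set {M : Mem} {r o : List Bool} {a : ℕ} {i e : Expr} (hM : Small Z M)
    (hi : i.Prec D M Z) (he : e.Prec D M Z) (hv : |e.eval D M| ≤ 2 ^ Z)
    (h : Small Z (write M a (i.eval D M) (e.eval D M)) →
      Φ ⟨write M a (i.eval D M) (e.eval D M), r, o⟩) :
    WP D Z (.set a i e) Φ ⟨M, r, o⟩ := by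
  refine ⟨_, ?_, _, .set a i e ⟨M, r, o⟩, h (hM.write hv)⟩
  obtain ⟨h1, h2⟩ := i.bounds hM hi
  obtain ⟨h3, h4⟩ := e.bounds hM he
  simp only [Prog.time]
  nlinarith

theorem WP.store {M : Mem} {r o : List Bool} {a : ℕ} {i e : Expr} {j v : ℤ} (hM : Small Z M)
    (hi : i.Prec D M Z) (he : e.Prec D M Z) (hj : i.eval D M = j) (hv : e.eval D M = v)
    (hb : |v| ≤ 2 ^ Z) (h : Small Z (write M a j v) → Φ ⟨write M a j v, r, o⟩) :
    WP D Z (.set a i e) Φ ⟨M, r, o⟩ := by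
  subst hj hv
  exact WP.set hM hi he hb h

theorem WP.flip {M : Mem} {r o : List Bool} {b : Bool} {a : ℕ} {i : Expr} (hM : Small Z M)
    (hi : i.Prec D M Z)
    (h : Small Z (write M a (i.eval D M) (if b then 1 else 0)) →
      Φ ⟨write M a (i.eval D M) (if b then 1 else 0), r, o⟩) :
    WP D Z (.flip a i) Φ ⟨M, b :: r, o⟩ := by
  refine ⟨_, ?_, _, .flip a i M b r o, h (hM.write ?_)⟩
  · obtain ⟨h1, h2⟩ := i.bounds hM hi
    simp only [Prog.time]
    nlinarith
  · have : (1 : ℤ) ≤ 2 ^ Z := one_le_pow₀ (by norm_num)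
    cases b <;> simp [this]

theorem WP.emit {M : Mem} {r o : List Bool} {e : Expr} (hM : Small Z M) (he : e.Prec D M Z)
    (h : Φ ⟨M, r, o ++ [decide (0 < e.eval D M)]⟩) : WP D Z (.emit e) Φ ⟨M, r, o⟩ := by
  refine ⟨_, ?_, _, .emit e ⟨M, r, o⟩, h⟩
  obtain ⟨h1, h2⟩ := e.bounds hM he
  simp only [Prog.time]
  nlinarith

theorem WP.branch {e : Expr} {P Q : Prog} (hM : Small Z s.mem) (he : e.Prec D s.mem Z)
    (hP : 0 < e.eval D s.mem → WP D Z P Φ s) (hQ : ¬ 0 < e.eval D s.mem → WP D Z Q Φ s) :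
    WP D Z (.branch e P Q) Φ s := by
  obtain ⟨h1, h2⟩ := e.bounds hM he
  by_cases h : 0 < e.eval D s.mem
  · obtain ⟨t, ht, s', h3, h4⟩ := hP h
    refine ⟨_, ?_, s', .branch_pos e P Q s s' t h h3, h4⟩
    simp only [Prog.time]
    nlinarith
  · obtain ⟨t, ht, s', h3, h4⟩ := hQ h
    refine ⟨_, ?_, s', .branch_neg e P Q s s' t h h3, h4⟩
    simp only [Prog.time]
    nlinarith

/-- Store the truth value of a test. -/
abbrev setBit (a : ℕ) (i e : Expr) : Prog := .branch e (.set a i (.lit 1)) (.set a i (.lit 0))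

/-- A truth value as an integer. -/
def bitVal (b : Bool) : ℤ := if b then 1 else 0

theorem abs_bitVal_le (b : Bool) : |bitVal b| ≤ 2 ^ Z := by
  have : (1 : ℤ) ≤ 2 ^ Z := one_le_pow₀ (by norm_num)
  cases b <;> simp [bitVal, this]

theorem WP.setBit {M : Mem} {r o : List Bool} {a : ℕ} {i e : Expr} {j : ℤ} {b : Bool}
    (hM : Small Z M) (hi : i.Prec D M Z) (he : e.Prec D M Z) (hj : i.eval D M = j)
    (hb : 0 < e.eval D M ↔ b = true)
    (h : Small Z (write M a j (bitVal b)) → Φ ⟨write M a j (bitVal b), r, o⟩) :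
    WP D Z (setBit a i e) Φ ⟨M, r, o⟩ := by
  refine WP.branch hM he (fun h' => ?_) fun h' => ?_
  · exact WP.store hM hi trivial hj (by simp [bitVal, hb.mp h', Expr.eval]) (abs_bitVal_le b) h
  · exact WP.store hM hi trivial hj (by simp [bitVal, hb.not.mp h', Expr.eval])
      (abs_bitVal_le b) h

/-- The invariant determines the number N of rounds exactly, since the test succeeds if and only if
k < N. The induction is on the number of rounds left, and N ≤ Z yields the factor allowed by
`Prog.time`. -/
theorem WP.loop {e : Expr} {P : Prog} (Inv : ℕ → State → Prop) (N : ℕ) (hN : N ≤ Z)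
    (hinv : ∀ k ≤ N, ∀ s, Inv k s → Small Z s.mem ∧ e.Prec D s.mem Z ∧
      (0 < e.eval D s.mem ↔ k < N))
    (hstep : ∀ k < N, ∀ s, Inv k s → WP D Z P (Inv (k + 1)) s)
    (h0 : Inv 0 s) (hpost : ∀ s, Inv N s → Φ s) : WP D Z (.loop e P) Φ s := by
  have key : ∀ j ≤ N, ∀ s, Inv (N - j) s → ∃ t ≤ (j + 1) * (((e.sz + 1) * (Z + 5)) ^ 2 +
      P.time (Z + 5)), ∃ s', Exec D (.loop e P) s t s' ∧ Inv N s' := by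
    intro j
    induction j with
    | zero =>
      intro _ s hs
      obtain ⟨h1, h2, h3⟩ := hinv _ (by omega) s hs
      obtain ⟨h4, h5⟩ := e.bounds h1 h2
      refine ⟨_, ?_, s, Exec.loop_stop e P s (by rw [h3]; omega), by simpa using hs⟩
      nlinarith
    | succ j ih =>
      intro hj s hs
      obtain ⟨h1, h2, h3⟩ := hinv _ (by omega) s hs
      obtain ⟨h4, h5⟩ := e.bounds h1 h2
      obtain ⟨t, ht, s', h6, h7⟩ := hstep (N - (j + 1)) (by omega) s hs
      rw [show N - (j + 1) + 1 = N - j by omega] at h7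
      obtain ⟨t', ht', s'', h8, h9⟩ := ih (by omega) s' h7
      refine ⟨_, ?_, s'', .loop_step e P s s' s'' t t' (h3.mpr (by omega)) h6 h8, h9⟩
      nlinarith
  obtain ⟨t, ht, s', h1, h2⟩ := key N le_rfl s (by simpa using h0)
  refine ⟨t, ht.trans ?_, s', h1, hpost _ h2⟩
  simp only [Prog.time]
  exact Nat.mul_le_mul_right _ (by omega)

/-- A variant for loops that consume input: the invariant is indexed by the suffix still to be read.
-/
theorem WP.loop_list {α : Type*} {e : Expr} {P : Prog} (Inv : List α → State → Prop) (L : List α)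
    (hN : L.length ≤ Z)
    (hinv : ∀ l, l <:+ L → ∀ s, Inv l s → Small Z s.mem ∧ e.Prec D s.mem Z ∧
      (0 < e.eval D s.mem ↔ 0 < l.length))
    (hstep : ∀ a l, a :: l <:+ L → ∀ s, Inv (a :: l) s → WP D Z P (Inv l) s)
    (h0 : Inv L s) (hpost : ∀ s, Inv [] s → Φ s) : WP D Z (.loop e P) Φ s := by
  refine WP.loop (fun k s => Inv (L.drop k) s) L.length hN ?_ ?_ (by simpa using h0)
    (by simpa using hpost)
  · intro k hk s hs
    obtain ⟨h1, h2, h3⟩ := hinv _ (List.drop_suffix k L) s hs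
    exact ⟨h1, h2, by rw [h3, List.length_drop]; omega⟩
  · intro k hk s hs
    rw [List.drop_eq_getElem_cons hk] at hs
    exact hstep _ _ (by rw [← List.drop_eq_getElem_cons hk]; exact List.drop_suffix k L) s hs

theorem write_apply (M : Mem) (a : ℕ) (i v : ℤ) (b : ℕ) (j : ℤ) :
    write M a i v b j = if b = a ∧ j = i then v else M b j := by
  by_cases hb : b = a
  · subst hb
    by_cases hj : j = i <;> simp [write, hj]
  · simp [write, hb]

theorem write_of_ne (M : Mem) {a : ℕ} (i v : ℤ) {b : ℕ} (h : b ≠ a) : write M a i v b = M b := by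
  simp [write, h]

theorem abs_zero_le_two_pow : |(0 : ℤ)| ≤ 2 ^ Z := by simp

theorem abs_one_le_two_pow : |(1 : ℤ)| ≤ 2 ^ Z := by
  rw [abs_one]; exact one_le_pow₀ (by norm_num)

theorem abs_natCast_le_two_pow {k : ℕ} (h : k ≤ Z) : |(k : ℤ)| ≤ 2 ^ Z := by
  rw [Nat.abs_cast]
  exact_mod_cast Nat.lt_two_pow_self.le.trans (Nat.pow_le_pow_right (by norm_num) h)

end RAM

namespace IQP

open RAM

/-! ### The program -/

/-- The content of a scalar variable. -/
abbrev var (a : ℕ) : Expr := .get a (.lit 0)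

/-- Assignment to a scalar variable. -/
abbrev assign (a : ℕ) (e : Expr) : Prog := .set a (.lit 0) e

/-- The number of qubits. -/
def nE : Expr := .int (.lit 0)

/-- The depth. -/
def dE : Expr := .int (.lit 1)

/-- The inverse precision. -/
def εE : Expr := .int (.lit 2)

/-- The inputs of the sampler: number of qubits, depth and inverse precision. -/
structure Header (D : Data) (Z n d E : ℕ) : Prop where
  ints_zero : D.ints.getD 0 0 = (n : ℤ)
  ints_one : D.ints.getD 1 0 = (d : ℤ)
  ints_two : D.ints.getD 2 0 = (E : ℤ)
  n_le : n ≤ Z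
  d_le : d ≤ Z
  E_le : E ≤ Z
  ints_le : ∀ k, |D.ints.getD k 0| ≤ 2 ^ Z
  length_le : D.ints.length ≤ Z
  reals_nonneg : ∀ k, 0 ≤ D.reals.getD k 0
  reals_lt : ∀ k, D.reals.getD k 0 < 8
  reals_length_le : D.reals.length ≤ Z

section Header

variable {D : Data} {Z n d E : ℕ} (h : Header D Z n d E) (M : Mem)

include h

theorem Header.eval_n : nE.eval D M = n := h.ints_zero

theorem Header.eval_d : dE.eval D M = d := h.ints_one

theorem Header.eval_E : εE.eval D M = E := h.ints_two

theorem Header.prec_n : nE.Prec D M Z :=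
  ⟨trivial, (congrArg abs h.ints_zero).trans_le (abs_natCast_le_two_pow h.n_le)⟩

theorem Header.prec_d : dE.Prec D M Z :=
  ⟨trivial, (congrArg abs h.ints_one).trans_le (abs_natCast_le_two_pow h.d_le)⟩

theorem Header.prec_E : εE.Prec D M Z :=
  ⟨trivial, (congrArg abs h.ints_two).trans_le (abs_natCast_le_two_pow h.E_le)⟩

end Header

/-! ### Drawing integers and deriving the random choices -/

/-- Read one draw of `B` bits into the array of draws. -/
def drawBits : Prog :=
  .loop (.sub (var 7) (var 5)) <|
    .seq (.flip 27 (.lit 0)) <|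
    .seq (.set 0 (var 4) (.add (.get 0 (var 4)) (.mul (var 6) (var 27)))) <|
    .seq (assign 6 (.add (var 6) (var 6))) <|
    assign 5 (.add (var 5) (.lit 1))

/-- Read all draws. -/
def drawAll : Prog :=
  .loop (.sub (.add (.mul nE (.add dE (.lit 3))) (.lit 2)) (var 4)) <|
    .seq (assign 5 (.lit 0)) <|
    .seq (assign 6 (.lit 1)) <|
    .seq drawBits <|
    assign 4 (.add (var 4) (.lit 1))

/-- The coins of a list as a sequence, continued by `false`. -/
abbrev bitsOf (r : List Bool) : ℕ → Bool := fun k => r.getD k false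

theorem ofBits_succ (r : ℕ → Bool) (a B : ℕ) :
    ofBits r a (B + 1) = ofBits r a B + if r (a + B) then 2 ^ B else 0 :=
  Finset.sum_range_succ _ _

/-- The last clause of such specifications is a frame condition naming the arrays that may change.
Arrays 0 to 3 hold the draws, S, the decaying bits and the output string. Registers 4 and 5 are
counters, 6 to 10 hold G, B, N, P, V, and 11 to 14 the two sides of the amplitude test, the parity
sign and the last index. Register 15 is the phase; 16 to 18 are reading positions in the integers,
reals and draws; 24 to 26 serve the cosine; 27 is scratch; 29 and 30 hold G^d and (G-P)^d. Here
register 6 runs through the powers of two and ends as G. -/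
theorem drawBits_spec {D : Data} {Z B k : ℕ} {M : Mem} {r o : List Bool} (hB : B ≤ Z)
    (hM : Small Z M) (h7 : M 7 0 = B) (h4 : M 4 0 = k) (h5 : M 5 0 = 0) (h6 : M 6 0 = 1)
    (h0 : M 0 k = 0) (hr : B * k + B ≤ r.length) :
    WP D Z drawBits (fun s => s.out = o ∧ s.coins = r.drop (B * k + B) ∧ Small Z s.mem ∧
      s.mem 6 0 = 2 ^ B ∧ s.mem 0 k = ofBits (bitsOf r) (B * k) B ∧
      (∀ i, i ≠ (k : ℤ) → s.mem 0 i = M 0 i) ∧ ∀ a, a ∉ [0, 5, 6, 27] → s.mem a = M a)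
      ⟨M, r.drop (B * k), o⟩ := by
  refine WP.loop (fun j s => s.out = o ∧ s.coins = r.drop (B * k + j) ∧ Small Z s.mem ∧
      s.mem 5 0 = j ∧ s.mem 6 0 = 2 ^ j ∧ s.mem 0 k = ofBits (bitsOf r) (B * k) j ∧
      (∀ i, i ≠ (k : ℤ) → s.mem 0 i = M 0 i) ∧ ∀ a, a ∉ [0, 5, 6, 27] → s.mem a = M a)
    B hB ?_ ?_ ?_ ?_
  · rintro j hj ⟨M', r', o'⟩ ⟨rfl, rfl, hS, e5, e6, e0, e0', efr⟩
    refine ⟨hS, by simp [Expr.Prec], ?_⟩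
    simp only at *
    simp only [Expr.eval, efr 7 (by decide), h7, e5]
    omega
  · rintro j hj ⟨M', r', o'⟩ ⟨rfl, rfl, hS, e5, e6, e0, e0', efr⟩
    simp only at *
    have hlen : B * k + j < r.length := by omega
    rw [List.drop_eq_getElem_cons hlen]
    have e4 : M' 4 0 = k := by rw [efr 4 (by decide), h4]
    have hbit : bitsOf r (B * k + j) = r[B * k + j] := by simp [bitsOf, hlen]
    have hlt : ofBits (bitsOf r) (B * k) (j + 1) < 2 ^ (j + 1) := ofBits_lt _ _ _
    have hle : (2 : ℤ) ^ (j + 1) ≤ 2 ^ Z := pow_le_pow_right₀ (by norm_num) (by omega)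
    have hval : (ofBits (bitsOf r) (B * k) j : ℤ) + 2 ^ j * (if r[B * k + j] then 1 else 0) =
        (ofBits (bitsOf r) (B * k) (j + 1) : ℕ) := by
      rw [ofBits_succ, hbit]
      push_cast
      split_ifs <;> simp
    refine WP.seq <| WP.flip hS trivial fun hS1 => ?_
    refine WP.seq <| WP.store (j := k) (v := (ofBits (bitsOf r) (B * k) (j + 1) : ℕ)) hS1
      (by simp [Expr.Prec]) (by simp [Expr.Prec]) (by simp [Expr.eval, write_apply, e4]) ?_ ?_
      fun hS2 => ?_
    · simp only [← hval, Expr.eval, write_apply, e4, e6]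
      simpa using e0
    · rw [abs_of_nonneg (by positivity)]
      exact le_trans (by exact_mod_cast hlt.le) hle
    refine WP.seq <| WP.store (j := 0) (v := 2 ^ (j + 1)) hS2 (by simp [Expr.Prec])
      (by simp [Expr.Prec]) rfl ?_ ?_ fun hS3 => ?_
    · simp [Expr.eval, write_apply, e6]; ring
    · rwa [abs_of_nonneg (by positivity)]
    refine WP.store (j := 0) (v := (j + 1 : ℕ)) hS3 (by simp [Expr.Prec]) (by simp [Expr.Prec])
      rfl ?_ (abs_natCast_le_two_pow (by omega)) fun hS4 => ?_
    · simp [Expr.eval, write_apply, e5]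
    refine ⟨rfl, rfl, hS4, ?_, ?_, ?_, ?_, ?_⟩ <;> dsimp only
    · simp [write_apply]
    · simp [write_apply]
    · simp [write_apply]
    · intro i hi
      simp [write_apply, hi, e0' i hi]
    · intro a ha
      simp only [List.mem_cons, List.not_mem_nil, not_or, or_false] at ha
      rw [write_of_ne _ _ _ ha.2.1, write_of_ne _ _ _ ha.2.2.1, write_of_ne _ _ _ ha.1,
        write_of_ne _ _ _ ha.2.2.2, efr a (by simp [ha])]
  · exact ⟨rfl, rfl, hM, by simp [h5], by simp [h6], by simp [h0, ofBits], fun _ _ => rfl,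
      fun _ _ => rfl⟩
  · rintro ⟨M', r', o'⟩ ⟨h1, h2, h3, h4, h5, h6, h7, h8⟩
    exact ⟨h1, h2, h3, h5, h6, h7, h8⟩

theorem drawAll_spec {D : Data} {Z n d E B m : ℕ} (hD : Header D Z n d E) {M : Mem}
    {r o : List Bool} (hm : m = n * (d + 3) + 2) (hmZ : m ≤ Z) (hB : B ≤ Z)
    (hM : Small Z M) (h7 : M 7 0 = B) (h4 : M 4 0 = 0)
    (h0 : ∀ i, M 0 i = 0) (hr : B * m ≤ r.length) :
    WP D Z drawAll (fun s => s.out = o ∧ s.coins = r.drop (B * m) ∧ Small Z s.mem ∧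
      s.mem 6 0 = 2 ^ B ∧ (∀ k < m, s.mem 0 k = ofBits (bitsOf r) (B * k) B) ∧
      ∀ a, a ∉ [0, 4, 5, 6, 27] → s.mem a = M a) ⟨M, r, o⟩ := by
  -- Register 6 holds 2^B only after a first draw, hence the guard 0 < k. It disappears at the end
  -- because m ≥ 2.
  refine WP.loop (fun k s => s.out = o ∧ s.coins = r.drop (B * k) ∧ Small Z s.mem ∧
      s.mem 4 0 = k ∧ (0 < k → s.mem 6 0 = 2 ^ B) ∧
      (∀ i < k, s.mem 0 i = ofBits (bitsOf r) (B * i) B) ∧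
      (∀ i : ℕ, k ≤ i → s.mem 0 i = 0) ∧ ∀ a, a ∉ [0, 4, 5, 6, 27] → s.mem a = M a)
    m hmZ ?_ ?_ ?_ ?_
  · rintro k hk ⟨M', r', o'⟩ ⟨rfl, rfl, hS, e4, e6, e0, e0', efr⟩
    refine ⟨hS, by simp [Expr.Prec, hD.prec_n, hD.prec_d], ?_⟩
    simp only at *
    simp only [Expr.eval, hD.eval_n, hD.eval_d, e4]
    rw [hm] at hk ⊢
    zify
    constructor <;> intro h <;> linarith
  · rintro k hk ⟨M', r', o'⟩ ⟨rfl, rfl, hS, e4, e6, e0, e0', efr⟩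
    simp only at *
    refine WP.seq <| WP.store (j := 0) (v := 0) hS trivial trivial rfl rfl abs_zero_le_two_pow
      fun hS1 => ?_
    refine WP.seq <| WP.store (j := 0) (v := 1) hS1 trivial trivial rfl rfl abs_one_le_two_pow
      fun hS2 => ?_
    refine WP.seq <| (drawBits_spec (k := k) hB hS2 ?_ ?_ ?_ ?_ ?_ ?_).mono ?_
    · simp [write_apply, efr 7 (by decide), h7]
    · simp [write_apply, e4]
    · simp [write_apply]
    · simp [write_apply]
    · simp [write_apply, e0' k le_rfl]
    · calc B * k + B = B * (k + 1) := by ring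
        _ ≤ B * m := Nat.mul_le_mul_left _ hk
        _ ≤ _ := hr
    rintro ⟨M'', r', o''⟩ ⟨g1, g2, g3, g6, g0, g0', gfr⟩
    simp only at *
    have g4 : M'' 4 0 = k := by
      rw [gfr 4 (by decide)]; simp [write_apply, e4]
    refine WP.store (j := 0) (v := (k + 1 : ℕ)) g3 trivial (by simp [Expr.Prec]) rfl
      (by simp [Expr.eval, g4]) (abs_natCast_le_two_pow (by omega)) fun hS3 => ?_
    refine ⟨g1, by rw [g2, mul_add, mul_one], hS3, ?_, ?_, ?_, ?_, ?_⟩ <;> dsimp only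
    · simp [write_apply]
    · intro _; simp [write_apply, g6]
    · intro i hi
      rw [write_of_ne _ _ _ (by decide)]
      rcases Nat.lt_succ_iff_lt_or_eq.mp hi with h | rfl
      · rw [g0' i (by exact_mod_cast h.ne), write_of_ne _ _ _ (by decide),
          write_of_ne _ _ _ (by decide), e0 i h]
      · rw [g0]
    · intro i hi
      rw [write_of_ne _ _ _ (by decide), g0' i (by exact_mod_cast (show i ≠ k by omega)),
        write_of_ne _ _ _ (by decide), write_of_ne _ _ _ (by decide), e0' i (by omega)]
    · intro a ha
      simp only [List.mem_cons, List.not_mem_nil, not_or, or_false] at ha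
      rw [write_of_ne _ _ _ ha.2.1, gfr a (by simp [ha]), write_of_ne _ _ _ ha.2.2.2.1,
        write_of_ne _ _ _ ha.2.2.1, efr a (by simp [ha])]
  · exact ⟨rfl, by simp, hM, by simp [h4], by simp, by simp, fun i _ => h0 i, fun _ _ => rfl⟩
  · rintro ⟨M', r', o'⟩ ⟨h1, h2, h3, h4, h5, h6, h7, h8⟩
    exact ⟨h1, h2, h3, h5 (by omega), h6, h8⟩

/-- Compute `G ^ d` and `(G - P) ^ d`. -/
def powers : Prog :=
  .loop (.sub dE (var 4)) <|
    .seq (assign 29 (.mul (var 29) (var 6))) <|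
    .seq (assign 30 (.mul (var 30) (.sub (var 6) (var 9)))) <|
    assign 4 (.add (var 4) (.lit 1))

theorem powers_spec {D : Data} {Z n d E B P : ℕ} (hD : Header D Z n d E) {M : Mem}
    {r o : List Bool} (hM : Small Z M) (hZ : B * d ≤ Z) (hP : P ≤ 2 ^ B)
    (h6 : M 6 0 = 2 ^ B) (h9 : M 9 0 = P) (h4 : M 4 0 = 0) (h29 : M 29 0 = 1) (h30 : M 30 0 = 1) :
    WP D Z powers (fun s => s.out = o ∧ s.coins = r ∧ Small Z s.mem ∧
      s.mem 29 0 = (2 ^ B) ^ d ∧ s.mem 30 0 = (2 ^ B - P) ^ d ∧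
      ∀ a, a ∉ [4, 29, 30] → s.mem a = M a) ⟨M, r, o⟩ := by
  refine WP.loop (fun k s => s.out = o ∧ s.coins = r ∧ Small Z s.mem ∧ s.mem 4 0 = k ∧
      s.mem 29 0 = (2 ^ B) ^ k ∧ s.mem 30 0 = (2 ^ B - P) ^ k ∧
      ∀ a, a ∉ [4, 29, 30] → s.mem a = M a) d hD.d_le ?_ ?_ ?_ ?_
  · rintro k hk ⟨M', r', o'⟩ ⟨rfl, rfl, hS, e4, e29, e30, efr⟩
    refine ⟨hS, by simp [Expr.Prec, hD.prec_d], ?_⟩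
    simp only at *
    simp only [Expr.eval, hD.eval_d, e4]
    omega
  · rintro k hk ⟨M', r', o'⟩ ⟨rfl, rfl, hS, e4, e29, e30, efr⟩
    simp only at *
    have e6 := efr 6 (by decide)
    have e9 := efr 9 (by decide)
    have hP' : (P : ℤ) ≤ 2 ^ B := by exact_mod_cast hP
    have hb : ((2 : ℤ) ^ B) ^ (k + 1) ≤ 2 ^ Z := by
      rw [← pow_mul]
      exact pow_le_pow_right₀ (by norm_num) ((Nat.mul_le_mul_left _ hk).trans hZ)
    refine WP.seq <| WP.store (j := 0) (v := (2 ^ B) ^ (k + 1)) hS trivial (by simp [Expr.Prec]) rfl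
      (by simp [Expr.eval, e29, e6, h6, pow_succ]) (by rwa [abs_of_nonneg (by positivity)])
      fun hS1 => ?_
    refine WP.seq <| WP.store (j := 0) (v := (2 ^ B - P) ^ (k + 1)) hS1 trivial
      (by simp [Expr.Prec]) rfl
      (by simp [Expr.eval, write_apply, e30, e6, h6, e9, h9, pow_succ]) ?_ fun hS2 => ?_
    · rw [abs_of_nonneg (pow_nonneg (by linarith) _)]
      exact (pow_le_pow_left₀ (by linarith) (by linarith [Int.natCast_nonneg P]) _).trans hb
    refine WP.store (j := 0) (v := (k + 1 : ℕ)) hS2 trivial (by simp [Expr.Prec]) rfl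
      (by simp [Expr.eval, write_apply, e4]) (abs_natCast_le_two_pow (hD.d_le.trans' hk))
      fun hS3 => ?_
    refine ⟨rfl, rfl, hS3, ?_, ?_, ?_, ?_⟩ <;> dsimp only
    · simp [write_apply]
    · simp [write_apply]
    · simp [write_apply]
    · intro a ha
      simp only [List.mem_cons, List.not_mem_nil, not_or, or_false] at ha
      simp [write_of_ne, ha, efr a (by simp [ha])]
  · exact ⟨rfl, rfl, hM, by simp [h4], by simp [h29], by simp [h30], fun _ _ => rfl⟩
  · rintro ⟨M', r', o'⟩ ⟨h1, h2, h3, h4, h5⟩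
    exact ⟨h1, h2, h3, h5⟩

/-- Turn the draws into the choices of the sampler. -/
def choices : Prog :=
  .loop (.sub nE (var 4)) <|
    .seq (setBit 1 (var 4) (.sub (var 10) (.get 0 (var 4)))) <|
    .seq (setBit 2 (var 4) (.sub (.div (var 6) (.lit 2)) (.get 0 (.add nE (var 4))))) <|
    .seq (setBit 3 (var 4) (.sub (.div (var 6) (.lit 2)) (.get 0 (.add nE (.add nE (var 4)))))) <|
    assign 4 (.add (var 4) (.lit 1))

theorem choices_spec {D : Data} {Z n d E G V : ℕ} (hD : Header D Z n d E) {M : Mem}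
    {r o : List Bool} {R : ℕ → ℕ} (hM : Small Z M)
    (hR : ∀ k < n + (n + n), M 0 k = R k) (h10 : M 10 0 = V) (h6 : M 6 0 = G) (h4 : M 4 0 = 0) :
    WP D Z choices (fun s => s.out = o ∧ s.coins = r ∧ Small Z s.mem ∧
      (∀ i < n, s.mem 1 i = bitVal (decide (R i < V))) ∧
      (∀ i < n, s.mem 2 i = bitVal (decide (R (n + i) < G / 2))) ∧
      (∀ i < n, s.mem 3 i = bitVal (decide (R (n + (n + i)) < G / 2))) ∧
      ∀ a, a ∉ [1, 2, 3, 4] → s.mem a = M a) ⟨M, r, o⟩ := by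
  refine WP.loop (fun k s => s.out = o ∧ s.coins = r ∧ Small Z s.mem ∧ s.mem 4 0 = k ∧
      (∀ i < k, s.mem 1 i = bitVal (decide (R i < V))) ∧
      (∀ i < k, s.mem 2 i = bitVal (decide (R (n + i) < G / 2))) ∧
      (∀ i < k, s.mem 3 i = bitVal (decide (R (n + (n + i)) < G / 2))) ∧
      ∀ a, a ∉ [1, 2, 3, 4] → s.mem a = M a) n hD.n_le ?_ ?_ ?_ ?_
  · rintro k hk ⟨M', r', o'⟩ ⟨rfl, rfl, hS, e4, e1, e2, e3, efr⟩
    refine ⟨hS, by simp [Expr.Prec, hD.prec_n], ?_⟩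
    simp only at *
    simp only [Expr.eval, hD.eval_n, e4]
    omega
  · rintro k hk ⟨M', r', o'⟩ ⟨rfl, rfl, hS, e4, e1, e2, e3, efr⟩
    simp only at *
    have e6 := efr 6 (by decide)
    have e10 := efr 10 (by decide)
    have e0 := efr 0 (by decide)
    have r1 := hR k (by omega)
    have r2 := hR (n + k) (by omega)
    have r3 := hR (n + (n + k)) (by omega)
    push_cast at r2 r3
    refine WP.seq <| WP.setBit (j := k) (b := decide (R k < V)) hS (by simp [Expr.Prec])
      (by simp [Expr.Prec]) (by simp [Expr.eval, e4]) ?_ fun hS1 => ?_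
    · simp [Expr.eval, e4, e10, h10, e0, r1]
    refine WP.seq <| WP.setBit (j := k) (b := decide (R (n + k) < G / 2)) hS1 (by simp [Expr.Prec])
      (by simp [Expr.Prec, hD.prec_n]) (by simp [Expr.eval, write_apply, e4]) ?_ fun hS2 => ?_
    · simp only [Expr.eval, write_apply, hD.eval_n, e4, e6, h6, e0]
      simp [r2]; omega
    refine WP.seq <| WP.setBit (j := k) (b := decide (R (n + (n + k)) < G / 2)) hS2
      (by simp [Expr.Prec]) (by simp [Expr.Prec, hD.prec_n])
      (by simp [Expr.eval, write_apply, e4]) ?_ fun hS3 => ?_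
    · simp only [Expr.eval, write_apply, hD.eval_n, e4, e6, h6, e0]
      simp [r3]; omega
    refine WP.store (j := 0) (v := (k + 1 : ℕ)) hS3 trivial (by simp [Expr.Prec]) rfl
      (by simp [Expr.eval, write_apply, e4]) (abs_natCast_le_two_pow (hD.n_le.trans' hk))
      fun hS4 => ?_
    refine ⟨rfl, rfl, hS4, ?_, ?_, ?_, ?_, ?_⟩ <;> dsimp only
    · simp [write_apply]
    · intro i hi
      rcases Nat.lt_succ_iff_lt_or_eq.mp hi with h | rfl
      · simp [write_apply, h.ne, e1 i h]
      · simp [write_apply]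
    · intro i hi
      rcases Nat.lt_succ_iff_lt_or_eq.mp hi with h | rfl
      · simp [write_apply, h.ne, e2 i h]
      · simp [write_apply]
    · intro i hi
      rcases Nat.lt_succ_iff_lt_or_eq.mp hi with h | rfl
      · simp [write_apply, h.ne, e3 i h]
      · simp [write_apply]
    · intro a ha
      simp only [List.mem_cons, List.not_mem_nil, not_or, or_false] at ha
      simp [write_of_ne, ha, efr a (by simp [ha])]
  · exact ⟨rfl, rfl, hM, by simp [h4], by simp, by simp, by simp, fun _ _ => rfl⟩
  · rintro ⟨M', r', o'⟩ ⟨h1, h2, h3, h4, h5⟩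
    exact ⟨h1, h2, h3, h5⟩

/-- The last index below `k` at which `S` holds, or `-1`. -/
def lastIdx (S : ℕ → Bool) : ℕ → ℤ
  | 0 => -1
  | k + 1 => if S k then k else lastIdx S k

theorem lastIdx_lt (S : ℕ → Bool) (k : ℕ) : -1 ≤ lastIdx S k ∧ lastIdx S k < k := by
  induction k with
  | zero => simp [lastIdx]
  | succ k ih => simp only [lastIdx]; split_ifs <;> push_cast <;> omega

/-- For empty S the index is the default -1. The program then writes to cell -1 of the output array,
which is never emitted, in agreement with `flipLast` being the identity. -/
theorem lastIdx_eq_iff (S : ℕ → Bool) (k i : ℕ) (hi : i < k) :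
    lastIdx S k = i ↔ S i = true ∧ ∀ j < k, i < j → S j = false := by
  induction k with
  | zero => omega
  | succ k ih =>
    simp only [lastIdx]
    rcases Nat.lt_succ_iff_lt_or_eq.mp hi with h | rfl
    · split_ifs with hk
      · constructor
        · intro h'; omega
        · rintro ⟨-, h'⟩
          rw [h' k (by omega) h] at hk
          cases hk
      · rw [ih h]
        refine and_congr_right fun _ => ⟨fun H j hj hij => ?_, fun H j hj hij => H j (by omega) hij⟩
        rcases Nat.lt_succ_iff_lt_or_eq.mp hj with h' | rfl
        · exact H j h' hij
        · simpa using hk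
    · split_ifs with hk
      · simp only [hk, true_and, true_iff]
        intro j hj hij; omega
      · constructor
        · intro h'; have := (lastIdx_lt S i).2; omega
        · rintro ⟨h', -⟩; exact absurd h' hk

/-- Compute the two sides of the amplitude test, the sign and the last index. -/
def products : Prog :=
  .loop (.sub nE (var 4)) <|
    .seq (assign 11 (.mul (var 11) (.add
      (.mul (.get 1 (var 4)) (.mul (.mul (var 10) (var 10)) (var 29)))
      (.mul (.sub (.lit 1) (.get 1 (var 4)))
        (.mul (.sub (var 6) (var 10)) (.sub (var 6) (var 10))))))) <|
    .seq (assign 12 (.mul (var 12) (.mul (.mul (var 6) (var 6))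
      (.add (.lit 1) (.mul (.get 1 (var 4)) (.sub (var 30) (.lit 1))))))) <|
    .seq (assign 13 (.mul (var 13) (.sub (.lit 1)
      (.mul (.lit 2) (.mul (.get 1 (var 4)) (.get 3 (var 4))))))) <|
    .seq (assign 14 (.add (var 14) (.mul (.get 1 (var 4)) (.sub (var 4) (var 14))))) <|
    assign 4 (.add (var 4) (.lit 1))

/-- Selection by the bit of S is arithmetical, as in S a + (1-S) b, so the loop body has no branch.
-/
theorem products_spec {D : Data} {Z n d E B V P u : ℕ} (hD : Header D Z n d E) {M : Mem}
    {r o : List Bool} {S X : ℕ → Bool} (hM : Small Z M) (hV : V ≤ 2 ^ B) (hP : P ≤ 2 ^ B)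
    (hu : u ≤ 2 ^ B) (hZ : B * (2 + n * (2 + d)) ≤ Z)
    (h1 : ∀ i < n, M 1 i = bitVal (S i)) (h3 : ∀ i < n, M 3 i = bitVal (X i)) (h10 : M 10 0 = V)
    (h6 : M 6 0 = 2 ^ B) (h4 : M 4 0 = 0) (h29 : M 29 0 = (2 ^ B) ^ d)
    (h30 : M 30 0 = (2 ^ B - P) ^ d) (h11 : M 11 0 = u ^ 2) (h12 : M 12 0 = (2 ^ B) ^ 2)
    (h13 : M 13 0 = 1) (h14 : M 14 0 = -1) :
    WP D Z products (fun s => s.out = o ∧ s.coins = r ∧ Small Z s.mem ∧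
      s.mem 11 0 = u ^ 2 * ∏ i ∈ Finset.range n, (if S i then (V : ℤ) ^ 2 * (2 ^ B) ^ d
        else ((2 : ℤ) ^ B - V) ^ 2) ∧
      s.mem 12 0 = (2 ^ B) ^ 2 * ∏ i ∈ Finset.range n, (if S i then
        ((2 : ℤ) ^ B) ^ 2 * (2 ^ B - P) ^ d else (2 ^ B) ^ 2) ∧
      s.mem 13 0 = ∏ i ∈ Finset.range n, (if S i && X i then -1 else 1) ∧
      s.mem 14 0 = lastIdx S n ∧
      ∀ a, a ∉ [4, 11, 12, 13, 14] → s.mem a = M a) ⟨M, r, o⟩ := by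
  have hV' : (V : ℤ) ≤ 2 ^ B := by exact_mod_cast hV
  have hP' : (P : ℤ) ≤ 2 ^ B := by exact_mod_cast hP
  have hu' : (u : ℤ) ≤ 2 ^ B := by exact_mod_cast hu
  have hV0 : (0 : ℤ) ≤ V := by positivity
  have hP0 : (0 : ℤ) ≤ P := by positivity
  have hG1 : (1 : ℤ) ≤ 2 ^ B := one_le_pow₀ (by norm_num)
  have hpd : (1 : ℤ) ≤ (2 ^ B) ^ d := one_le_pow₀ hG1
  have hPd : (2 ^ B - P : ℤ) ^ d ≤ (2 ^ B) ^ d := pow_le_pow_left₀ (by linarith) (by linarith) _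
  have hPd0 : 0 ≤ (2 ^ B - P : ℤ) ^ d := pow_nonneg (by linarith) _
  -- Each factor is at most G^(2+d) and the prefactor at most G², so partial products stay below
  -- 2^(B(2+n(2+d))). This is the origin of `hZ`.
  have bound : ∀ (f : ℕ → ℤ) (w : ℤ) (k : ℕ), k ≤ n → 0 ≤ w → w ≤ 2 ^ B → (∀ i, 0 ≤ f i) →
      (∀ i, f i ≤ (2 ^ B) ^ 2 * (2 ^ B) ^ d) →
      |w ^ 2 * ∏ i ∈ Finset.range k, f i| ≤ 2 ^ Z := by
    intro f w k hk hw0 hw hf0 hf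
    rw [abs_of_nonneg (mul_nonneg (by positivity) (Finset.prod_nonneg fun i _ => hf0 i))]
    have h1 : ∏ i ∈ Finset.range k, f i ≤ (((2 : ℤ) ^ B) ^ 2 * (2 ^ B) ^ d) ^ k := by
      refine (Finset.prod_le_prod (fun i _ => hf0 i) fun i _ => hf i).trans ?_
      simp
    calc w ^ 2 * ∏ i ∈ Finset.range k, f i
        ≤ (2 ^ B) ^ 2 * (((2 : ℤ) ^ B) ^ 2 * (2 ^ B) ^ d) ^ k :=
          mul_le_mul (pow_le_pow_left₀ hw0 hw 2) h1 (Finset.prod_nonneg fun i _ => hf0 i)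
            (by positivity)
      _ = 2 ^ (B * (2 + k * (2 + d))) := by ring
      _ ≤ 2 ^ Z := pow_le_pow_right₀ (by norm_num)
          (hZ.trans' (Nat.mul_le_mul_left _ (by gcongr)))
  have hbL := fun k hk => bound (fun i => if S i then (V : ℤ) ^ 2 * (2 ^ B) ^ d
      else ((2 : ℤ) ^ B - V) ^ 2) u k hk (by positivity) hu'
    (fun i => by split_ifs <;> positivity) (fun i => by
      split_ifs
      · exact mul_le_mul_of_nonneg_right (pow_le_pow_left₀ hV0 hV' 2) (by positivity)
      · refine le_trans (pow_le_pow_left₀ (by linarith) (by linarith) 2)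
          (le_mul_of_one_le_right (by positivity) hpd))
  have hbR := fun k hk => bound (fun i => if S i then
        ((2 : ℤ) ^ B) ^ 2 * (2 ^ B - P) ^ d else (2 ^ B) ^ 2) (2 ^ B) k hk (by positivity) le_rfl
    (fun i => by split_ifs <;> positivity) (fun i => by
      split_ifs
      · exact mul_le_mul_of_nonneg_left hPd (by positivity)
      · exact le_mul_of_one_le_right (by positivity) hpd)
  refine WP.loop (fun k s => s.out = o ∧ s.coins = r ∧ Small Z s.mem ∧ s.mem 4 0 = k ∧
      s.mem 11 0 = u ^ 2 * ∏ i ∈ Finset.range k, (if S i then (V : ℤ) ^ 2 * (2 ^ B) ^ d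
        else ((2 : ℤ) ^ B - V) ^ 2) ∧
      s.mem 12 0 = (2 ^ B) ^ 2 * ∏ i ∈ Finset.range k, (if S i then
        ((2 : ℤ) ^ B) ^ 2 * (2 ^ B - P) ^ d else (2 ^ B) ^ 2) ∧
      s.mem 13 0 = ∏ i ∈ Finset.range k, (if S i && X i then -1 else 1) ∧
      s.mem 14 0 = lastIdx S k ∧
      ∀ a, a ∉ [4, 11, 12, 13, 14] → s.mem a = M a) n hD.n_le ?_ ?_ ?_ ?_
  · rintro k hk ⟨M', r', o'⟩ ⟨rfl, rfl, hS, e4, e11, e12, e13, e14, efr⟩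
    refine ⟨hS, by simp [Expr.Prec, hD.prec_n], ?_⟩
    simp only at *
    simp only [Expr.eval, hD.eval_n, e4]
    omega
  · rintro k hk ⟨M', r', o'⟩ ⟨rfl, rfl, hS, e4, e11, e12, e13, e14, efr⟩
    simp only at *
    have e6 := efr 6 (by decide)
    have e10 := efr 10 (by decide)
    have e29 := efr 29 (by decide)
    have e30 := efr 30 (by decide)
    have e1 := efr 1 (by decide)
    have e3 := efr 3 (by decide)
    have f1 := h1 k hk
    have f3 := h3 k hk
    refine WP.seq <| WP.store (j := 0) hS trivial (by simp [Expr.Prec]) rfl ?_ (hbL (k + 1) hk)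
      fun hS1 => ?_
    · simp only [Expr.eval, e4, e11, e1, f1, e10, e6, e29, h10, h6, h29, Finset.prod_range_succ]
      cases S k <;> simp [bitVal] <;> ring
    refine WP.seq <| WP.store (j := 0) hS1 trivial (by simp [Expr.Prec]) rfl ?_ (hbR (k + 1) hk)
      fun hS2 => ?_
    · simp only [Expr.eval, write_of_ne _ _ _ (show 12 ≠ 11 by decide),
        write_of_ne _ _ _ (show 4 ≠ 11 by decide), write_of_ne _ _ _ (show 6 ≠ 11 by decide),
        write_of_ne _ _ _ (show 1 ≠ 11 by decide), write_of_ne _ _ _ (show 30 ≠ 11 by decide),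
        e4, e12, e1, f1, e6, e30, h6, h30, Finset.prod_range_succ]
      cases S k <;> simp [bitVal] <;> ring
    refine WP.seq <| WP.store (j := 0)
      (v := ∏ i ∈ Finset.range (k + 1), (if S i && X i then -1 else 1)) hS2 trivial
      (by simp [Expr.Prec]) rfl ?_ ?_ fun hS3 => ?_
    · simp only [Expr.eval, write_of_ne _ _ _ (show 13 ≠ 11 by decide),
        write_of_ne _ _ _ (show 4 ≠ 11 by decide), write_of_ne _ _ _ (show 3 ≠ 11 by decide),
        write_of_ne _ _ _ (show 1 ≠ 11 by decide), write_of_ne _ _ _ (show 13 ≠ 12 by decide),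
        write_of_ne _ _ _ (show 4 ≠ 12 by decide), write_of_ne _ _ _ (show 3 ≠ 12 by decide),
        write_of_ne _ _ _ (show 1 ≠ 12 by decide),
        e4, e13, e1, f1, e3, f3, Finset.prod_range_succ]
      cases S k <;> cases X k <;> simp [bitVal]
    · rw [Finset.abs_prod, Finset.prod_congr rfl (g := fun _ => 1), Finset.prod_const_one]
      · exact one_le_pow₀ (by norm_num)
      · intro i _; split_ifs <;> simp
    refine WP.seq <| WP.store (j := 0) (v := lastIdx S (k + 1)) hS3 trivial
      (by simp [Expr.Prec]) rfl ?_ ?_ fun hS4 => ?_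
    · simp only [Expr.eval, write_of_ne _ _ _ (show 14 ≠ 11 by decide),
        write_of_ne _ _ _ (show 4 ≠ 11 by decide), write_of_ne _ _ _ (show 14 ≠ 13 by decide),
        write_of_ne _ _ _ (show 1 ≠ 11 by decide), write_of_ne _ _ _ (show 14 ≠ 12 by decide),
        write_of_ne _ _ _ (show 4 ≠ 12 by decide), write_of_ne _ _ _ (show 4 ≠ 13 by decide),
        write_of_ne _ _ _ (show 1 ≠ 12 by decide), write_of_ne _ _ _ (show 1 ≠ 13 by decide),
        e4, e14, e1, f1, lastIdx]
      cases S k <;> simp [bitVal]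
    · obtain ⟨g1, g2⟩ := lastIdx_lt S (k + 1)
      have : |lastIdx S (k + 1)| ≤ (k + 1 : ℕ) := abs_le.mpr ⟨by push_cast; omega, g2.le⟩
      exact this.trans ((le_abs_self _).trans (abs_natCast_le_two_pow (hD.n_le.trans' hk)))
    refine WP.store (j := 0) (v := (k + 1 : ℕ)) hS4 trivial (by simp [Expr.Prec]) rfl
      (by simp [Expr.eval, write_apply, e4]) (abs_natCast_le_two_pow (hD.n_le.trans' hk))
      fun hS5 => ?_
    refine ⟨rfl, rfl, hS5, ?_, ?_, ?_, ?_, ?_, ?_⟩ <;> dsimp only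
    · simp [write_apply]
    · simp [write_apply]
    · simp [write_apply]
    · simp [write_apply]
    · simp [write_apply]
    · intro a ha
      simp only [List.mem_cons, List.not_mem_nil, not_or, or_false] at ha
      simp [write_of_ne, ha, efr a (by simp [ha])]
  · exact ⟨rfl, rfl, hM, by simp [h4], by simp [h11], by simp [h12], by simp [h13],
      by simp [h14, lastIdx], fun _ _ => rfl⟩
  · rintro ⟨M', r', o'⟩ ⟨h1, h2, h3, h4, h5⟩
    exact ⟨h1, h2, h3, h5⟩

/-! ### Reading the circuit -/

/-- `l` occurs in `L` at position `p`. -/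
def At {α : Type*} (L : List α) (p : ℕ) (l : List α) : Prop :=
  ∃ a b, L = a ++ l ++ b ∧ a.length = p

section At

variable {α : Type*} {L l l' : List α} {p : ℕ} {x : α}

theorem At.le (h : At L p l) : p + l.length ≤ L.length := by
  obtain ⟨a, b, rfl, rfl⟩ := h
  simp

theorem At.getD (h : At L p (x :: l)) (z : α) : L.getD p z = x := by
  obtain ⟨a, b, rfl, rfl⟩ := h
  simp [List.getD]

theorem At.tail (h : At L p (x :: l)) : At L (p + 1) l := by
  obtain ⟨a, b, rfl, rfl⟩ := h
  exact ⟨a ++ [x], b, by simp, by simp⟩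

theorem At.left (h : At L p (l ++ l')) : At L p l := by
  obtain ⟨a, b, rfl, rfl⟩ := h
  exact ⟨a, l' ++ b, by simp, rfl⟩

theorem At.right (h : At L p (l ++ l')) : At L (p + l.length) l' := by
  obtain ⟨a, b, rfl, rfl⟩ := h
  exact ⟨a ++ l, b, by simp, by simp⟩

end At

theorem Header.abs_pos_le {D : Data} {Z n d E : ℕ} (hD : Header D Z n d E) {p : ℕ} {l : List ℤ}
    (h : At D.ints p l) : |(p : ℤ)| ≤ 2 ^ Z :=
  abs_natCast_le_two_pow (by have := h.le; have := hD.length_le; omega)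

theorem Header.prec_int {D : Data} {Z n d E : ℕ} (hD : Header D Z n d E) {M : Mem} {e : Expr} :
    (Expr.int e).Prec D M Z ↔ e.Prec D M Z := by
  simp only [Expr.Prec, hD.ints_le, and_true]

/-- Read the qubits of a gate, and multiply their bits and their damped bits. -/
def readQubits : Prog :=
  .loop (var 20) <|
    .seq (assign 27 (.int (var 16))) <|
    .seq (assign 21 (.mul (var 21) (.get 2 (var 27)))) <|
    .seq (assign 22 (.mul (var 22) (.sub (.add (.get 2 (var 27)) (.get 1 (var 27)))
      (.mul (.lit 2) (.mul (.get 2 (var 27)) (.get 1 (var 27))))))) <|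
    .seq (assign 16 (.add (var 16) (.lit 1))) <|
    assign 20 (.sub (var 20) (.lit 1))

/-- The polynomial a + b - 2ab is the exclusive or of bits, so registers 21 and 22 build the
conjunctions for the two basis states of the pair. In the invariant, the bit so far and the
condition on the unread qubits together give the final value. -/
theorem readQubits_spec {D : Data} {Z n d E : ℕ} (hD : Header D Z n d E) {M : Mem}
    {r o : List Bool} (hM : Small Z M) {qs : List (Fin n)} {S Y : Fin n → Bool} {p : ℕ}
    (hqs : At D.ints p (qs.map fun i : Fin n => ((i : ℕ) : ℤ))) (hlen : qs.length ≤ Z)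
    (h1 : ∀ i, M 1 (i : Fin n) = bitVal (S i)) (h2 : ∀ i, M 2 (i : Fin n) = bitVal (Y i))
    (h16 : M 16 0 = p) (h20 : M 20 0 = qs.length) (h21 : M 21 0 = 1) (h22 : M 22 0 = 1) :
    WP D Z readQubits (fun s => s.out = o ∧ s.coins = r ∧ Small Z s.mem ∧
      s.mem 16 0 = (p + qs.length : ℕ) ∧
      s.mem 21 0 = bitVal (decide (∀ i ∈ qs, Y i = true)) ∧
      s.mem 22 0 = bitVal (decide (∀ i ∈ qs, flipOn S Y i = true)) ∧
      ∀ a, a ∉ [16, 20, 21, 22, 27] → s.mem a = M a) ⟨M, r, o⟩ := by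
  refine WP.loop_list (fun l s => s.out = o ∧ s.coins = r ∧ Small Z s.mem ∧
      (∃ p', s.mem 16 0 = (p' : ℕ) ∧ At D.ints p' (l.map fun i : Fin n => ((i : ℕ) : ℤ)) ∧
        p' + l.length = p + qs.length) ∧ s.mem 20 0 = l.length ∧
      (∃ b, s.mem 21 0 = bitVal b ∧ (b && decide (∀ i ∈ l, Y i = true)) =
        decide (∀ i ∈ qs, Y i = true)) ∧
      (∃ b, s.mem 22 0 = bitVal b ∧ (b && decide (∀ i ∈ l, flipOn S Y i = true)) =
        decide (∀ i ∈ qs, flipOn S Y i = true)) ∧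
      ∀ a, a ∉ [16, 20, 21, 22, 27] → s.mem a = M a) qs hlen ?_ ?_ ?_ ?_
  · rintro l hl ⟨M', r', o'⟩ ⟨rfl, rfl, hS, -, e20, -⟩
    refine ⟨hS, trivial, ?_⟩
    simp only at *
    simp only [Expr.eval, e20]
    omega
  · rintro i l hl ⟨M', r', o'⟩ ⟨rfl, rfl, hS, ⟨p', e16, hp', hsum⟩, e20, ⟨b, e21, hb⟩,
      ⟨c, e22, hc⟩, efr⟩
    simp only [List.map_cons] at *
    have e1 : M' 1 (i : ℕ) = bitVal (S i) := by rw [efr 1 (by decide), h1]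
    have e2 : M' 2 (i : ℕ) = bitVal (Y i) := by rw [efr 2 (by decide), h2]
    refine WP.seq <| WP.store (j := 0) (v := (i : ℕ)) hS trivial (hD.prec_int.mpr trivial) rfl ?_
      (abs_natCast_le_two_pow (i.2.le.trans hD.n_le)) fun hS1 => ?_
    · simp only [Expr.eval, e16, Int.toNat_natCast]; exact hp'.getD 0
    refine WP.seq <| WP.store (j := 0) (v := bitVal (b && Y i)) hS1 trivial (by simp [Expr.Prec])
      rfl ?_ (abs_bitVal_le _) fun hS2 => ?_
    · simp only [Expr.eval, write_apply, e21]
      cases b <;> cases h : Y i <;> simp [bitVal, e2, h]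
    refine WP.seq <| WP.store (j := 0) (v := bitVal (c && flipOn S Y i)) hS2 trivial
      (by simp [Expr.Prec]) rfl ?_ (abs_bitVal_le _) fun hS3 => ?_
    · simp only [Expr.eval, write_apply, e22]
      cases c <;> cases h : Y i <;> cases h' : S i <;> simp [bitVal, e2, e1, h, h', flipOn]
    refine WP.seq <| WP.store (j := 0) (v := (p' + 1 : ℕ)) hS3 trivial
      (by simp [Expr.Prec]) rfl (by simp [Expr.eval, write_apply, e16]) (hD.abs_pos_le hp'.tail)
      fun hS4 => ?_
    refine WP.store (j := 0) (v := l.length) hS4 trivial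
      (by simp [Expr.Prec]) rfl (by simp [Expr.eval, write_apply, e20])
      (abs_natCast_le_two_pow ?_) fun hS5 => ?_
    · have := hl.length_le; simp at this; omega
    refine ⟨rfl, rfl, hS5, ⟨p' + 1, ?_, hp'.tail, ?_⟩, ?_, ⟨b && Y i, ?_, ?_⟩,
      ⟨c && flipOn S Y i, ?_, ?_⟩, ?_⟩
    · simp [write_apply]
    · rw [← hsum, List.length_cons]; omega
    · simp [write_apply]
    · simp [write_apply]
    · rw [← hb]; simp [Bool.and_assoc]
    · simp [write_apply]
    · rw [← hc]; simp [Bool.and_assoc]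
    · intro a ha
      simp only [List.mem_cons, List.not_mem_nil, not_or, or_false] at ha
      simp [write_of_ne, ha, efr a (by simp [ha])]
  · exact ⟨rfl, rfl, hM, ⟨p, h16, hqs, rfl⟩, h20, ⟨true, by simp [h21, bitVal], by simp⟩,
      ⟨true, by simp [h22, bitVal], by simp⟩, fun _ _ => rfl⟩
  · rintro ⟨M', r', o'⟩ ⟨rfl, rfl, hS, ⟨p', e16, -, hsum⟩, -, ⟨b, e21, hb⟩, ⟨c, e22, hc⟩, efr⟩
    refine ⟨rfl, rfl, hS, ?_, ?_, ?_, efr⟩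
    · rw [e16, ← hsum]; simp
    · rw [e21, ← hb]; simp
    · rw [e22, ← hc]; simp

/-- Read a layer, and add its contribution to the phase difference. -/
def readGates : Prog :=
  .loop (var 19) <|
    .seq (assign 20 (.int (var 16))) <|
    .seq (assign 16 (.add (var 16) (.lit 1))) <|
    .seq (setBit 28 (.lit 0) (.sub (var 20) (.lit 1))) <|
    .seq (assign 21 (.lit 1)) <|
    .seq (assign 22 (.lit 1)) <|
    .seq readQubits <|
    .seq (assign 15 (.add (var 15) (.mul (.mul (.sub (.mul (.lit 3) (var 28)) (.lit 2))
      (.sub (var 21) (var 22))) (.real (var 17) (var 7))))) <|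
    .seq (assign 17 (.add (var 17) (.lit 1))) <|
    assign 19 (.sub (var 19) (.lit 1))

theorem Gate.code_eq {n : ℕ} (g : Gate n) : g.code =
    (g.support.card : ℤ) :: (g.support.sort (· ≤ ·)).map fun i : Fin n => ((i : ℕ) : ℤ) := by
  simp [Gate.code, ← List.map_eq_flatMap]

/-- The program distinguishes the two kinds of gates by the number of qubits. This is sound because
`Gate.InGateSet` excludes controlled phases on fewer than two qubits. -/
theorem Gate.coef_eq {n l : ℕ} {g : Gate n} (h : g.InGateSet l) :
    g.coef = 3 * bitVal (decide (1 < g.support.card)) - 2 := by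
  cases g with
  | zRot t i => simp [Gate.coef, Gate.support, bitVal]
  | cPhase θ s => simp [Gate.coef, Gate.support, bitVal, show 1 < s.card from h.1]

theorem Gate.active_eq {n : ℕ} (g : Gate n) (b : Fin n → Bool) :
    g.active b = bitVal (decide (∀ i ∈ g.support.sort (· ≤ ·), b i = true)) := by
  simp [Gate.active, bitVal]

theorem abs_gate_term_le {n B : ℕ} (g : Gate n) (b c : Fin n → Bool) :
    |g.coef * (g.active b - g.active c) * g.angleInt (2 ^ B)| ≤ 14 * 2 ^ B := by
  have h1 : |g.coef * (g.active b - g.active c)| ≤ 2 := by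
    cases g <;> simp only [Gate.coef, Gate.active] <;> split_ifs <;> simp
  have h2 := g.angleInt_nonneg (2 ^ B)
  have h3 := g.angleInt_le (2 ^ B)
  rw [abs_mul, abs_of_nonneg h2]
  push_cast at h3
  nlinarith [abs_nonneg (g.coef * (g.active b - g.active c))]

/-- The number T is a budget for the size of the phase: each gate spends at most 14·2^B of it, and
the invariant reserves the share of the gates still to come. Reading an angle to B places yields
exactly `Gate.angleInt (2 ^ B)`. -/
theorem readGates_spec {D : Data} {Z n d E ℓ B : ℕ} (hD : Header D Z n d E) {M : Mem}
    {r o : List Bool} (hM : Small Z M) {L : List (Gate n)} {S Y : Fin n → Bool} {p q : ℕ}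
    {T : ℕ} (hL : ∀ g ∈ L, g.InGateSet ℓ) (hB : B ≤ Z)
    (hp : At D.ints p (L.flatMap Gate.code))
    (hq : At D.reals q (L.map fun g => toIcoMod Real.two_pi_pos 0 g.angle)) (hlen : L.length ≤ Z)
    (hT : |M 15 0| + 14 * 2 ^ B * L.length ≤ T) (hTZ : T ≤ 2 ^ Z)
    (h1 : ∀ i, M 1 (i : Fin n) = bitVal (S i)) (h2 : ∀ i, M 2 (i : Fin n) = bitVal (Y i))
    (h7 : M 7 0 = B) (h16 : M 16 0 = p) (h17 : M 17 0 = q) (h19 : M 19 0 = L.length) :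
    WP D Z readGates (fun s => s.out = o ∧ s.coins = r ∧ Small Z s.mem ∧
      s.mem 16 0 = (p + (L.flatMap Gate.code).length : ℕ) ∧
      s.mem 17 0 = (q + L.length : ℕ) ∧
      |s.mem 15 0| ≤ T ∧
      s.mem 15 0 = M 15 0 + (layerPhase (Gate.angleInt (2 ^ B)) L Y -
        layerPhase (Gate.angleInt (2 ^ B)) L (flipOn S Y)) ∧
      ∀ a, a ∉ [15, 16, 17, 19, 20, 21, 22, 27, 28] → s.mem a = M a) ⟨M, r, o⟩ := by
  have hT0 : (0 : ℤ) ≤ 14 * 2 ^ B := by positivity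
  refine WP.loop_list (fun l s => s.out = o ∧ s.coins = r ∧ Small Z s.mem ∧
      (∃ p', s.mem 16 0 = (p' : ℕ) ∧ At D.ints p' (l.flatMap Gate.code) ∧
        p' + (l.flatMap Gate.code).length = p + (L.flatMap Gate.code).length) ∧
      (∃ q', s.mem 17 0 = (q' : ℕ) ∧
        At D.reals q' (l.map fun g => toIcoMod Real.two_pi_pos 0 g.angle) ∧
        q' + l.length = q + L.length) ∧ s.mem 19 0 = l.length ∧
      |s.mem 15 0| + 14 * 2 ^ B * l.length ≤ T ∧
      s.mem 15 0 + (layerPhase (Gate.angleInt (2 ^ B)) l Y -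
        layerPhase (Gate.angleInt (2 ^ B)) l (flipOn S Y)) =
      M 15 0 + (layerPhase (Gate.angleInt (2 ^ B)) L Y -
        layerPhase (Gate.angleInt (2 ^ B)) L (flipOn S Y)) ∧
      ∀ a, a ∉ [15, 16, 17, 19, 20, 21, 22, 27, 28] → s.mem a = M a) L hlen ?_ ?_ ?_ ?_
  · rintro l hl ⟨M', r', o'⟩ ⟨rfl, rfl, hS, -, -, e19, -⟩
    refine ⟨hS, trivial, ?_⟩
    simp only at *
    simp only [Expr.eval, e19]
    omega
  · rintro g l hl ⟨M', r', o'⟩ ⟨rfl, rfl, hS, ⟨p', e16, hp', hps⟩, ⟨q', e17, hq', hqs⟩, e19, hb,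
      hsum, efr⟩
    simp only [List.flatMap_cons, List.map_cons, Gate.code_eq g, List.cons_append] at *
    have hg : g.InGateSet ℓ := hL g (hl.subset (List.mem_cons_self))
    have hsort : (g.support.sort (· ≤ ·)).length = g.support.card := Finset.length_sort _
    have hcard : g.support.card ≤ n := by simpa using g.support.card_le_univ
    have hcZ : (g.support.sort (· ≤ ·)).length ≤ Z := by
      rw [hsort]; exact hcard.trans hD.n_le
    refine WP.seq <| WP.store (j := 0) (v := (g.support.card : ℕ)) hS trivial
      (hD.prec_int.mpr trivial) rfl ?_ (abs_natCast_le_two_pow (hcard.trans hD.n_le)) fun hS1 => ?_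
    · simp only [Expr.eval, e16, Int.toNat_natCast]; exact hp'.getD 0
    refine WP.seq <| WP.store (j := 0) (v := (p' + 1 : ℕ)) hS1 trivial
      (by simp [Expr.Prec]) rfl (by simp [Expr.eval, write_apply, e16]) (hD.abs_pos_le hp'.tail)
      fun hS2 => ?_
    refine WP.seq <| WP.setBit (j := 0) (b := decide (1 < g.support.card)) hS2 trivial
      (by simp [Expr.Prec]) rfl (by simp [Expr.eval, write_apply]) fun hS3 => ?_
    refine WP.seq <| WP.store (j := 0) (v := 1) hS3 trivial trivial rfl rfl abs_one_le_two_pow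
      fun hS4 => ?_
    refine WP.seq <| WP.store (j := 0) (v := 1) hS4 trivial trivial rfl rfl abs_one_le_two_pow
      fun hS5 => ?_
    refine WP.seq <| (readQubits_spec hD hS5 (S := S) (Y := Y) hp'.tail.left hcZ ?_ ?_ ?_ ?_ ?_
      ?_).mono ?_
    · intro i; simp [write_apply, efr 1 (by decide), h1]
    · intro i; simp [write_apply, efr 2 (by decide), h2]
    · simp [write_apply]
    · simp [write_apply]
    · simp [write_apply]
    · simp [write_apply]
    rintro ⟨N, r', o''⟩ ⟨rfl, rfl, gS, g16, g21, g22, gfr⟩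
    simp only at *
    have g15 : N 15 0 = M' 15 0 := by simp [gfr 15 (by decide), write_apply]
    have g28 : N 28 0 = bitVal (decide (1 < g.support.card)) := by
      simp [gfr 28 (by decide), write_apply]
    have g17 : N 17 0 = q' := by simp [gfr 17 (by decide), write_apply, e17]
    have g7 : N 7 0 = B := by simp [gfr 7 (by decide), write_apply, efr 7 (by decide), h7]
    have g19 : N 19 0 = (l.length + 1 : ℕ) := by simp [gfr 19 (by decide), write_apply, e19]
    have hreal := hq'.getD 0
    set t : ℤ := g.coef * (g.active Y - g.active (flipOn S Y)) * g.angleInt (2 ^ B) with ht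
    have htb : |t| ≤ 14 * 2 ^ B := abs_gate_term_le g _ _
    push_cast [List.length_cons] at hb
    have hab := abs_add_le (M' 15 0) t
    have hl0 : (0 : ℤ) ≤ 14 * 2 ^ B * l.length := by positivity
    refine WP.seq <| WP.store (j := 0) (v := M' 15 0 + t) gS trivial ?_ rfl ?_ (by linarith)
      fun hS6 => ?_
    · simp only [Expr.Prec, Expr.eval, g7, Int.toNat_natCast, hB, hD.reals_nonneg, hD.reals_lt,
        and_self]
    · simp only [Expr.eval, g7, g15, g28, g21, g22, g17, Int.toNat_natCast]
      rw [hreal, ht, Gate.coef_eq hg, Gate.active_eq, Gate.active_eq, Gate.angleInt]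
      push_cast [Gate.angleMod]
      rfl
    refine WP.seq <| WP.store (j := 0) (v := (q' + 1 : ℕ)) hS6 trivial
      (by simp [Expr.Prec]) rfl (by simp [Expr.eval, write_apply, g17])
      (abs_natCast_le_two_pow (by have := hq'.tail.le; have := hD.reals_length_le; omega))
      fun hS7 => ?_
    refine WP.store (j := 0) (v := l.length) hS7 trivial (by simp [Expr.Prec]) rfl
      (by simp [Expr.eval, write_apply, g19])
      (abs_natCast_le_two_pow (by have := hl.length_le; simp at this; omega)) fun hS8 => ?_
    refine ⟨rfl, rfl, hS8, ⟨_, ?_, hp'.tail.right, ?_⟩, ⟨q' + 1, ?_, hq'.tail, ?_⟩, ?_, ?_, ?_, ?_⟩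
    · simp [write_apply, g16]
    · rw [← hps]; simp; omega
    · simp [write_apply]
    · rw [← hqs]; simp; omega
    · simp [write_apply]
    · simp only [write_apply]; simp; linarith
    · rw [← hsum]
      simp [write_apply, layerPhase, ht]
      ring
    · intro a ha
      simp only [List.mem_cons, List.not_mem_nil, not_or, or_false] at ha
      simp [write_of_ne, ha, efr a (by simp [ha]), gfr a (by simp [ha])]
  · exact ⟨rfl, rfl, hM, ⟨p, h16, hp, rfl⟩, ⟨q, h17, hq, rfl⟩, h19, hT, rfl, fun _ _ => rfl⟩
  · rintro ⟨M', r', o'⟩ ⟨rfl, rfl, hS, ⟨p', e16, -, hps⟩, ⟨q', e17, -, hqs⟩, -, hb, hsum, efr⟩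
    refine ⟨rfl, rfl, hS, ?_, ?_, ?_, ?_, efr⟩
    · rw [e16, ← hps]; simp
    · rw [e17, ← hqs]; simp
    · simpa using hb
    · rw [← hsum]; simp [layerPhase]

/-- Apply the decay choices of a layer. -/
def decay : Prog :=
  .loop (.sub nE (var 5)) <|
    .seq (setBit 27 (.lit 0) (.sub (var 9) (.get 0 (var 18)))) <|
    .seq (.set 2 (var 5) (.mul (.get 2 (var 5)) (.add (.get 1 (var 5))
      (.mul (.sub (.lit 1) (.get 1 (var 5))) (.sub (.lit 1) (var 27)))))) <|
    .seq (assign 18 (.add (var 18) (.lit 1))) <|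
    assign 5 (.add (var 5) (.lit 1))

theorem decay_spec {D : Data} {Z n d E P c : ℕ} (hD : Header D Z n d E) {M : Mem}
    {r o : List Bool} {R : ℕ → ℕ} {S Y : Fin n → Bool} (hM : Small Z M) (hc : c + n ≤ Z)
    (hR : ∀ k < n, M 0 (c + k : ℕ) = R (c + k)) (h1 : ∀ i, M 1 (i : Fin n) = bitVal (S i))
    (h2 : ∀ i, M 2 (i : Fin n) = bitVal (Y i))
    (h5 : M 5 0 = 0) (h9 : M 9 0 = P) (h18 : M 18 0 = c) :
    WP D Z decay (fun s => s.out = o ∧ s.coins = r ∧ Small Z s.mem ∧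
      (∀ i, s.mem 2 (i : Fin n) = bitVal (damp S Y (fun j : Fin n => decide (R (c + j) < P)) i)) ∧
      s.mem 18 0 = (c + n : ℕ) ∧
      ∀ a, a ∉ [2, 5, 18, 27] → s.mem a = M a) ⟨M, r, o⟩ := by
  refine WP.loop (fun k s => s.out = o ∧ s.coins = r ∧ Small Z s.mem ∧ s.mem 5 0 = k ∧
      (∀ i : Fin n, s.mem 2 i = bitVal (if (i : ℕ) < k then
        damp S Y (fun j : Fin n => decide (R (c + j) < P)) i else Y i)) ∧
      s.mem 18 0 = (c + k : ℕ) ∧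
      ∀ a, a ∉ [2, 5, 18, 27] → s.mem a = M a) n hD.n_le ?_ ?_ ?_ ?_
  · rintro k hk ⟨M', r', o'⟩ ⟨rfl, rfl, hS, e5, e2, e18, efr⟩
    refine ⟨hS, by simp [Expr.Prec, hD.prec_n], ?_⟩
    simp only at *
    simp only [Expr.eval, hD.eval_n, e5]
    omega
  · rintro k hk ⟨M', r', o'⟩ ⟨rfl, rfl, hS, e5, e2, e18, efr⟩
    simp only at *
    have e0 : M' 0 (c + k : ℕ) = R (c + k) := by rw [efr 0 (by decide), hR k hk]
    have e1 : M' 1 k = bitVal (S ⟨k, hk⟩) := by rw [efr 1 (by decide)]; exact h1 ⟨k, hk⟩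
    have e2k : M' 2 k = bitVal (Y ⟨k, hk⟩) := by simpa using e2 ⟨k, hk⟩
    have e9 := efr 9 (by decide)
    refine WP.seq <| WP.setBit (j := 0) (b := decide (R (c + k) < P)) hS trivial
      (by simp [Expr.Prec]) rfl ?_ fun hS1 => ?_
    · simp only [Expr.eval, e9, h9, e18, e0]; simp
    refine WP.seq <| WP.store (j := k)
      (v := bitVal (damp S Y (fun j : Fin n => decide (R (c + j) < P)) ⟨k, hk⟩)) hS1
      (by simp [Expr.Prec]) (by simp [Expr.Prec]) (by simp [Expr.eval, write_apply, e5]) ?_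
      (abs_bitVal_le _) fun hS2 => ?_
    · simp only [Expr.eval, write_of_ne _ _ _ (show 2 ≠ 27 by decide),
        write_of_ne _ _ _ (show 5 ≠ 27 by decide), write_of_ne _ _ _ (show 1 ≠ 27 by decide),
        e5, e1, e2k]
      simp only [write_apply, damp]
      cases Y ⟨k, hk⟩ <;> cases S ⟨k, hk⟩ <;> cases decide (R (c + k) < P) <;> simp [bitVal]
    refine WP.seq <| WP.store (j := 0) (v := (c + k + 1 : ℕ)) hS2 trivial (by simp [Expr.Prec]) rfl
      (by simp [Expr.eval, write_apply, e18]) (abs_natCast_le_two_pow (by omega)) fun hS3 => ?_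
    refine WP.store (j := 0) (v := (k + 1 : ℕ)) hS3 trivial (by simp [Expr.Prec]) rfl
      (by simp [Expr.eval, write_apply, e5]) (abs_natCast_le_two_pow (hD.n_le.trans' hk))
      fun hS4 => ?_
    refine ⟨rfl, rfl, hS4, ?_, ?_, ?_, ?_⟩ <;> dsimp only
    · simp [write_apply]
    · intro i
      by_cases hi : (i : ℕ) = k
      · obtain rfl : i = ⟨k, hk⟩ := Fin.ext hi
        simp [write_apply]
      · have : (i : ℕ) < k + 1 ↔ (i : ℕ) < k := by omega
        simp [write_apply, hi, e2 i, this]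
    · simp [write_apply, add_assoc]
    · intro a ha
      simp only [List.mem_cons, List.not_mem_nil, not_or, or_false] at ha
      simp [write_of_ne, ha, efr a (by simp [ha])]
  · exact ⟨rfl, rfl, hM, by simp [h5], by simp [h2], by simp [h18], fun _ _ => rfl⟩
  · rintro ⟨M', r', o'⟩ ⟨h1, h2, h3, h4, h5, h6⟩
    exact ⟨h1, h2, h3, fun i => by simpa using h5 i, h6⟩

/-- Run through the layers. -/
def runLayers : Prog :=
  .loop (.sub dE (var 4)) <|
    .seq (assign 19 (.int (var 16))) <|
    .seq (assign 16 (.add (var 16) (.lit 1))) <|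
    .seq readGates <|
    .seq (assign 5 (.lit 0)) <|
    .seq decay <|
    assign 4 (.add (var 4) (.lit 1))

/-- The invariant says that the phase collected so far plus the phase difference of the remaining
layers, started at the current bits, is the total. The bits in array 2 are overwritten by their
decayed values after each layer. -/
theorem runLayers_spec {D : Data} {Z n E ℓ B P T : ℕ} {Ls : List (List (Gate n))}
    (hD : Header D Z n Ls.length E) {M : Mem} {r o : List Bool} {R : ℕ → ℕ} {S Y : Fin n → Bool}
    (hM : Small Z M)
    (hLs : ∀ L ∈ Ls, ∀ g ∈ L, g.InGateSet ℓ) (hlen : ∀ L ∈ Ls, L.length ≤ n) (hB : B ≤ Z)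
    (hp : At D.ints 3 (Ls.flatMap fun L => (L.length : ℤ) :: L.flatMap Gate.code))
    (hq : At D.reals 1 (Ls.flatten.map fun g => toIcoMod Real.two_pi_pos 0 g.angle))
    (hT : 14 * 2 ^ B * (n * Ls.length) ≤ T) (hTZ : (T : ℤ) ≤ 2 ^ Z)
    (hc : n + (n + (n + n * Ls.length)) ≤ Z)
    (hR : ∀ k < n + (n + (n + n * Ls.length)), M 0 k = R k)
    (h1 : ∀ i, M 1 (i : Fin n) = bitVal (S i)) (h2 : ∀ i, M 2 (i : Fin n) = bitVal (Y i))
    (h4 : M 4 0 = 0) (h7 : M 7 0 = B) (h9 : M 9 0 = P) (h15 : M 15 0 = 0) (h16 : M 16 0 = 3)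
    (h17 : M 17 0 = 1) (h18 : M 18 0 = (n + (n + n) : ℕ)) :
    WP D Z runLayers (fun s => s.out = o ∧ s.coins = r ∧ Small Z s.mem ∧ |s.mem 15 0| ≤ T ∧
      s.mem 15 0 = phaseDiff (Gate.angleInt (2 ^ B)) S Ls
        (fun t (i : Fin n) => decide (R (n + (n + (n + (i + n * t)))) < P)) Y ∧
      ∀ a, a ∉ [2, 4, 5, 15, 16, 17, 18, 19, 20, 21, 22, 27, 28] → s.mem a = M a) ⟨M, r, o⟩ := by
  set e : ℕ → Fin n → Bool := fun t i => decide (R (n + (n + (n + (i + n * t)))) < P) with he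
  refine WP.loop_list (fun l s => s.out = o ∧ s.coins = r ∧ Small Z s.mem ∧
      ∃ k Y' p q, k + l.length = Ls.length ∧ s.mem 4 0 = (k : ℕ) ∧
      (∀ i, s.mem 2 (i : Fin n) = bitVal (Y' i)) ∧
      s.mem 16 0 = (p : ℕ) ∧
      At D.ints p (l.flatMap fun L => (L.length : ℤ) :: L.flatMap Gate.code) ∧
      s.mem 17 0 = (q : ℕ) ∧
      At D.reals q (l.flatten.map fun g => toIcoMod Real.two_pi_pos 0 g.angle) ∧
      s.mem 18 0 = (n + (n + (n + n * k)) : ℕ) ∧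
      |s.mem 15 0| + 14 * 2 ^ B * (n * l.length) ≤ T ∧
      s.mem 15 0 + phaseDiff (Gate.angleInt (2 ^ B)) S l (fun t => e (t + k)) Y' =
        phaseDiff (Gate.angleInt (2 ^ B)) S Ls e Y ∧
      ∀ a, a ∉ [2, 4, 5, 15, 16, 17, 18, 19, 20, 21, 22, 27, 28] → s.mem a = M a) Ls hD.d_le
      ?_ ?_ ?_ ?_
  · rintro l hl ⟨M', r', o'⟩ ⟨rfl, rfl, hS, k, Y', p, q, hk, e4, -⟩
    refine ⟨hS, by simp [Expr.Prec, hD.prec_d], ?_⟩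
    simp only at *
    simp only [Expr.eval, hD.eval_d, e4]
    omega
  · rintro L l hl ⟨M', r', o'⟩ ⟨rfl, rfl, hS, k, Y', p, q, hk, e4, e2, e16, hp', e17, hq', e18,
      hb, hsum, efr⟩
    simp only [List.flatMap_cons, List.flatten_cons, List.map_append, List.cons_append,
      List.length_cons] at *
    have hmem : L ∈ Ls := hl.subset List.mem_cons_self
    have hLn := hlen L hmem
    have hnk : n * k + n ≤ n * Ls.length := by
      rw [← Nat.mul_succ]; exact Nat.mul_le_mul_left _ (by omega)
    refine WP.seq <| WP.store (j := 0) (v := (L.length : ℕ)) hS trivial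
      (hD.prec_int.mpr trivial) rfl ?_ (abs_natCast_le_two_pow (hLn.trans hD.n_le)) fun hS1 => ?_
    · simp only [Expr.eval, e16, Int.toNat_natCast]; exact hp'.getD 0
    refine WP.seq <| WP.store (j := 0) (v := (p + 1 : ℕ)) hS1 trivial
      (by simp [Expr.Prec]) rfl (by simp [Expr.eval, write_apply, e16]) (hD.abs_pos_le hp'.tail)
      fun hS2 => ?_
    have hb0 : (|M' 15 0| + 14 * 2 ^ B * L.length : ℤ) + 14 * 2 ^ B * (n * l.length) ≤ T := by
      refine le_trans ?_ hb
      push_cast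
      have h : (14 * 2 ^ B : ℤ) * L.length ≤ 14 * 2 ^ B * n := by gcongr
      linarith
    have hl0 : (0 : ℤ) ≤ 14 * 2 ^ B * (n * l.length) := by positivity
    -- The inner budget is the part that this layer may use up; the rest stays reserved for the
    -- later layers.
    have hb1 : ((|M' 15 0| + 14 * 2 ^ B * L.length).toNat : ℤ) =
        |M' 15 0| + 14 * 2 ^ B * L.length := Int.toNat_of_nonneg (by positivity)
    refine WP.seq <| (readGates_spec hD hS2 (S := S) (Y := Y')
      (T := (|M' 15 0| + 14 * 2 ^ B * L.length).toNat) (hLs L hmem) hB hp'.tail.left hq'.left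
      (hLn.trans hD.n_le) ?_ 
      (by exact_mod_cast hb1.trans_le (show _ ≤ (2 : ℤ) ^ Z by linarith)) ?_ ?_ ?_ ?_ ?_ ?_).mono ?_
    · simp [write_apply]
    · intro i; simp [write_apply, efr 1 (by decide), h1]
    · intro i; simp [write_apply, e2]
    · simp [write_apply, efr 7 (by decide), h7]
    · simp [write_apply]
    · simp [write_apply, e17]
    · simp [write_apply]
    rintro ⟨N, r', o''⟩ ⟨rfl, rfl, gS, g16, g17, gb, g15, gfr⟩
    simp only at *
    rw [hb1] at gb
    have fr : ∀ a, a ∉ [2, 4, 5, 15, 16, 17, 18, 19, 20, 21, 22, 27, 28] → N a = M a := by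
      intro a ha
      simp only [List.mem_cons, List.not_mem_nil, not_or, or_false] at ha
      rw [gfr a (by simp [ha]), write_of_ne _ _ _ (by simp [ha]), write_of_ne _ _ _ (by simp [ha]),
        efr a (by simp [ha])]
    refine WP.seq <| WP.store (j := 0) (v := 0) gS trivial trivial rfl rfl abs_zero_le_two_pow
      fun hS3 => ?_
    refine WP.seq <| (decay_spec hD (R := R) (S := S) (Y := Y') (P := P)
      (c := n + (n + (n + n * k))) hS3 (by omega) ?_ ?_ ?_ ?_ ?_ ?_).mono ?_
    · intro i hi
      rw [write_of_ne _ _ _ (by decide), fr 0 (by decide)]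
      exact hR _ (by omega)
    · intro i; simp [write_apply, fr 1 (by decide), h1]
    · intro i; simp [write_apply, gfr 2 (by decide), e2]
    · simp [write_apply]
    · simp [write_apply, fr 9 (by decide), h9]
    · simp [write_apply, gfr 18 (by decide), e18]
    rintro ⟨N', r', o'⟩ ⟨rfl, rfl, fS, f2, f18, ffr⟩
    simp only at *
    have f4 : N' 4 0 = k := by simp [ffr 4 (by decide), write_apply, gfr 4 (by decide), e4]
    have f15 : N' 15 0 = N 15 0 := by simp [ffr 15 (by decide), write_apply]
    refine WP.store (j := 0) (v := (k + 1 : ℕ)) fS trivial (by simp [Expr.Prec]) rfl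
      (by simp [Expr.eval, f4]) (abs_natCast_le_two_pow (by have := hD.d_le; omega)) fun hS4 => ?_
    have e1 : (fun j : Fin n => decide (R (n + (n + (n + n * k)) + j) < P)) = e k := by
      funext j; simp only [he]; congr 3; ring
    rw [e1] at f2
    refine ⟨rfl, rfl, hS4, k + 1, damp S Y' (e k), _, _, by omega, by simp [write_apply], ?_, ?_,
      hp'.tail.right, ?_, hq'.right, ?_, ?_, ?_, ?_⟩ <;> dsimp only
    · intro i; rw [write_of_ne _ _ _ (by decide), f2]
    · simp [write_apply, ffr 16 (by decide), g16]
    · simp [write_apply, ffr 17 (by decide), g17]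
    · simp [write_apply, f18]; ring
    · rw [write_of_ne _ _ _ (by decide), f15]; linarith
    · rw [write_of_ne _ _ _ (by decide), f15, ← hsum, g15]
      simp only [phaseDiff, zero_add]
      rw [write_of_ne _ _ _ (by decide), write_of_ne _ _ _ (by decide)]
      have e2 : (fun t => e (t + (k + 1))) = fun t => e (t + 1 + k) := by
        funext t; congr 1; ring
      rw [e2]
      ring
    · intro a ha
      have ha' := ha
      simp only [List.mem_cons, List.not_mem_nil, not_or, or_false] at ha
      rw [write_of_ne _ _ _ (by simp [ha]), ffr a (by simp [ha]), write_of_ne _ _ _ (by simp [ha]),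
        fr a ha']
  · refine ⟨rfl, rfl, hM, 0, Y, 3, 1, by simp, h4, h2, h16, hp, h17, hq, h18, ?_, ?_,
      fun _ _ => rfl⟩
    · simp only [h15, abs_zero, zero_add]; exact_mod_cast hT
    · simp [h15]
  · rintro ⟨M', r', o'⟩ ⟨rfl, rfl, hS, k, Y', p, q, hk, e4, e2, e16, hp', e17, hq', e18,
      hb, hsum, efr⟩
    refine ⟨rfl, rfl, hS, ?_, ?_, efr⟩
    · simpa using hb
    · rw [← hsum]; simp [phaseDiff]

/-! ### The cosine and the output -/

/-- Compute the `N`-th power of the Gaussian integer `N G + i D`, and `(N G) ^ N`. -/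
def gaussPow : Prog :=
  .loop (.sub (var 8) (var 4)) <|
    .seq (assign 27 (.sub (.mul (var 24) (.mul (var 8) (var 6))) (.mul (var 25) (var 15)))) <|
    .seq (assign 25 (.add (.mul (var 24) (var 15)) (.mul (var 25) (.mul (var 8) (var 6))))) <|
    .seq (assign 24 (var 27)) <|
    .seq (assign 26 (.mul (var 26) (.mul (var 8) (var 6)))) <|
    assign 4 (.add (var 4) (.lit 1))

/-- The norm |re| + |im| is submultiplicative on Gaussian integers. It bounds the lengths of all
intermediate powers. -/
theorem abs_re_add_abs_im_pow_le (x y : ℤ) (k : ℕ) :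
    |((⟨x, y⟩ : GaussianInt) ^ k).re| + |((⟨x, y⟩ : GaussianInt) ^ k).im| ≤ (|x| + |y|) ^ k := by
  induction k with
  | zero => simp
  | succ k ih =>
    set z := (⟨x, y⟩ : GaussianInt) ^ k
    rw [pow_succ, Zsqrtd.re_mul, Zsqrtd.im_mul]
    have h1 := abs_add_le (z.re * x) (-1 * z.im * y)
    have h2 := abs_add_le (z.re * y) (z.im * x)
    simp only [abs_mul, abs_neg, abs_one, one_mul] at h1 h2
    have h3 := mul_le_mul_of_nonneg_right ih (by positivity : 0 ≤ |x| + |y|)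
    rw [pow_succ]
    have e : z.re * x + -1 * z.im * y = z.re * x + -1 * (z.im * y) := by ring
    simp only [mul_assoc] at *
    nlinarith

theorem gaussPow_spec {D : Data} {Z N G q : ℕ} {A : ℤ} {M : Mem} {r o : List Bool}
    (hM : Small Z M) (hN : N ≤ Z) (hq : (N : ℤ) * G + |A| ≤ 2 ^ q) (hZ : q * N ≤ Z)
    (h4 : M 4 0 = 0) (h6 : M 6 0 = G) (h8 : M 8 0 = N) (h15 : M 15 0 = A) (h24 : M 24 0 = 1)
    (h25 : M 25 0 = 0) (h26 : M 26 0 = 1) :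
    WP D Z gaussPow (fun s => s.out = o ∧ s.coins = r ∧ Small Z s.mem ∧
      s.mem 24 0 = cosNum N G A ∧ s.mem 26 0 = ((N : ℤ) * G) ^ N ∧
      ∀ a, a ∉ [4, 24, 25, 26, 27] → s.mem a = M a) ⟨M, r, o⟩ := by
  have hNG : (0 : ℤ) ≤ N * G := by positivity
  have hpow : ∀ k ≤ N, ((N : ℤ) * G + |A|) ^ k ≤ 2 ^ Z := fun k hk => by
    refine (pow_le_pow_left₀ (by positivity) hq k).trans ?_
    rw [← pow_mul]
    exact pow_le_pow_right₀ (by norm_num) ((Nat.mul_le_mul_left _ hk).trans hZ)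
  have hre : ∀ k ≤ N, |((⟨N * G, A⟩ : GaussianInt) ^ k).re| ≤ 2 ^ Z ∧
      |((⟨N * G, A⟩ : GaussianInt) ^ k).im| ≤ 2 ^ Z := fun k hk => by
    have h1 := abs_re_add_abs_im_pow_le (N * G) A k
    rw [abs_of_nonneg hNG] at h1
    have h2 := hpow k hk
    constructor
    · linarith [abs_nonneg ((⟨N * G, A⟩ : GaussianInt) ^ k).im]
    · linarith [abs_nonneg ((⟨N * G, A⟩ : GaussianInt) ^ k).re]
  refine WP.loop (fun k s => s.out = o ∧ s.coins = r ∧ Small Z s.mem ∧ s.mem 4 0 = k ∧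
      s.mem 24 0 = ((⟨N * G, A⟩ : GaussianInt) ^ k).re ∧
      s.mem 25 0 = ((⟨N * G, A⟩ : GaussianInt) ^ k).im ∧ s.mem 26 0 = ((N : ℤ) * G) ^ k ∧
      ∀ a, a ∉ [4, 24, 25, 26, 27] → s.mem a = M a) N hN ?_ ?_ ?_ ?_
  · rintro k hk ⟨M', r', o'⟩ ⟨rfl, rfl, hS, e4, e24, e25, e26, efr⟩
    refine ⟨hS, by simp [Expr.Prec], ?_⟩
    simp only at *
    simp only [Expr.eval, efr 8 (by decide), h8, e4]
    omega
  · rintro k hk ⟨M', r', o'⟩ ⟨rfl, rfl, hS, e4, e24, e25, e26, efr⟩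
    simp only at *
    have e6 : M' 6 0 = G := by rw [efr 6 (by decide), h6]
    have e8 : M' 8 0 = N := by rw [efr 8 (by decide), h8]
    have e15 : M' 15 0 = A := by rw [efr 15 (by decide), h15]
    obtain ⟨b1, b2⟩ := hre (k + 1) hk
    refine WP.seq <| WP.store (j := 0) hS trivial (by simp [Expr.Prec]) rfl ?_ b1 fun hS1 => ?_
    · simp only [Expr.eval, e24, e25, e6, e8, e15, pow_succ, Zsqrtd.re_mul]; ring
    refine WP.seq <| WP.store (j := 0) hS1 trivial (by simp [Expr.Prec]) rfl ?_ b2 fun hS2 => ?_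
    · simp only [Expr.eval, write_of_ne _ _ _ (show 24 ≠ 27 by decide),
        write_of_ne _ _ _ (show 25 ≠ 27 by decide), write_of_ne _ _ _ (show 6 ≠ 27 by decide),
        write_of_ne _ _ _ (show 8 ≠ 27 by decide), write_of_ne _ _ _ (show 15 ≠ 27 by decide),
        e24, e25, e6, e8, e15, pow_succ, Zsqrtd.im_mul]
    refine WP.seq <| WP.store (j := 0) hS2 trivial (by simp [Expr.Prec]) rfl
      (by simp [Expr.eval, write_apply]) b1 fun hS3 => ?_
    refine WP.seq <| WP.store (j := 0) (v := ((N : ℤ) * G) ^ (k + 1)) hS3 trivial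
      (by simp [Expr.Prec]) rfl (by simp [Expr.eval, write_apply, e26, e6, e8, pow_succ]) ?_
      fun hS4 => ?_
    · rw [abs_of_nonneg (by positivity)]
      exact (pow_le_pow_left₀ hNG (by linarith [abs_nonneg A]) _).trans (hpow _ hk)
    refine WP.store (j := 0) (v := (k + 1 : ℕ)) hS4 trivial (by simp [Expr.Prec]) rfl
      (by simp [Expr.eval, write_apply, e4]) (abs_natCast_le_two_pow (hN.trans' hk))
      fun hS5 => ?_
    refine ⟨rfl, rfl, hS5, ?_, ?_, ?_, ?_, ?_⟩ <;> dsimp only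
    · simp [write_apply]
    · simp [write_apply]
    · simp [write_apply]
    · simp [write_apply]
    · intro a ha
      simp only [List.mem_cons, List.not_mem_nil, not_or, or_false] at ha
      simp [write_of_ne, ha, efr a (by simp [ha])]
  · exact ⟨rfl, rfl, hM, by simp [h4], by simp [h24], by simp [h25], by simp [h26], fun _ _ => rfl⟩
  · rintro ⟨M', r', o'⟩ ⟨h1, h2, h3, h4, h5, h6, h7⟩
    exact ⟨h1, h2, h3, h5, h7⟩

/-- Emit the output. -/
def emitAll : Prog :=
  .loop (.sub nE (var 4)) <|
    .seq (.emit (.get 3 (var 4))) <|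
    assign 4 (.add (var 4) (.lit 1))

theorem emitAll_spec {D : Data} {Z n d E : ℕ} (hD : Header D Z n d E) {M : Mem}
    {r : List Bool} {W : Fin n → Bool} (hM : Small Z M)
    (h3 : ∀ i, M 3 (i : Fin n) = bitVal (W i)) (h4 : M 4 0 = 0) :
    WP D Z emitAll (fun s => s.out = List.ofFn W) ⟨M, r, []⟩ := by
  refine WP.loop (fun k s => s.out = (List.ofFn W).take k ∧ Small Z s.mem ∧ s.mem 4 0 = k ∧
      s.mem 3 = M 3) n hD.n_le ?_ ?_ ?_ ?_
  · rintro k hk ⟨M', r', o'⟩ ⟨rfl, hS, e4, -⟩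
    refine ⟨hS, by simp [Expr.Prec, hD.prec_n], ?_⟩
    simp only at *
    simp only [Expr.eval, hD.eval_n, e4]
    omega
  · rintro k hk ⟨M', r', o'⟩ ⟨rfl, hS, e4, e3⟩
    simp only at *
    refine WP.seq <| WP.emit hS (by simp [Expr.Prec]) ?_
    refine WP.store (j := 0) (v := (k + 1 : ℕ)) hS trivial (by simp [Expr.Prec]) rfl
      (by simp [Expr.eval, e4]) (abs_natCast_le_two_pow (hD.n_le.trans' hk)) fun hS1 => ?_
    refine ⟨?_, hS1, by simp [write_apply], by simp [write_of_ne, e3]⟩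
    have h := h3 ⟨k, hk⟩
    simp only at h
    rw [List.take_add_one, List.getElem?_eq_getElem (by simpa using hk)]
    simp only [Expr.eval, e4, e3, h, List.getElem_ofFn, Option.toList_some]
    congr 2
    cases W ⟨k, hk⟩ <;> simp [bitVal]
  · exact ⟨by simp, hM, by simp [h4], rfl⟩
  · rintro ⟨M', r', o'⟩ ⟨h1, -⟩
    rwa [List.take_of_length_le (by simp)] at h1

/-! ### Assembly of the program for the signed mixture -/

/-- The index of the random number used for the amplitude. -/
def uE : Expr := .mul nE (.add dE (.lit 3))

/-- Draw random numbers and derive the choices. -/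
def setup : Prog :=
  .seq (assign 7 (.add (.add (.add (.add (.mul (.lit 12) (.mul nE nE)) nE) dE)
    (.mul (.lit 2) εE)) (.lit 4))) <|
  .seq (assign 8 (.mul (.lit 1600) (.mul εE (.mul (.mul nE dE) (.mul nE dE))))) <|
  .seq drawAll <|
  .seq (assign 9 (.real (.lit 0) (var 7))) <|
  .seq (assign 10 (.div (var 6) (.sub (.mul (.lit 2) nE) (.lit 1)))) <|
  .seq (assign 29 (.lit 1)) <|
  .seq (assign 30 (.lit 1)) <|
  .seq (assign 4 (.lit 0)) <|
  .seq powers <|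
  .seq (assign 4 (.lit 0)) choices

theorem setup_spec {D : Data} {Z n d E B N V P m : ℕ} (hD : Header D Z n d E) {r : List Bool}
    {R : ℕ → ℕ} (hn : 0 < n) (hB : B = 12 * n ^ 2 + n + d + 2 * E + 4)
    (hN : N = 1600 * E * (n * d) ^ 2) (hm : m = n * (d + 3) + 2) (hV : V = 2 ^ B / (2 * n - 1))
    (hP : (P : ℤ) = ⌊(2 : ℝ) ^ B * D.reals.getD 0 0⌋) (hPG : P ≤ 2 ^ B)
    (hR : ∀ k < m, R k = ofBits (bitsOf r) (B * k) B) (hr : B * m ≤ r.length)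
    (hBZ : B * (2 + n * (2 + d)) ≤ Z) (hNZ : N ≤ Z) (hmZ : m ≤ Z) :
    WP D Z setup (fun s => s.out = [] ∧ Small Z s.mem ∧
      (∀ k < m, s.mem 0 k = R k) ∧
      (∀ i < n, s.mem 1 i = bitVal (decide (R i < V))) ∧
      (∀ i < n, s.mem 2 i = bitVal (decide (R (n + i) < 2 ^ B / 2))) ∧
      (∀ i < n, s.mem 3 i = bitVal (decide (R (n + (n + i)) < 2 ^ B / 2))) ∧
      s.mem 6 0 = 2 ^ B ∧ s.mem 7 0 = B ∧ s.mem 8 0 = N ∧ s.mem 9 0 = P ∧ s.mem 10 0 = V ∧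
      s.mem 29 0 = (2 ^ B) ^ d ∧ s.mem 30 0 = (2 ^ B - P) ^ d) ⟨fun _ _ => 0, r, []⟩ := by
  have hB2 : B * 2 ≤ Z := hBZ.trans' (Nat.mul_le_mul_left _ (by omega))
  have hBZ' : B ≤ Z := by omega
  have hBd : B * d ≤ Z := hBZ.trans' (Nat.mul_le_mul_left _ (by nlinarith))
  have hpB : (2 : ℤ) ^ B ≤ 2 ^ Z := pow_le_pow_right₀ (by norm_num) hBZ'
  have hM0 : Small Z (fun _ _ => 0) := fun _ _ => by simp
  refine WP.seq <| WP.store (j := 0) (v := B) hM0 trivial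
    (by simp [Expr.Prec, hD.prec_n, hD.prec_d, hD.prec_E]) rfl ?_ (abs_natCast_le_two_pow hBZ')
    fun hS1 => ?_
  · simp only [Expr.eval, hD.eval_n, hD.eval_d, hD.eval_E, hB]; push_cast; ring
  refine WP.seq <| WP.store (j := 0) (v := N) hS1 trivial
    (by simp [Expr.Prec, hD.prec_n, hD.prec_d, hD.prec_E]) rfl ?_ (abs_natCast_le_two_pow hNZ)
    fun hS2 => ?_
  · simp only [Expr.eval, hD.eval_n, hD.eval_d, hD.eval_E, hN]; push_cast; ring
  refine WP.seq <| (drawAll_spec hD hm hmZ hBZ' hS2 (by simp [write_apply]) (by simp [write_apply])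
    (by simp [write_apply]) hr).mono ?_
  rintro ⟨M, r', o⟩ ⟨rfl, rfl, gS, g6, g0, gfr⟩
  simp only at *
  have g7 : M 7 0 = B := by simp [gfr 7 (by decide), write_apply]
  have g8 : M 8 0 = N := by simp [gfr 8 (by decide), write_apply]
  refine WP.seq <| WP.store (j := 0) (v := P) gS trivial ?_ rfl ?_ ?_ fun hS3 => ?_
  · simp only [Expr.Prec, Expr.eval, g7, Int.toNat_natCast, hBZ', hD.reals_nonneg, hD.reals_lt,
      and_self]
  · simp only [Expr.eval, g7, Int.toNat_natCast]; exact hP.symm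
  · rw [Nat.abs_cast]; exact le_trans (by exact_mod_cast hPG) hpB
  have hVG : V ≤ 2 ^ B := hV ▸ Nat.div_le_self _ _
  refine WP.seq <| WP.store (j := 0) (v := V) hS3 trivial (by simp [Expr.Prec, hD.prec_n]) rfl ?_ ?_
    fun hS4 => ?_
  · simp only [Expr.eval, hD.eval_n, write_of_ne _ _ _ (show 6 ≠ 9 by decide), g6, hV]
    push_cast [show 1 ≤ 2 * n by omega]
    rfl
  · rw [Nat.abs_cast]; exact le_trans (by exact_mod_cast hVG) hpB
  refine WP.seq <| WP.store (j := 0) (v := 1) hS4 trivial trivial rfl rfl abs_one_le_two_pow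
    fun hS5 => ?_
  refine WP.seq <| WP.store (j := 0) (v := 1) hS5 trivial trivial rfl rfl abs_one_le_two_pow
    fun hS6 => ?_
  refine WP.seq <| WP.store (j := 0) (v := 0) hS6 trivial trivial rfl rfl abs_zero_le_two_pow
    fun hS7 => ?_
  refine WP.seq <| (powers_spec (P := P) (B := B) hD hS7 hBd hPG (by simp [write_apply, g6])
    (by simp [write_apply]) (by simp [write_apply]) (by simp [write_apply])
    (by simp [write_apply])).mono ?_
  rintro ⟨M', r', o⟩ ⟨rfl, rfl, fS, f29, f30, ffr⟩
  simp only at *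
  have f0 : M' 0 = M 0 := by simp [ffr 0 (by decide), write_of_ne]
  refine WP.seq <| WP.store (j := 0) (v := 0) fS trivial trivial rfl rfl abs_zero_le_two_pow
    fun hS8 => ?_
  have hR' : ∀ k < m, write M' 4 0 0 0 k = R k := fun k hk => by
    rw [write_of_ne _ _ _ (by decide), f0, g0 k hk, hR k hk]
  refine (choices_spec (G := 2 ^ B) (V := V) (R := R) hD hS8
    (fun k hk => hR' k (by rw [hm]; nlinarith))
    (by simp [write_apply, ffr 10 (by decide)]) (by simp [write_apply, ffr 6 (by decide), g6])
    (by simp [write_apply])).mono ?_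
  rintro ⟨N', r', o⟩ ⟨rfl, rfl, eS, e1, e2, e3, efr⟩
  simp only at *
  refine ⟨trivial, eS, fun k hk => ?_, e1, e2, e3, ?_, ?_, ?_, ?_, ?_, ?_, ?_⟩
  · rw [efr 0 (by decide)]; exact hR' k hk
  · simp [efr 6 (by decide), write_apply, ffr 6 (by decide), g6]
  · simp [efr 7 (by decide), write_apply, ffr 7 (by decide), g7]
  · simp [efr 8 (by decide), write_apply, ffr 8 (by decide), g8]
  · simp [efr 9 (by decide), write_apply, ffr 9 (by decide)]
  · simp [efr 10 (by decide), write_apply, ffr 10 (by decide)]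
  · simp [efr 29 (by decide), write_apply, f29]
  · simp [efr 30 (by decide), write_apply, f30]

/-- Compute the quantities of the two tests from the choices. -/
def compute : Prog :=
  .seq (assign 11 (.mul (.get 0 uE) (.get 0 uE))) <|
  .seq (assign 12 (.mul (var 6) (var 6))) <|
  .seq (assign 13 (.lit 1)) <|
  .seq (assign 14 (.lit (-1))) <|
  .seq (assign 4 (.lit 0)) <|
  .seq products <|
  .seq (assign 15 (.lit 0)) <|
  .seq (assign 16 (.lit 3)) <|
  .seq (assign 17 (.lit 1)) <|
  .seq (assign 18 (.add nE (.add nE nE))) <|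
  .seq (assign 4 (.lit 0)) runLayers

/-- Perform the two tests and emit the result. -/
def decideAndEmit : Prog :=
  .seq (setBit 23 (.lit 0) (.sub (var 12) (var 11))) <|
  .seq (assign 24 (.lit 1)) <|
  .seq (assign 25 (.lit 0)) <|
  .seq (assign 26 (.lit 1)) <|
  .seq (assign 4 (.lit 0)) <|
  .seq gaussPow <|
  .seq (.branch (.sub (.mul (var 6) (.add (var 26) (.mul (.mul (var 13) (var 24)) (var 23))))
      (.mul (.mul (.lit 2) (.get 0 (.add uE (.lit 1)))) (var 26))) .skip
    (setBit 3 (var 14) (.sub (.lit 1) (.get 3 (var 14))))) <|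
  .seq (assign 4 (.lit 0)) emitAll

theorem flipLast_eq_lastIdx {n : ℕ} (S : ℕ → Bool) (x : Fin n → Bool) (i : Fin n) :
    flipLast (fun j => S j) x i = if ((i : ℕ) : ℤ) = lastIdx S n then !x i else x i := by
  have h := lastIdx_eq_iff S n i i.2
  rw [flipLast]
  congr 1
  rw [eq_iff_iff, @eq_comm _ _ (lastIdx S n), h]
  refine and_congr_right fun _ => ⟨fun H k hk => H ⟨k, hk⟩, fun H k hk => H k k.2 hk⟩

theorem compute_spec {D : Data} {Z n E ℓ B V P m : ℕ} {Ls : List (List (Gate n))}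
    (hD : Header D Z n Ls.length E) {M : Mem} {r : List Bool} {R : ℕ → ℕ}
    (hm : m = n * (Ls.length + 3) + 2) (hmZ : m ≤ Z) (hZ : 2 ≤ Z)
    (hV : V ≤ 2 ^ B) (hPG : P ≤ 2 ^ B) (hRB : ∀ k < m, R k < 2 ^ B)
    (hBZ : B * (2 + n * (2 + Ls.length)) ≤ Z) (hTZ : B + 14 * (n * Ls.length) ≤ Z)
    (hLs : ∀ L ∈ Ls, ∀ g ∈ L, g.InGateSet ℓ) (hlen : ∀ L ∈ Ls, L.length ≤ n)
    (hp : At D.ints 3 (Ls.flatMap fun L => (L.length : ℤ) :: L.flatMap Gate.code))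
    (hq : At D.reals 1 (Ls.flatten.map fun g => toIcoMod Real.two_pi_pos 0 g.angle))
    {S X : ℕ → Bool} {Y : Fin n → Bool} (hM : Small Z M) (h0 : ∀ k < m, M 0 k = R k)
    (h1 : ∀ i < n, M 1 i = bitVal (S i)) (h2 : ∀ i : Fin n, M 2 i = bitVal (Y i))
    (h3 : ∀ i < n, M 3 i = bitVal (X i)) (h6 : M 6 0 = 2 ^ B) (h7 : M 7 0 = B)
    (h9 : M 9 0 = P) (h10 : M 10 0 = V)
    (h29 : M 29 0 = (2 ^ B) ^ Ls.length) (h30 : M 30 0 = (2 ^ B - P) ^ Ls.length) :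
    WP D Z compute (fun s => s.out = [] ∧ Small Z s.mem ∧
      s.mem 11 0 = R (n * (Ls.length + 3)) ^ 2 * ∏ i : Fin n,
        (if S i then (V : ℤ) ^ 2 * (2 ^ B) ^ Ls.length else ((2 : ℤ) ^ B - V) ^ 2) ∧
      s.mem 12 0 = (2 ^ B) ^ 2 * ∏ i : Fin n, (if S i then
        ((2 : ℤ) ^ B) ^ 2 * (2 ^ B - P) ^ Ls.length else (2 ^ B) ^ 2) ∧
      s.mem 13 0 = sgn (fun i : Fin n => S i) (fun i => X i) ∧ s.mem 14 0 = lastIdx S n ∧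
      |s.mem 15 0| ≤ (14 * 2 ^ B * (n * Ls.length) : ℕ) ∧
      s.mem 15 0 = phaseDiff (Gate.angleInt (2 ^ B)) (fun i : Fin n => S i) Ls
        (fun t (i : Fin n) => decide (R (n + (n + (n + (i + n * t)))) < P)) Y ∧
      ∀ a, a ∈ [0, 3, 6, 8] → s.mem a = M a) ⟨M, r, []⟩ := by
  have hu : R (n * (Ls.length + 3)) < 2 ^ B := hRB _ (by omega)
  have hB2 : B * 2 ≤ Z := hBZ.trans' (Nat.mul_le_mul_left _ (by omega))
  have hsq : ∀ x : ℤ, 0 ≤ x → x ≤ 2 ^ B → |x ^ 2| ≤ 2 ^ Z := fun x h0 h => by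
    rw [abs_of_nonneg (by positivity)]
    refine (pow_le_pow_left₀ h0 h 2).trans ?_
    rw [← pow_mul]
    exact pow_le_pow_right₀ (by norm_num) hB2
  have h0u : M 0 ((n : ℤ) * (Ls.length + 3)) = R (n * (Ls.length + 3)) := by
    rw [← h0 _ (by omega)]; push_cast; rfl
  have hup : uE.Prec D M Z := by simp [uE, Expr.Prec, hD.prec_n, hD.prec_d]
  have hue : uE.eval D M = (n : ℤ) * (Ls.length + 3) := by
    simp [uE, Expr.eval, hD.eval_n, hD.eval_d]
  refine WP.seq <| WP.store (j := 0) (v := R (n * (Ls.length + 3)) ^ 2) hM trivial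
    (by simp [Expr.Prec, hup]) rfl (by simp only [Expr.eval, hue, h0u]; ring)
    (hsq _ (by positivity) (by exact_mod_cast hu.le)) fun hS1 => ?_
  refine WP.seq <| WP.store (j := 0) (v := (2 ^ B) ^ 2) hS1 trivial
    (by simp [Expr.Prec]) rfl (by simp [Expr.eval, write_apply, h6]; ring)
    (hsq _ (by positivity) le_rfl) fun hS2 => ?_
  refine WP.seq <| WP.store (j := 0) (v := 1) hS2 trivial trivial rfl rfl abs_one_le_two_pow
    fun hS3 => ?_
  refine WP.seq <| WP.store (j := 0) (v := -1) hS3 trivial trivial rfl rfl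
    (by rw [abs_neg]; exact abs_one_le_two_pow) fun hS4 => ?_
  refine WP.seq <| WP.store (j := 0) (v := 0) hS4 trivial trivial rfl rfl abs_zero_le_two_pow
    fun hS5 => ?_
  refine WP.seq <| (products_spec (S := S) (X := X) (V := V) (P := P) hD hS5 hV hPG hu.le hBZ
    ?_ ?_ ?_ ?_ ?_ ?_ ?_ ?_ ?_ ?_ ?_).mono ?_
  · intro i hi; simp [write_apply, h1 i hi]
  · intro i hi; simp [write_apply, h3 i hi]
  · simp [write_apply, h10]
  · simp [write_apply, h6]
  · simp [write_apply]
  · simp [write_apply, h29]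
  · simp [write_apply, h30]
  · simp [write_apply]
  · simp [write_apply]
  · simp [write_apply]
  · simp [write_apply]
  rintro ⟨N, r', o⟩ ⟨rfl, rfl, gS, g11, g12, g13, g14, gfr⟩
  simp only at *
  have fr : ∀ a, a ∉ [4, 11, 12, 13, 14] → N a = M a := by
    intro a ha
    have ha' := ha
    simp only [List.mem_cons, List.not_mem_nil, not_or, or_false] at ha
    rw [gfr a ha']
    simp [write_of_ne, ha]
  refine WP.seq <| WP.store (j := 0) (v := 0) gS trivial trivial rfl rfl abs_zero_le_two_pow
    fun hS6 => ?_
  refine WP.seq <| WP.store (j := 0) (v := (3 : ℕ)) hS6 trivial trivial rfl rfl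
    ?_ fun hS7 => ?_
  · refine le_trans ?_ (pow_le_pow_right₀ (by norm_num) hZ)
    norm_num
  refine WP.seq <| WP.store (j := 0) (v := (1 : ℕ)) hS7 trivial trivial rfl rfl
    (by simpa using abs_one_le_two_pow) fun hS8 => ?_
  refine WP.seq <| WP.store (j := 0) (v := (n + (n + n) : ℕ)) hS8 trivial
    (by simp [Expr.Prec, hD.prec_n]) rfl (by simp [Expr.eval, hD.eval_n])
    (abs_natCast_le_two_pow (by rw [hm] at hmZ; nlinarith)) fun hS9 => ?_
  refine WP.seq <| WP.store (j := 0) (v := 0) hS9 trivial trivial rfl rfl abs_zero_le_two_pow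
    fun hS10 => ?_
  have hm' : n + (n + (n + n * Ls.length)) ≤ m := by rw [hm]; nlinarith
  refine (runLayers_spec (R := R) (S := fun i : Fin n => S i) (Y := Y) (P := P) (B := B)
    (T := 14 * 2 ^ B * (n * Ls.length)) hD hS10 hLs hlen (by omega) hp hq le_rfl ?_ (by omega) ?_
    ?_ ?_ ?_ ?_ ?_ ?_ ?_ ?_ ?_).mono ?_
  -- The crude bound k ≤ 2^k suffices, as only the bit length of the phase matters.
  · have h : 14 * (n * Ls.length) ≤ 2 ^ (14 * (n * Ls.length)) := Nat.lt_two_pow_self.le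
    have h' : 14 * 2 ^ B * (n * Ls.length) ≤ 2 ^ Z := by
      calc 14 * 2 ^ B * (n * Ls.length) = 2 ^ B * (14 * (n * Ls.length)) := by ring
        _ ≤ 2 ^ B * 2 ^ (14 * (n * Ls.length)) := Nat.mul_le_mul_left _ h
        _ = 2 ^ (B + 14 * (n * Ls.length)) := by rw [pow_add]
        _ ≤ 2 ^ Z := Nat.pow_le_pow_right (by norm_num) hTZ
    exact_mod_cast h'
  · intro k hk; simp [write_apply, fr 0 (by decide), h0 k (by omega)]
  · intro i; simp [write_apply, fr 1 (by decide), h1 i i.2]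
  · intro i; simp [write_apply, fr 2 (by decide), h2 i]
  · simp [write_apply]
  · simp [write_apply, fr 7 (by decide), h7]
  · simp [write_apply, fr 9 (by decide), h9]
  · simp [write_apply]
  · simp [write_apply]
  · simp [write_apply]
  · simp [write_apply]
  rintro ⟨N', r', o⟩ ⟨rfl, rfl, fS, fb, f15, ffr⟩
  simp only at *
  refine ⟨trivial, fS, ?_, ?_, ?_, ?_, fb, f15, ?_⟩
  · simp only [ffr 11 (by decide), write_apply, g11, Finset.prod_range]; simp
  · simp only [ffr 12 (by decide), write_apply, g12, Finset.prod_range]; simp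
  · simp only [ffr 13 (by decide), write_apply, g13, Finset.prod_range, sgn]; simp
  · simp only [ffr 14 (by decide), write_apply, g14]; simp
  · intro a ha
    simp only [List.mem_cons, List.not_mem_nil, or_false] at ha
    rcases ha with rfl | rfl | rfl | rfl <;>
      rw [ffr _ (by decide), write_of_ne _ _ _ (by decide), write_of_ne _ _ _ (by decide),
        write_of_ne _ _ _ (by decide), write_of_ne _ _ _ (by decide),
        write_of_ne _ _ _ (by decide), fr _ (by decide)]

theorem decideAndEmit_spec {D : Data} {Z n E B V P N m : ℕ} {Ls : List (List (Gate n))}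
    (hD : Header D Z n Ls.length E) {M : Mem} {r : List Bool} {R : ℕ → ℕ}
    (hm : m = n * (Ls.length + 3) + 2) (hNZ : N * (B + N + 14 * (n * Ls.length)) ≤ Z) (hN' : N ≤ Z)
    {S X : ℕ → Bool} {Y : Fin n → Bool} {e : ℕ → Fin n → Bool}
    (hM : Small Z M) (h0 : ∀ k < m, M 0 k = R k)
    (h3 : ∀ i < n, M 3 i = bitVal (X i)) (h6 : M 6 0 = 2 ^ B) (h8 : M 8 0 = N)
    (h11 : M 11 0 = R (n * (Ls.length + 3)) ^ 2 * ∏ i : Fin n,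
        (if S i then (V : ℤ) ^ 2 * (2 ^ B) ^ Ls.length else ((2 : ℤ) ^ B - V) ^ 2))
    (h12 : M 12 0 = (2 ^ B) ^ 2 * ∏ i : Fin n, (if S i then
        ((2 : ℤ) ^ B) ^ 2 * (2 ^ B - P) ^ Ls.length else (2 ^ B) ^ 2))
    (h13 : M 13 0 = sgn (fun i : Fin n => S i) (fun i => X i)) (h14 : M 14 0 = lastIdx S n)
    (hb : |M 15 0| ≤ (14 * 2 ^ B * (n * Ls.length) : ℕ))
    (h15 : M 15 0 = phaseDiff (Gate.angleInt (2 ^ B)) (fun i : Fin n => S i) Ls e Y) :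
    WP D Z decideAndEmit (fun s => s.out = List.ofFn (sampler N (2 ^ B) V P Ls
      (fun i : Fin n => S i) Y (fun i => X i) e (R (n * (Ls.length + 3)))
      (R (n * (Ls.length + 3) + 1)))) ⟨M, r, []⟩ := by
  classical
  have hamp : ampTest Ls.length (2 ^ B) V P (fun i : Fin n => S i) (R (n * (Ls.length + 3))) ↔
      M 11 0 < M 12 0 := by
    rw [h11, h12, ampTest]; push_cast; rfl
  refine WP.seq <| WP.setBit (j := 0) (b := decide (M 11 0 < M 12 0)) hM trivial
    (by simp [Expr.Prec]) rfl (by simp [Expr.eval]) fun hS1 => ?_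
  refine WP.seq <| WP.store (j := 0) (v := 1) hS1 trivial trivial rfl rfl abs_one_le_two_pow
    fun hS2 => ?_
  refine WP.seq <| WP.store (j := 0) (v := 0) hS2 trivial trivial rfl rfl abs_zero_le_two_pow
    fun hS3 => ?_
  refine WP.seq <| WP.store (j := 0) (v := 1) hS3 trivial trivial rfl rfl abs_one_le_two_pow
    fun hS4 => ?_
  refine WP.seq <| WP.store (j := 0) (v := 0) hS4 trivial trivial rfl rfl abs_zero_le_two_pow
    fun hS5 => ?_
  refine WP.seq <| (gaussPow_spec (N := N) (G := 2 ^ B) (A := M 15 0)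
    (q := B + N + 14 * (n * Ls.length)) hS5 hN' ?_ (by rwa [mul_comm]) (by simp [write_apply])
    (by simp [write_apply, h6]) (by simp [write_apply, h8]) (by simp [write_apply])
    (by simp [write_apply]) (by simp [write_apply]) (by simp [write_apply])).mono ?_
  · have h : N + 14 * (n * Ls.length) ≤ 2 ^ (N + 14 * (n * Ls.length)) := Nat.lt_two_pow_self.le
    have h' : N * 2 ^ B + 14 * 2 ^ B * (n * Ls.length) ≤ 2 ^ (B + N + 14 * (n * Ls.length)) := by
      calc N * 2 ^ B + 14 * 2 ^ B * (n * Ls.length) = 2 ^ B * (N + 14 * (n * Ls.length)) := by ring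
        _ ≤ 2 ^ B * 2 ^ (N + 14 * (n * Ls.length)) := Nat.mul_le_mul_left _ h
        _ = _ := by rw [← pow_add, add_assoc]
    zify at h' hb
    push_cast
    linarith
  rintro ⟨M', r', o⟩ ⟨rfl, rfl, gS, g24, g26, gfr⟩
  simp only at *
  have fr : ∀ a, a ∈ [0, 3, 6, 13, 14] → M' a = M a := by
    intro a ha
    simp only [List.mem_cons, List.not_mem_nil, or_false] at ha
    rcases ha with rfl | rfl | rfl | rfl | rfl <;>
      rw [gfr _ (by decide), write_of_ne _ _ _ (by decide), write_of_ne _ _ _ (by decide),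
        write_of_ne _ _ _ (by decide), write_of_ne _ _ _ (by decide),
        write_of_ne _ _ _ (by decide)]
  have g23 : M' 23 0 = bitVal (decide (M 11 0 < M 12 0)) := by
    simp [gfr 23 (by decide), write_apply]
  have hkeep : keepTest N (2 ^ B) (phaseDiff (Gate.angleInt (2 ^ B)) (fun i : Fin n => S i) Ls e Y)
      (sgn (fun i : Fin n => S i) fun i => X i)
      (if ampTest Ls.length (2 ^ B) V P (fun i : Fin n => S i) (R (n * (Ls.length + 3)))
        then 1 else 0) (R (n * (Ls.length + 3) + 1)) ↔
      0 < (Expr.sub (.mul (var 6) (.add (var 26) (.mul (.mul (var 13) (var 24)) (var 23))))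
      (.mul (.mul (.lit 2) (.get 0 (.add uE (.lit 1)))) (var 26))).eval D M' := by
    have e0 : M' 0 ((n : ℤ) * (Ls.length + 3) + 1) = R (n * (Ls.length + 3) + 1) := by
      rw [fr 0 (by decide), ← h0 _ (by omega)]; push_cast; rfl
    simp only [Expr.eval, uE, hD.eval_n, hD.eval_d, e0, fr 6 (by decide), fr 13 (by decide), g24,
      g26, g23, h6, h13, keepTest, hamp, ← h15, bitVal, decide_eq_true_eq]
    push_cast
    rfl
  have key : ∀ N' : Mem, Small Z N' → (∀ i : Fin n, N' 3 i = bitVal (sampler N (2 ^ B) V P Ls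
      (fun i : Fin n => S i) Y (fun i => X i) e (R (n * (Ls.length + 3)))
      (R (n * (Ls.length + 3) + 1)) i)) →
      WP D Z (.seq (assign 4 (.lit 0)) emitAll) (fun s => s.out = List.ofFn (sampler N (2 ^ B) V P Ls
      (fun i : Fin n => S i) Y (fun i => X i) e (R (n * (Ls.length + 3)))
      (R (n * (Ls.length + 3) + 1)))) ⟨N', r', []⟩ := fun N' hN'S hN'3 => by
    refine WP.seq <| WP.store (j := 0) (v := 0) hN'S trivial trivial rfl rfl abs_zero_le_two_pow
      fun hS6 => ?_
    exact emitAll_spec hD hS6 (fun i => by rw [write_of_ne _ _ _ (by decide), hN'3])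
      (by simp [write_apply])
  refine WP.seq <| WP.branch gS (by simp [Expr.Prec, uE, hD.prec_n, hD.prec_d]) (fun h => ?_)
    fun h => ?_
  · refine WP.skip (key M' gS fun i => ?_)
    rw [sampler, if_pos (hkeep.mpr h), fr 3 (by decide), h3 i i.2]
  · refine WP.setBit (j := lastIdx S n) (b := decide (M 3 (lastIdx S n) < 1)) gS
      (by simp [Expr.Prec]) (by simp [Expr.Prec])
      (by simp [Expr.eval, fr 14 (by decide), h14])
      (by simp [Expr.eval, fr 14 (by decide), h14, fr 3 (by decide)]) fun hS6 => key _ hS6 fun i => ?_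
    rw [sampler, if_neg (hkeep.not.mpr h), flipLast_eq_lastIdx, write_apply]
    by_cases hi : ((i : ℕ) : ℤ) = lastIdx S n
    · rw [if_pos ⟨rfl, hi⟩, if_pos hi, ← hi, h3 i i.2]
      cases X i <;> simp [bitVal]
    · rw [if_neg (fun h' => hi h'.2), if_neg hi, fr 3 (by decide), h3 i i.2]

/-- Draw a sample. -/
def drawSample : Prog := .seq setup <| .seq compute decideAndEmit

theorem drawSample_spec {D : Data} {Z n E ℓ B N V P m : ℕ} {Ls : List (List (Gate n))}
    (hD : Header D Z n Ls.length E) {r : List Bool} {R : ℕ → ℕ} (hn : 0 < n)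
    (hB : B = 12 * n ^ 2 + n + Ls.length + 2 * E + 4)
    (hN : N = 1600 * E * (n * Ls.length) ^ 2) (hm : m = n * (Ls.length + 3) + 2)
    (hV : V = 2 ^ B / (2 * n - 1))
    (hP : (P : ℤ) = ⌊(2 : ℝ) ^ B * D.reals.getD 0 0⌋) (hPG : P ≤ 2 ^ B)
    (hR : ∀ k < m, R k = ofBits (bitsOf r) (B * k) B) (hr : B * m ≤ r.length)
    (hBZ : B * (2 + n * (2 + Ls.length)) ≤ Z) (hTZ : B + 14 * (n * Ls.length) ≤ Z)
    (hNZ : N * (B + N + 14 * (n * Ls.length)) ≤ Z) (hN' : N ≤ Z) (hmZ : m ≤ Z)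
    (hLs : ∀ L ∈ Ls, ∀ g ∈ L, g.InGateSet ℓ) (hlen : ∀ L ∈ Ls, L.length ≤ n)
    (hp : At D.ints 3 (Ls.flatMap fun L => (L.length : ℤ) :: L.flatMap Gate.code))
    (hq : At D.reals 1 (Ls.flatten.map fun g => toIcoMod Real.two_pi_pos 0 g.angle)) :
    WP D Z drawSample (fun s => s.out = List.ofFn (sampler N (2 ^ B) V P Ls
      (fun i : Fin n => decide (R i < V)) (fun i => decide (R (n + i) < 2 ^ B / 2))
      (fun i => decide (R (n + (n + i)) < 2 ^ B / 2))
      (fun t i => decide (R (n + (n + (n + (i + n * t)))) < P)) (R (n * (Ls.length + 3)))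
      (R (n * (Ls.length + 3) + 1)))) ⟨fun _ _ => 0, r, []⟩ := by
  refine WP.seq <| (setup_spec hD hn hB hN hm hV hP hPG hR hr hBZ hN' hmZ).mono ?_
  rintro ⟨M, r', o⟩ ⟨rfl, hS, h0, h1, h2, h3, h6, h7, h8, h9, h10, h29, h30⟩
  simp only at *
  refine WP.seq <| (compute_spec (R := R) (S := fun i => decide (R i < V))
    (X := fun i => decide (R (n + (n + i)) < 2 ^ B / 2)) (ℓ := ℓ)
    (Y := fun i => decide (R (n + i) < 2 ^ B / 2)) hD hm hmZ (by omega)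
    (hV ▸ Nat.div_le_self _ _) hPG (fun k hk => by rw [hR k hk]; exact ofBits_lt _ _ _) hBZ hTZ hLs
    hlen hp hq hS h0 h1 (fun i => h2 i i.2) h3 h6 h7 h9 h10 h29 h30).mono ?_
  rintro ⟨M', r'', o⟩ ⟨rfl, gS, g11, g12, g13, g14, gb, g15, gfr⟩
  simp only at *
  exact decideAndEmit_spec (S := fun i => decide (R i < V))
    (X := fun i => decide (R (n + (n + i)) < 2 ^ B / 2)) hD hm hNZ hN' gS
    (fun k hk => by rw [gfr 0 (by decide), h0 k hk])
    (fun i hi => by rw [gfr 3 (by decide), h3 i hi]) (by rw [gfr 6 (by decide), h6])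
    (by rw [gfr 8 (by decide), h8]) g11 g12 g13 g14 gb g15

/-! ### The problem instance -/

theorem Gate.support_nonempty {n l : ℕ} {g : Gate n} (h : g.InGateSet l) : g.support.Nonempty := by
  cases g with
  | zRot t i => exact Finset.singleton_nonempty i
  | cPhase θ s => exact Finset.card_pos.mp (lt_of_lt_of_le (by norm_num) h.1)

/-- Disjoint nonempty supports inject the gates of a layer into the n qubits. Nonemptiness is
supplied by the gate set. -/
theorem length_le_of_pairwise_disjoint {n : ℕ} {L : List (Gate n)}
    (hne : ∀ g ∈ L, g.support.Nonempty)
    (hd : L.Pairwise fun g h => Disjoint g.support h.support) : L.length ≤ n := by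
  have key : L.length ≤ (L.foldr (fun (g : Gate n) U => g.support ∪ U) ∅).card := by
    induction L with
    | nil => simp
    | cons g L ih =>
      rw [List.pairwise_cons] at hd
      have h1 := ih (fun g' h => hne g' (List.mem_cons_of_mem _ h)) hd.2
      have h2 : 0 < g.support.card := Finset.card_pos.mpr (hne g List.mem_cons_self)
      have h3 : ∀ L' : List (Gate n), (∀ h ∈ L', Disjoint g.support h.support) →
          Disjoint g.support (L'.foldr (fun (g : Gate n) U => g.support ∪ U) ∅) := by
        intro L' h
        induction L' with
        | nil => simp
        | cons g' L' ih' =>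
          rw [List.foldr_cons, Finset.disjoint_union_right]
          exact ⟨h g' List.mem_cons_self, ih' fun h' hh => h h' (List.mem_cons_of_mem _ hh)⟩
      rw [List.foldr_cons, Finset.card_union_of_disjoint (h3 L hd.1), List.length_cons]
      omega
  exact key.trans (by simpa using Finset.card_le_univ (L.foldr (fun (g : Gate n) U => g.support ∪ U) ∅))

section Instance

variable {n l : ℕ} (C : Circuit n l)

theorem Circuit.layer_length_le : ∀ L ∈ C.layers, L.length ≤ n := fun L hL =>
  length_le_of_pairwise_disjoint (fun g hg => Gate.support_nonempty (C.inGateSet L hL g hg))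
    (C.disjoint L hL)

theorem Gate.length_code_le (g : Gate n) : g.code.length ≤ n + 1 := by
  have : g.support.card ≤ n := by simpa using g.support.card_le_univ
  simpa [Gate.code_eq] using this

theorem Gate.mem_code {g : Gate n} {x : ℤ} (hx : x ∈ g.code) : 0 ≤ x ∧ x ≤ n := by
  have hc : g.support.card ≤ n := by simpa using g.support.card_le_univ
  rw [Gate.code_eq, List.mem_cons, List.mem_map] at hx
  rcases hx with rfl | ⟨i, -, rfl⟩
  · exact ⟨by positivity, by exact_mod_cast hc⟩
  · exact ⟨by positivity, by exact_mod_cast i.2.le⟩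

theorem length_flatMap_le {α β : Type*} (L : List α) (f : α → List β) (c : ℕ)
    (h : ∀ x ∈ L, (f x).length ≤ c) : (L.flatMap f).length ≤ L.length * c := by
  rw [List.length_flatMap]
  refine (List.sum_le_card_nsmul _ c ?_).trans (by simp)
  simpa using h

theorem header_instanceData {p ε : ℝ} {E Z : ℕ} (hE : (E : ℤ) = ⌈1 / ε⌉) (hp0 : 0 ≤ p)
    (hp1 : p ≤ 1) (hn : n ≤ Z) (hd : C.layers.length ≤ Z) (hEZ : E ≤ Z)
    (hlen : 3 + C.layers.length * (n * (n + 1) + 1) ≤ Z) :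
    Header (instanceData C p ε) Z n C.layers.length E where
  ints_zero := by simp [instanceData]
  ints_one := by simp [instanceData, Circuit.depth]
  ints_two := by simp [instanceData, hE]
  n_le := hn
  d_le := hd
  E_le := hEZ
  ints_le := by
    have hn' : (n : ℤ) ≤ 2 ^ Z := (le_abs_self _).trans (abs_natCast_le_two_pow hn)
    have key : ∀ x ∈ (instanceData C p ε).ints, |x| ≤ 2 ^ Z := by
      intro x hx
      simp only [instanceData, ← hE, Circuit.depth, List.mem_append, List.mem_cons,
        List.not_mem_nil, or_false, List.mem_flatMap] at hx
      rcases hx with (rfl | rfl | rfl) | ⟨L, hL, rfl | ⟨g, hg, hx⟩⟩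
      · exact abs_natCast_le_two_pow hn
      · exact abs_natCast_le_two_pow hd
      · exact abs_natCast_le_two_pow hEZ
      · exact abs_natCast_le_two_pow ((C.layer_length_le L hL).trans hn)
      · obtain ⟨h1, h2⟩ := Gate.mem_code hx
        rw [abs_of_nonneg h1]; exact h2.trans hn'
    intro k
    rw [List.getD_eq_getElem?_getD]
    by_cases hk : k < (instanceData C p ε).ints.length
    · rw [List.getElem?_eq_getElem hk]
      exact key _ (List.getElem_mem hk)
    · rw [List.getElem?_eq_none (by omega)]; simp
  length_le := by
    refine le_trans ?_ hlen
    simp only [instanceData, List.length_append, List.length_cons, List.length_nil]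
    refine Nat.add_le_add_left (length_flatMap_le _ _ _ fun L hL => ?_) 3
    rw [List.length_cons, Nat.add_le_add_iff_right]
    exact (length_flatMap_le _ _ _ fun g _ => g.length_code_le).trans
      (Nat.mul_le_mul_right _ (C.layer_length_le L hL))
  reals_nonneg := by
    intro k
    have key : ∀ x ∈ (instanceData C p ε).reals, 0 ≤ x := by
      intro x hx
      simp only [instanceData, List.mem_cons, List.mem_map] at hx
      rcases hx with rfl | ⟨g, -, rfl⟩
      · exact hp0
      · exact g.angleMod_nonneg
    rw [List.getD_eq_getElem?_getD]
    by_cases hk : k < (instanceData C p ε).reals.length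
    · rw [List.getElem?_eq_getElem hk]
      exact key _ (List.getElem_mem hk)
    · rw [List.getElem?_eq_none (by omega)]; simp
  reals_lt := by
    intro k
    have key : ∀ x ∈ (instanceData C p ε).reals, x < 8 := by
      intro x hx
      simp only [instanceData, List.mem_cons, List.mem_map] at hx
      rcases hx with rfl | ⟨g, -, rfl⟩
      · linarith
      · have := g.angleMod_lt
        rw [Gate.angleMod] at this
        linarith
    rw [List.getD_eq_getElem?_getD]
    by_cases hk : k < (instanceData C p ε).reals.length
    · rw [List.getElem?_eq_getElem hk]
      exact key _ (List.getElem_mem hk)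
    · rw [List.getElem?_eq_none (by omega)]; simp
  reals_length_le := by
    refine le_trans ?_ hlen
    have h := length_flatMap_le C.layers id n C.layer_length_le
    rw [List.flatMap_id] at h
    simp only [instanceData, List.length_cons, List.length_map]
    nlinarith [Nat.zero_le (C.layers.length * (n * n)), Nat.zero_le C.layers.length]

theorem at_ints_instanceData (p ε : ℝ) : At (instanceData C p ε).ints 3
    (C.layers.flatMap fun L => (L.length : ℤ) :: L.flatMap Gate.code) :=
  ⟨[(n : ℤ), (C.depth : ℤ), ⌈1 / ε⌉], [], by simp [instanceData], rfl⟩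

theorem at_reals_instanceData (p ε : ℝ) : At (instanceData C p ε).reals 1
    (C.layers.flatten.map fun g => toIcoMod Real.two_pi_pos 0 g.angle) :=
  ⟨[p], [], by simp [instanceData], rfl⟩

end Instance

/-! ### The uniform distribution -/

/-- Emit `n` coin tosses. -/
def emitCoins : Prog :=
  .loop (.sub nE (var 4)) <|
    .seq (.flip 3 (.lit 0)) <|
    .seq (.emit (var 3)) <|
    assign 4 (.add (var 4) (.lit 1))

theorem emitCoins_spec {D : Data} {n : ℕ} (hD : D.ints.getD 0 0 = (n : ℤ)) {r : List Bool}
    (hr : n ≤ r.length) :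
    WP D n emitCoins (fun s => s.out = r.take n) ⟨fun _ _ => 0, r, []⟩ := by
  have hprec : ∀ M, nE.Prec D M n := fun M =>
    ⟨trivial, (congrArg abs hD).trans_le (abs_natCast_le_two_pow le_rfl)⟩
  have heval : ∀ M, nE.eval D M = n := fun M => hD
  refine WP.loop (fun k s => s.out = r.take k ∧ s.coins = r.drop k ∧ Small n s.mem ∧
      s.mem 4 0 = k) n le_rfl ?_ ?_ ⟨by simp, by simp, fun _ _ => by simp, by simp⟩ ?_
  · rintro k hk ⟨M, r', o⟩ ⟨rfl, rfl, hS, e4⟩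
    refine ⟨hS, by simp [Expr.Prec, hprec], ?_⟩
    simp only at *
    simp only [Expr.eval, heval, e4]
    omega
  · rintro k hk ⟨M, r', o⟩ ⟨rfl, rfl, hS, e4⟩
    simp only at *
    have hlen : k < r.length := by omega
    rw [List.drop_eq_getElem_cons hlen]
    refine WP.seq <| WP.flip hS trivial fun hS1 => ?_
    refine WP.seq <| WP.emit hS1 trivial ?_
    refine WP.store (j := 0) (v := (k + 1 : ℕ)) hS1 trivial (by simp [Expr.Prec]) rfl
      (by simp [Expr.eval, write_apply, e4]) (abs_natCast_le_two_pow hk) fun hS2 => ?_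
    refine ⟨?_, rfl, hS2, by simp [write_apply]⟩
    rw [List.take_add_one, List.getElem?_eq_getElem hlen]
    simp only [Expr.eval, write_apply, Option.toList_some]
    congr 2
    cases r[k] <;> simp
  · rintro ⟨M, r', o⟩ ⟨h1, -⟩
    exact h1

/-- With Z = n the logic charges O(n²) for each of the O(n) rounds. This coarse count gives the n³
of the theorem. -/
theorem emitCoins_time_le : ∃ c : ℕ, ∀ n, 0 < n → emitCoins.time (n + 5) ≤ c * n ^ 3 := by
  refine ⟨7 * (6 ^ 2 * ((nE.sz + 2 + 1 + 1) ^ 2 + 100)), fun n hn => ?_⟩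
  have h1 : n + 5 ≤ 6 * n := by omega
  have h2 : n + 5 + 1 ≤ 7 * n := by omega
  simp only [emitCoins, Prog.time, Expr.sz]
  calc _ ≤ (7 * n) * (((nE.sz + 2 + 1 + 1) ^ 2 + 100) * (6 * n) ^ 2) := by
        refine Nat.mul_le_mul h2 ?_
        have h3 : (n + 5) ^ 2 ≤ (6 * n) ^ 2 := Nat.pow_le_pow_left h1 2
        refine le_trans ?_ (Nat.mul_le_mul_left _ h3)
        norm_num
        nlinarith
    _ = _ := by ring

theorem samples_uniform {D : Data} {P : Prog} {n T : ℕ} (hn : n ≤ T)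
    (h : ∀ r : List Bool, n ≤ r.length → ∃ t ≤ T, ∃ s,
      Exec D P ⟨fun _ _ => 0, r, []⟩ t s ∧ s.out = r.take n) :
    ∃ Q : PMF (Fin n → Bool), Samples P D T Q ∧ ∀ x, (Q x).toReal = (1 / 2) ^ n := by
  obtain ⟨T', rfl⟩ := Nat.exists_eq_add_of_le hn
  refine ⟨_, ⟨fun r i => r (Fin.castAdd T' i), fun r => ?_, rfl⟩, fun x => ?_⟩
  · obtain ⟨t, ht, s, h1, h2⟩ := h (List.ofFn r) (by simp)
    refine ⟨t, ht, s, h1, h2.trans ?_⟩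
    refine List.ext_getElem (by simp) fun i _ _ => ?_
    simp [Fin.castAdd, Fin.castLE]
  · rw [toReal_map_uniform, expect_castAdd n T' (fun y => if y = x then 1 else 0),
      Fintype.expect_eq_sum_div_card]
    simp

/-! ### The complete sampler -/

/-- The sampler: uniform bits if the noise is strong enough for the precision, and a sample of the
signed mixture otherwise. -/
def iqpSampler (c : ℕ) : Prog :=
  .branch (.sub (.add nE (.lit 1)) εE) emitCoins <|
    .branch (.sub dE (.mul (.lit c) (.mul εE εE))) emitCoins drawSample

/-- Unlike in `WP.branch`, the length bound Z of the test is independent of the time bound T of the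
branches. The two cheap tests are thus not charged for the long numbers of `drawSample`. -/
theorem exists_exec_branch {D : Data} {e : Expr} {P Q : Prog} {s : State} {Z T : ℕ}
    {Φ : State → Prop} (hM : Small Z s.mem) (he : e.Prec D s.mem Z)
    (hP : 0 < e.eval D s.mem → ∃ t ≤ T, ∃ s', Exec D P s t s' ∧ Φ s')
    (hQ : ¬ 0 < e.eval D s.mem → ∃ t ≤ T, ∃ s', Exec D Q s t s' ∧ Φ s') :
    ∃ t ≤ 2 * (e.sz * (Z + 5)) ^ 2 + T, ∃ s', Exec D (.branch e P Q) s t s' ∧ Φ s' := by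
  obtain ⟨h1, h2⟩ := e.bounds hM he
  have h3 : e.sz * (Z + 5) ≤ (e.sz * (Z + 5)) ^ 2 := Nat.le_self_pow (by norm_num) _
  by_cases h : 0 < e.eval D s.mem
  · obtain ⟨t, ht, s', h4, h5⟩ := hP h
    exact ⟨_, by omega, s', .branch_pos e P Q s s' t h h4, h5⟩
  · obtain ⟨t, ht, s', h4, h5⟩ := hQ h
    exact ⟨_, by omega, s', .branch_neg e P Q s s' t h h4, h5⟩

/-- Reading the depth costs about the square of its bit length, which has to fit into the single
factor d of the time bound. -/
theorem size_sq_le {d : ℕ} (hd : 0 < d) : d.size ^ 2 ≤ 4 * d := by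
  have key : ∀ s : ℕ, (s + 1) ^ 2 ≤ 4 * 2 ^ s := by
    intro s
    induction s with
    | zero => norm_num
    | succ s ih =>
      rcases Nat.lt_or_ge s 2 with h | h
      · interval_cases s <;> norm_num
      · rw [pow_succ 2 s]; nlinarith
  obtain ⟨s, hs⟩ : ∃ s, d.size = s + 1 :=
    ⟨d.size - 1, by have := Nat.size_pos.mpr hd; omega⟩
  have h : 2 ^ s ≤ d := Nat.lt_size.mp (by omega)
  rw [hs]
  exact (key s).trans (by omega)

/-- The first test handles n and E, the second d and E. For the second the length bound is the bit
length of d plus E; using d itself would cost d². The coefficient a depends on c, which occurs in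
the program as a literal. -/
theorem exists_exec_iqpSampler (c : ℕ) : ∃ a : ℕ, 0 < a ∧ ∀ (D : Data) (n d E : ℕ) (r : List Bool)
    (T : ℕ) (Φ : State → Prop), D.ints.getD 0 0 = (n : ℤ) → D.ints.getD 1 0 = (d : ℤ) →
    D.ints.getD 2 0 = (E : ℤ) → 0 < n → 0 < d →
    (E ≤ n ∨ c * E ^ 2 < d → n ≤ r.length ∧ ∀ s : State, s.out = r.take n → Φ s) →
    (¬ (E ≤ n ∨ c * E ^ 2 < d) →
      ∃ t ≤ T, ∃ s, Exec D drawSample ⟨fun _ _ => 0, r, []⟩ t s ∧ Φ s) →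
    ∃ t ≤ a * (n ^ 3 * d * (E + 6) ^ 2) + T, ∃ s,
      Exec D (iqpSampler c) ⟨fun _ _ => 0, r, []⟩ t s ∧ Φ s := by
  obtain ⟨cU, hcU⟩ := emitCoins_time_le
  refine ⟨200 + 8 * (c + 15) ^ 2 + cU, by omega,
    fun D n d E r T Φ hn' hd' hE' hn hd hU hdraw => ?_⟩
  have hM0 : ∀ Z, Small Z (fun _ _ => 0) := fun Z _ _ => by simp
  set U := emitCoins.time (n + 5)
  have hUΦ : E ≤ n ∨ c * E ^ 2 < d →
      ∃ t ≤ U + T, ∃ s, Exec D emitCoins ⟨fun _ _ => 0, r, []⟩ t s ∧ Φ s := fun h => by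
    obtain ⟨hr, hΦ⟩ := hU h
    obtain ⟨t, ht, s, h1, h2⟩ := emitCoins_spec hn' hr
    exact ⟨t, ht.trans (Nat.le_add_right _ _), s, h1, hΦ s h2⟩
  have hsz : d ≤ 2 ^ d.size := (Nat.lt_size_self d).le
  have he1 : (Expr.sub (.add nE (.lit 1)) εE).eval D (fun _ _ => 0) = n + 1 - E := by
    simp only [Expr.eval, nE, εE]
    rw [← hn', ← hE']; rfl
  have he2 : (Expr.sub dE (.mul (.lit c) (.mul εE εE))).eval D (fun _ _ => 0) = d - c * (E * E) := by
    simp only [Expr.eval, dE, εE]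
    rw [← hd', ← hE']; rfl
  have hE1 : ∀ Z, E ≤ Z → εE.Prec D (fun _ _ => 0) Z := fun Z h =>
    ⟨trivial, (congrArg abs hE').trans_le (abs_natCast_le_two_pow h)⟩
  have main := exists_exec_branch (Φ := Φ) (P := emitCoins)
    (Q := .branch (.sub dE (.mul (.lit c) (.mul εE εE))) emitCoins drawSample)
    (T := 2 * ((Expr.sub dE (.mul (.lit c) (.mul εE εE))).sz * (d.size + E + 5)) ^ 2 + (U + T))
    (e := .sub (.add nE (.lit 1)) εE) (s := ⟨fun _ _ => 0, r, []⟩) (Z := n + E)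
    (hM0 _) ⟨⟨⟨trivial, (congrArg abs hn').trans_le (abs_natCast_le_two_pow (by omega))⟩, trivial⟩,
      hE1 _ (by omega)⟩ ?_ ?_
  · obtain ⟨t, ht, h⟩ := main
    refine ⟨t, ht.trans ?_, h⟩
    have s1 : (Expr.sub (.add nE (.lit 1)) εE).sz = 10 := rfl
    have s2 : (Expr.sub dE (.mul (.lit c) (.mul εE εE))).sz = c + 15 := by
      simp only [Expr.sz, dE, εE, Int.natAbs_natCast]; norm_num; ring
    rw [s1, s2]
    have hs := Nat.size_pos.mpr hd
    have b1 : n + E + 5 ≤ n * (E + 6) := by nlinarith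
    have b2 : d.size + E + 5 ≤ d.size * (E + 6) := by nlinarith
    have c1 : n ^ 2 * (E + 6) ^ 2 ≤ n ^ 3 * d * (E + 6) ^ 2 := by
      refine Nat.mul_le_mul_right _ ?_
      calc n ^ 2 = n ^ 2 * 1 * 1 := by ring
        _ ≤ n ^ 2 * n * d := by gcongr <;> omega
        _ = _ := by ring
    have c2 : d * (E + 6) ^ 2 ≤ n ^ 3 * d * (E + 6) ^ 2 := by
      refine Nat.mul_le_mul_right _ ?_
      exact Nat.le_mul_of_pos_left _ (by positivity)
    have c3 : n ^ 3 ≤ n ^ 3 * d * (E + 6) ^ 2 := by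
      rw [mul_assoc]
      exact Nat.le_mul_of_pos_right _ (by positivity)
    have t1 : 2 * (10 * (n + E + 5)) ^ 2 ≤ 200 * (n ^ 3 * d * (E + 6) ^ 2) := by
      calc 2 * (10 * (n + E + 5)) ^ 2 ≤ 2 * (10 * (n * (E + 6))) ^ 2 := by gcongr
        _ = 200 * (n ^ 2 * (E + 6) ^ 2) := by ring
        _ ≤ _ := by gcongr
    have t2 : 2 * ((c + 15) * (d.size + E + 5)) ^ 2 ≤
        8 * (c + 15) ^ 2 * (n ^ 3 * d * (E + 6) ^ 2) := by
      calc 2 * ((c + 15) * (d.size + E + 5)) ^ 2 ≤ 2 * ((c + 15) * (d.size * (E + 6))) ^ 2 := by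
            gcongr
        _ = 2 * (c + 15) ^ 2 * (d.size ^ 2 * (E + 6) ^ 2) := by ring
        _ ≤ 2 * (c + 15) ^ 2 * (4 * d * (E + 6) ^ 2) := by gcongr; exact size_sq_le hd
        _ = 8 * (c + 15) ^ 2 * (d * (E + 6) ^ 2) := by ring
        _ ≤ _ := by gcongr
    have t3 : U ≤ cU * (n ^ 3 * d * (E + 6) ^ 2) := (hcU n hn).trans (Nat.mul_le_mul_left _ c3)
    linarith
  · intro h
    obtain ⟨t, ht, h'⟩ := hUΦ (Or.inl (by rw [he1] at h; omega))
    exact ⟨t, ht.trans (Nat.le_add_left _ _), h'⟩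
  · intro h
    refine exists_exec_branch (hM0 _) ⟨⟨trivial, ?_⟩, trivial, hE1 _ (by omega), hE1 _ (by omega)⟩
      (fun h2 => ?_) fun h2 => ?_
    · refine (congrArg abs hd').trans_le ?_
      rw [Nat.abs_cast]
      exact_mod_cast hsz.trans (Nat.pow_le_pow_right (by norm_num) (Nat.le_add_right _ _))
    · refine hUΦ (Or.inr ?_)
      rw [he2] at h2
      zify
      linarith
    · obtain ⟨t, ht, h'⟩ := hdraw fun h' => by
        rcases h' with h' | h'
        · exact h (by rw [he1]; zify at h'; linarith)
        · exact h2 (by rw [he2]; zify at h'; linarith)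
      exact ⟨t, ht.trans (Nat.le_add_left _ _), h'⟩

/-! ### Choice of the parameters and conclusion -/

/-- All quantities are powers of W = ndE up to constants. The worst is the bit length of the
Gaussian power, N (B + N + 14nd), at most 1600·1634·W^6. -/
theorem size_bounds {n d E B N W Z : ℕ} (hn : 0 < n) (hd : 0 < d) (hE : 0 < E)
    (hB : B = 12 * n ^ 2 + n + d + 2 * E + 4) (hN : N = 1600 * E * (n * d) ^ 2)
    (hW : W = n * d * E) (hZ : Z = 10 ^ 7 * W ^ 6) :
    B * (2 + n * (2 + d)) ≤ Z ∧ B + 14 * (n * d) ≤ Z ∧ N * (B + N + 14 * (n * d)) ≤ Z ∧ N ≤ Z ∧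
      n * (d + 3) + 2 ≤ Z ∧ B * (n * (d + 3) + 2) ≤ Z ∧ 3 + d * (n * (n + 1) + 1) ≤ Z ∧
      n ≤ Z ∧ d ≤ Z ∧ E ≤ Z := by
  have hnd : n * d ≤ W := hW ▸ Nat.le_mul_of_pos_right _ hE
  have hnW : n ≤ W := (Nat.le_mul_of_pos_right _ hd).trans hnd
  have hdW : d ≤ W := (Nat.le_mul_of_pos_left _ hn).trans hnd
  have hEW : E ≤ W := hW ▸ Nat.le_mul_of_pos_left _ (Nat.mul_pos hn hd)
  have hW1 : 1 ≤ W := Nat.succ_le_of_lt (hE.trans_le hEW)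
  have w2 : W ≤ W ^ 2 := Nat.le_self_pow (by norm_num) _
  have p : ∀ i, i ≤ 6 → W ^ i ≤ W ^ 6 := fun i hi => Nat.pow_le_pow_right hW1 hi
  have p1 := p 1 (by norm_num)
  have p2 := p 2 (by norm_num)
  have p3 := p 3 (by norm_num)
  have hn2 : n ^ 2 ≤ W ^ 2 := Nat.pow_le_pow_left hnW 2
  have hBW : B ≤ 20 * W ^ 2 := by rw [hB]; nlinarith
  have hNW : N ≤ 1600 * W ^ 3 := by
    rw [hN]
    calc 1600 * E * (n * d) ^ 2 ≤ 1600 * W * W ^ 2 := by gcongr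
      _ = _ := by ring
  have hmW : n * (d + 3) + 2 ≤ 6 * W := by nlinarith
  have hm2 : 2 + n * (2 + d) ≤ 6 * W := by nlinarith
  rw [pow_one] at p1
  refine ⟨?_, ?_, ?_, ?_, ?_, ?_, ?_, ?_, ?_, ?_⟩
  · calc _ ≤ (20 * W ^ 2) * (6 * W) := Nat.mul_le_mul hBW hm2
      _ = 120 * W ^ 3 := by ring
      _ ≤ _ := by omega
  · omega
  · have h : B + N + 14 * (n * d) ≤ 1634 * W ^ 3 := by
      have : W ^ 2 ≤ W ^ 3 := Nat.pow_le_pow_right hW1 (by norm_num)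
      omega
    calc _ ≤ (1600 * W ^ 3) * (1634 * W ^ 3) := Nat.mul_le_mul hNW h
      _ = 2614400 * W ^ 6 := by ring
      _ ≤ _ := by omega
  · omega
  · omega
  · calc _ ≤ (20 * W ^ 2) * (6 * W) := Nat.mul_le_mul hBW hmW
      _ = 120 * W ^ 3 := by ring
      _ ≤ _ := by omega
  · calc 3 + d * (n * (n + 1) + 1) = 3 + (n * d) * n + n * d + d := by ring
      _ ≤ 3 + W * W + W + W := by gcongr
      _ = 3 + W ^ 2 + W + W := by ring
      _ ≤ _ := by omega
  · omega
  · omega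
  · omega

/-- The number B is the exponent obtained from k ≤ 2^k in each factor of the first bound: 4 + 2E + d
+ n, and 12n² for (6n)^(2n). -/
theorem resolution_bounds {n d E B : ℕ} (hn : 0 < n)
    (hB : B = 12 * n ^ 2 + n + d + 2 * E + 4) :
    16 * E ^ 2 * (d * n) * ((6 * n) ^ n) ^ 2 ≤ 2 ^ B ∧ 2 * n * (2 * n - 1) ≤ 2 ^ B ∧
      14 * E * (n * d) ≤ 2 ^ B := by
  have lt : ∀ k : ℕ, k ≤ 2 ^ k := fun k => Nat.lt_two_pow_self.le
  have h1 : 16 * E ^ 2 * (d * n) * ((6 * n) ^ n) ^ 2 ≤ 2 ^ B := by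
    calc 16 * E ^ 2 * (d * n) * ((6 * n) ^ n) ^ 2
        ≤ 2 ^ 4 * (2 ^ E) ^ 2 * (2 ^ d * 2 ^ n) * (((2 ^ (6 * n))) ^ n) ^ 2 := by
          gcongr
          · norm_num
          · exact lt E
          · exact lt d
          · exact lt n
          · exact lt (6 * n)
      _ = 2 ^ B := by rw [hB]; ring
  refine ⟨h1, ?_, ?_⟩
  · calc 2 * n * (2 * n - 1) ≤ 2 * n * (2 * n) := Nat.mul_le_mul_left _ (by omega)
      _ = 4 * n ^ 2 := by ring
      _ ≤ B := by omega
      _ ≤ _ := lt B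
  · calc 14 * E * (n * d) ≤ 2 ^ 4 * 2 ^ E * (2 ^ n * 2 ^ d) := by
          gcongr
          · norm_num
          · exact lt E
          · exact lt n
          · exact lt d
      _ = 2 ^ (4 + E + n + d) := by ring
      _ ≤ 2 ^ B := Nat.pow_le_pow_right (by norm_num) (by omega)

theorem tvd_le_of_sum_le {α : Type} [Fintype α] {Q : PMF α} {P : α → ℝ} {a : ℝ}
    (h : ∑ x, |(Q x).toReal - P x| ≤ 2 * a) : tvd Q P ≤ a := by
  rw [tvd]; linarith

/-- A program that falls through to `drawSample` within time `T` approximates the output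
distribution. -/
theorem exists_samples_signed_mixture {n l : ℕ} (C : Circuit n l) {p ε : ℝ} {E T Z : ℕ} {A : Prog}
    (hn : 0 < n) (hd : 0 < C.depth) (hp0 : 0 ≤ p) (hp1 : p ≤ 1) (hE0 : 0 < E)
    (hE : (E : ℤ) = ⌈1 / ε⌉) (hs : Real.sqrt (1 - p) ^ C.depth * (n : ℝ) ^ 4 ≤ 1)
    (hZ : Z = 10 ^ 7 * (n * C.depth * E) ^ 6) (hZT : Z ≤ T)
    (hA : ∀ (r : List Bool) (Φ : State → Prop), (∃ t ≤ drawSample.time (Z + 5), ∃ s,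
      Exec (instanceData C p ε) drawSample ⟨fun _ _ => 0, r, []⟩ t s ∧ Φ s) →
      ∃ t ≤ T, ∃ s, Exec (instanceData C p ε) A ⟨fun _ _ => 0, r, []⟩ t s ∧ Φ s) :
    ∃ Q : PMF (Fin n → Bool), Samples A (instanceData C p ε) T Q ∧
      ∑ x, |(Q x).toReal - bornProb C p x| ≤ 1 / E := by
  classical
  set d := C.depth with hdd
  have hdl : C.layers.length = d := rfl
  obtain ⟨B, hB⟩ : ∃ B, B = 12 * n ^ 2 + n + d + 2 * E + 4 := ⟨_, rfl⟩
  obtain ⟨N, hN⟩ : ∃ N, N = 1600 * E * (n * d) ^ 2 := ⟨_, rfl⟩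
  obtain ⟨V, hV⟩ : ∃ V, V = 2 ^ B / (2 * n - 1) := ⟨_, rfl⟩
  obtain ⟨m, hm⟩ : ∃ m, m = n + (n + (n + (C.layers.length * n + (1 + 1)))) := ⟨_, rfl⟩
  have hm' : m = n * (C.layers.length + 3) + 2 := by rw [hm]; ring
  obtain ⟨z1, z2, z3, z4, z5, z6, z7, z8, z9, z10⟩ := size_bounds hn hd hE0 hB hN rfl hZ
  obtain ⟨g1, g2, g3⟩ := resolution_bounds (E := E) hn hB
  have hpB : (0 : ℝ) < 2 ^ B := by positivity
  have hfl0 : 0 ≤ ⌊(2 : ℝ) ^ B * p⌋ := Int.floor_nonneg.mpr (by positivity)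
  obtain ⟨P, hP⟩ : ∃ P : ℕ, (P : ℤ) = ⌊(2 : ℝ) ^ B * p⌋ :=
    ⟨_, Int.toNat_of_nonneg hfl0⟩
  have hPle : (P : ℝ) ≤ 2 ^ B * p := by
    have := Int.floor_le ((2 : ℝ) ^ B * p)
    rw [← hP] at this; exact_mod_cast this
  have hPlt : 2 ^ B * p < (P : ℝ) + 1 := by
    have := Int.lt_floor_add_one ((2 : ℝ) ^ B * p)
    rw [← hP] at this; exact_mod_cast this
  have hPG : P ≤ 2 ^ B := by
    have : (P : ℝ) ≤ 2 ^ B := hPle.trans (mul_le_of_le_one_right hpB.le hp1)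
    exact_mod_cast this
  have hPp : |(P : ℝ) / (2 ^ B : ℕ) - p| ≤ 1 / (2 ^ B : ℕ) := by
    push_cast
    rw [show (P : ℝ) / 2 ^ B - p = (P - 2 ^ B * p) / 2 ^ B by field_simp, abs_div,
      abs_of_pos hpB]
    refine div_le_div_of_nonneg_right ?_ hpB.le
    rw [abs_le]; constructor <;> linarith
  have hD : Header (instanceData C p ε) Z n C.layers.length E :=
    header_instanceData C hE hp0 hp1 z8 z9 z10 z7
  -- The allotted T coins are the m blocks of B that are tossed and T' that are not.
  obtain ⟨T', hT⟩ : ∃ T', T = m * B + T' := Nat.exists_eq_add_of_le (by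
    rw [hm', mul_comm]; exact z6.trans hZT)
  subst hT
  set U : (Fin (m * B + T') → Bool) → Fin m → Fin (2 ^ B) := fun r k =>
    ⟨ofBits (coinAt r) (B * k) B, ofBits_lt _ _ _⟩ with hU
  set F : (Fin m → Fin (2 ^ B)) → Fin n → Bool := fun U =>
    sampler N (2 ^ B) V P C.layers (fun i => decide (drawAt U i < V))
      (fun i => decide (drawAt U (n + i) < 2 ^ B / 2))
      (fun i => decide (drawAt U (n + (n + i)) < 2 ^ B / 2))
      (fun t i => decide (drawAt U (n + (n + (n + (i + n * t)))) < P))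
      (drawAt U (n + (n + (n + (C.layers.length * n)))))
      (drawAt U (n + (n + (n + (C.layers.length * n + 1))))) with hF
  refine ⟨_, ⟨fun r => F (U r), fun r => ?_, rfl⟩, ?_⟩
  · have hcoin : bitsOf (List.ofFn r) = coinAt r := by
      funext k
      by_cases hk : k < m * B + T' <;> simp [bitsOf, coinAt, hk]
    have h := drawSample_spec (Z := Z) (r := List.ofFn r) (R := drawAt (U r)) hD hn hB hN hm' hV
      (by rw [hP]; simp [instanceData]) hPG (fun k hk => by rw [drawAt, dif_pos hk, hcoin])
      (by rw [List.length_ofFn, mul_comm]; exact Nat.le_add_right _ _) z1 z2 z3 z4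
      (by rw [hm']; exact z5) C.inGateSet C.layer_length_le (at_ints_instanceData C p ε)
      (at_reals_instanceData C p ε)
    obtain ⟨t, ht, s, h1, h2⟩ := hA (List.ofFn r) _ h
    refine ⟨t, ht, s, h1, h2.trans ?_⟩
    rw [hF]
    simp only
    rw [show n * (C.layers.length + 3) + 1 = n + (n + (n + (C.layers.length * n + 1))) by ring,
      show n * (C.layers.length + 3) = n + (n + (n + (C.layers.length * n))) by ring]
  · have h := sum_abs_expect_sampler_sub_le C (E := E) (N := N) (G := 2 ^ B) (V := V) (P := P) hn
      hE0 hp0 hp1 (dvd_pow_self 2 (by omega)) (by exact_mod_cast g1) g2 g3 hV hPG hPp hN hd hs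
      C.layer_length_le
    refine le_trans (le_of_eq ?_) h
    refine Finset.sum_congr rfl fun x _ => ?_
    have e := (toReal_map_uniform (fun r => F (U r)) x).trans
      (expect_coins m B T' (fun U => if F U = x then (1 : ℝ) else 0))
    rw [e]
    subst hm
    rfl

end IQP

open IQP RAM in
/-- For `p = 1` the threshold `K * log n / log (1 - p)⁻¹` is `0`, in accordance with
`log (1 - p)⁻¹ = ∞`. -/
theorem theorem1 :
    ∃ K : ℝ, 0 < K ∧
      ∀ (l : ℕ) (p₀ : ℝ), 0 < p₀ →
        ∃ (A : RAM.Prog) (q : Polynomial ℝ),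
          ∀ (n : ℕ) (C : IQP.Circuit n l) (p ε : ℝ),
            0 < n → 0 < C.depth → p₀ ≤ p → p ≤ 1 → 0 < ε →
            K * Real.log n / Real.log (1 - p)⁻¹ ≤ C.depth →
            ∃ (T : ℕ) (Q : PMF (Fin n → Bool)),
              RAM.Samples A (IQP.instanceData C p ε) T Q ∧
              IQP.tvd Q (IQP.bornProb C p) ≤ ε ∧
              (T : ℝ) ≤ (n : ℝ) ^ 3 * C.depth * q.eval (1 / ε) := by
  refine ⟨8, by norm_num, fun l p₀ hp₀ => ?_⟩
  -- With this c, d > c E² forces s ≤ 2/(pd) ≤ 1/E².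
  obtain ⟨c, hc⟩ : ∃ c : ℕ, 2 / p₀ ≤ c := exists_nat_ge _
  have hc2 : 2 ≤ p₀ * c := by rwa [div_le_iff₀' hp₀] at hc
  obtain ⟨a, ha, hA⟩ := exists_exec_iqpSampler c
  obtain ⟨b, k, hb⟩ := drawSample.exists_time_le
  -- The time bound in terms of E; the polynomial q arises from it by E ≤ 1/ε + 1. Where the signed
  -- mixture is used, ndE ≤ c E⁴, hence Z ≤ 10^7 c^6 E^24.
  set f : ℝ → ℝ := fun e => a * (e + 6) ^ 2 + b * ((10 ^ 7 * c ^ 6 + 5) * e ^ 24) ^ k +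
    10 ^ 7 * c ^ 6 * e ^ 24 with hf
  refine ⟨iqpSampler c, Polynomial.C (a : ℝ) * (Polynomial.X + 7) ^ 2 +
    Polynomial.C (b : ℝ) * (Polynomial.C (10 ^ 7 * c ^ 6 + 5 : ℝ) * (Polynomial.X + 1) ^ 24) ^ k +
    Polynomial.C (10 ^ 7 * c ^ 6 : ℝ) * (Polynomial.X + 1) ^ 24,
    fun n C p ε hn hd hpp hp1 hε hdT => ?_⟩
  have hp0 : 0 < p := hp₀.trans_le hpp
  have hs := sqrt_one_sub_pow_mul_le hp0 hp1 hd hn hdT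
  set d := C.depth with hdd
  have hceil : 0 < ⌈1 / ε⌉ := Int.ceil_pos.mpr (by positivity)
  obtain ⟨E, hE⟩ : ∃ E : ℕ, (E : ℤ) = ⌈1 / ε⌉ := ⟨_, Int.toNat_of_nonneg hceil.le⟩
  have hE0 : 0 < E := by omega
  have hER : (0 : ℝ) < E := by exact_mod_cast hE0
  have hEle : 1 / ε ≤ E := by
    have := Int.le_ceil (1 / ε); rw [← hE] at this; exact_mod_cast this
  have hElt : (E : ℝ) ≤ 1 / ε + 1 := by
    have := (Int.ceil_lt_add_one (1 / ε)).le; rw [← hE] at this; exact_mod_cast this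
  have hEε : 1 / (E : ℝ) ≤ ε := by rwa [div_le_comm₀ hER hε]
  have hnR : (1 : ℝ) ≤ n := by exact_mod_cast hn
  have hdR : (1 : ℝ) ≤ d := by exact_mod_cast hd
  have hq : f E ≤ (Polynomial.C (a : ℝ) * (Polynomial.X + 7) ^ 2 +
      Polynomial.C (b : ℝ) * (Polynomial.C (10 ^ 7 * c ^ 6 + 5 : ℝ) *
        (Polynomial.X + 1) ^ 24) ^ k +
      Polynomial.C (10 ^ 7 * c ^ 6 : ℝ) * (Polynomial.X + 1) ^ 24).eval (1 / ε) := by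
    simp only [hf, Polynomial.eval_add, Polynomial.eval_mul, Polynomial.eval_pow,
      Polynomial.eval_C, Polynomial.eval_X, Polynomial.eval_one, Polynomial.eval_ofNat]
    have h1 : (E : ℝ) + 6 ≤ 1 / ε + 7 := by linarith
    generalize 1 / ε + 7 = y at h1
    gcongr
  have hi0 : (instanceData C p ε).ints.getD 0 0 = (n : ℤ) := by simp [instanceData]
  have hi1 : (instanceData C p ε).ints.getD 1 0 = (d : ℤ) := by simp [instanceData, hdd]
  have hi2 : (instanceData C p ε).ints.getD 2 0 = (E : ℤ) := by simp [instanceData, hE]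
  by_cases hcase : E ≤ n ∨ c * E ^ 2 < d
  · set T := a * (n ^ 3 * d * (E + 6) ^ 2) with hT
    have hnT : n ≤ T := by
      have : 0 < a * (n ^ 2 * d * (E + 6) ^ 2) := by positivity
      calc n ≤ n * (a * (n ^ 2 * d * (E + 6) ^ 2)) := Nat.le_mul_of_pos_right _ this
        _ = T := by rw [hT]; ring
    obtain ⟨Q, hQ, hQx⟩ := samples_uniform (D := instanceData C p ε) (P := iqpSampler c) hnT
      fun r hr => hA _ n d E r 0 _ hi0 hi1 hi2 hn hd (fun _ => ⟨hr, fun s hs => hs⟩)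
        fun h => absurd hcase h
    refine ⟨T, Q, hQ, tvd_le_of_sum_le ?_, ?_⟩
    · simp only [hQx]
      refine (sum_abs_uniform_sub_le C hp0.le hp1).trans ?_
      have hs0 : 0 ≤ Real.sqrt (1 - p) ^ d := by positivity
      refine (one_add_pow_sub_one_le (a := 1 / E) hs0 ?_ ?_).trans (by linarith)
      · rw [le_div_iff₀ hER]
        by_cases hEn : E ≤ n
        · have h1 : (E : ℝ) ≤ n := by exact_mod_cast hEn
          -- If E ≤ n, then n s E ≤ n⁴ s ≤ 1.
          calc n * Real.sqrt (1 - p) ^ d * E ≤ n * Real.sqrt (1 - p) ^ d * n ^ 3 := by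
                gcongr
                exact h1.trans (le_self_pow₀ hnR (by norm_num))
            _ = Real.sqrt (1 - p) ^ d * n ^ 4 := by ring
            _ ≤ 1 := hs
        · have h1 : (n : ℝ) ≤ E := by exact_mod_cast (not_le.mp hEn).le
          have h2 : (c : ℝ) * E ^ 2 ≤ d := by
            exact_mod_cast (hcase.resolve_left hEn).le
          have h3 := sqrt_one_sub_pow_le hp0 hp1 hd
          calc n * Real.sqrt (1 - p) ^ d * E ≤ E * (2 / (p * d)) * E := by gcongr
            _ = 2 * E ^ 2 / (p * d) := by ring
            _ ≤ 1 := by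
              rw [div_le_one (by positivity)]
              calc 2 * (E : ℝ) ^ 2 ≤ (p₀ * c) * E ^ 2 := by gcongr
                _ = p₀ * (c * E ^ 2) := by ring
                _ ≤ p * d := by gcongr
      · rw [div_le_one hER]; exact_mod_cast hE0
    · refine le_trans ?_ (mul_le_mul_of_nonneg_left hq (by positivity))
      rw [hT, hf]
      push_cast
      have : (0 : ℝ) ≤ n ^ 3 * d * (b * ((10 ^ 7 * c ^ 6 + 5) * E ^ 24) ^ k +
        10 ^ 7 * c ^ 6 * E ^ 24) := by positivity
      linarith
  · obtain ⟨Z, hZ⟩ : ∃ Z, Z = 10 ^ 7 * (n * d * E) ^ 6 := ⟨_, rfl⟩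
    push Not at hcase
    obtain ⟨hnE, hdE⟩ := hcase
    set T := a * (n ^ 3 * d * (E + 6) ^ 2) + (drawSample.time (Z + 5) + Z) with hT
    obtain ⟨Q, hQ, hQx⟩ := exists_samples_signed_mixture C (T := T) (A := iqpSampler c) hn hd
      hp0.le hp1 hE0 hE hs hZ (by omega) fun r Φ h =>
        hA _ n d E r _ Φ hi0 hi1 hi2 hn hd (fun h' => absurd h' (by push Not; exact ⟨hnE, hdE⟩))
          fun _ => by
            obtain ⟨t, ht, h⟩ := h
            exact ⟨t, ht.trans (Nat.le_add_right _ _), h⟩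
    refine ⟨T, Q, hQ, tvd_le_of_sum_le (hQx.trans ?_), ?_⟩
    · linarith [one_div_pos.mpr hER]
    · refine le_trans ?_ (mul_le_mul_of_nonneg_left hq (by positivity))
      have hZE : Z ≤ 10 ^ 7 * c ^ 6 * E ^ 24 := by
        calc Z = 10 ^ 7 * (n * d * E) ^ 6 := hZ
          _ ≤ 10 ^ 7 * (E * (c * E ^ 2) * E) ^ 6 := by gcongr
          _ = _ := by ring
      have hZ5 : Z + 5 ≤ (10 ^ 7 * c ^ 6 + 5) * E ^ 24 := by
        have : 1 ≤ E ^ 24 := Nat.one_le_pow _ _ hE0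
        linarith
      have htime : drawSample.time (Z + 5) ≤ b * ((10 ^ 7 * c ^ 6 + 5) * E ^ 24) ^ k :=
        (hb (Z + 5) (by omega)).trans (Nat.mul_le_mul_left _ (Nat.pow_le_pow_left hZ5 k))
      have h1 : ((drawSample.time (Z + 5) + Z : ℕ) : ℝ) ≤
          b * ((10 ^ 7 * c ^ 6 + 5) * E ^ 24) ^ k + 10 ^ 7 * c ^ 6 * E ^ 24 := by
        exact_mod_cast Nat.add_le_add htime hZE
      -- The cost of the signed mixture now depends on E alone and is absorbed because n³ d ≥ 1.
      have h2 : (1 : ℝ) ≤ n ^ 3 * d := one_le_mul_of_one_le_of_one_le (one_le_pow₀ hnR) hdR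
      have h3 : (0 : ℝ) ≤ b * ((10 ^ 7 * c ^ 6 + 5) * E ^ 24) ^ k + 10 ^ 7 * c ^ 6 * E ^ 24 := by
        positivity
      have h4 := h1.trans (le_mul_of_one_le_left h3 h2)
      rw [hT, hf, Nat.cast_add]
      push_cast at h4 ⊢
      linarith
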